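/- **Setting.** Let $Q\subset\mathbb R^N$ be a bounded open set, $(\Omega,\mathscr M,\mu)$ a probability space, and $\{T(x):\Omega\to\Omega,\ x\in\mathbb R^N\}$ an $N$-dimensional dynamical system: $T(0)=\mathrm{id}$, $T(x+y)=T(x)\circ T(y)$, every $T(x)$ is measurable and $\mu$-preserving, and $(x,\omega)\mapsto T(x)\omega$ is measurable with respect to the product of the Lebesgue $\sigma$-algebra of $\mathbb R^N$ and $\mathscr M$. Let $\Phi:[0,\infty)\to[0,\infty)$ be a Young function (continuous, convex, positive on $(0,\infty)$, $\Phi(t)/t\to0$ as $t\to0$, $\Phi(t)/t\to\infty$ as $t\to\infty$) with conjugate $\widetilde\Phi(t)=\sup_{s\ge0}(st-\Phi(s))$. $\Psi\in\Delta_2$ means: there are $t_0>0$, $k>2$ with $\Psi(2t)\le k\Psi(t)$ for all $t\ge t_0$. $\Psi\in\Delta'$ means: there is $\beta>0$ with $\Psi(ts)\le\beta\,\Psi(t)\Psi(s)$ for all $t,s\ge0$. For a measure space $X$ and a normed space $F$, $L^\Phi(X;F)$ is the space of (classes of) strongly measurable $f:X\to F$ with $\int_X\Phi(\|f\|/\delta)<\infty$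 for some $\delta>0$; $L^\Phi(X)=L^\Phi(X;\mathbb R)$ carries the Luxemburg norm $\|f\|_{L^\Phi(X)}=\inf\{\delta>0:\int_X\Phi(|f|/\delta)\le1\}$. $\mathcal C^\infty(\Omega)$ is the space of $f\in L^\infty(\Omega)$ all of whose iterated stochastic derivatives exist, where $D_if=\lim_{t\to0}t^{-1}(f\circ T(te_i)-f)$ in $L^\infty(\Omega)$, and $D_\omega f=(D_1f,\dots,D_Nf)$. $W^1_\#L^\Phi(\Omega)$ is the completion of $\mathcal C^\infty(\Omega)$ for the seminorm $\sum_{i}\|D_if\|_{L^\Phi(\Omega)}$, and $\overline D_\omega:W^1_\#L^\Phi(\Omega)\to L^\Phi(\Omega)^N$ is the extension of $D_\omega$ by continuity. $I^\Phi_{nv}(\Omega)$ is the space of $f\in L^\Phi(\Omega)$ such that, for every $x\in\mathbb R^N$, $f\circ T(x)=f$ $\mu$-a.e. $W^1L^\Phi_{D_x}(Q;L^\Phi(\Omega))$ is the space of $v\in L^\Phi(Q\times\Omega)$ whose distributional derivatives $\partial v/\partial x_i$ on $Q$ belong to $L^\Phi(Q\times\Omega)$ for $1\le i\le N$, $D_xv$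 is the vector of these derivatives, and $W^1L^\Phi_{D_x}(Q;I^\Phi_{nv}(\Omega))$ is the space of those $v$ for which $v(x,\cdot)$ and all $\frac{\partial v}{\partial x_i}(x,\cdot)$ lie in $I^\Phi_{nv}(\Omega)$ for a.e. $x\in Q$. For a sequence $\epsilon\to0$, $\epsilon>0$, a sequence $(v_\epsilon)$ in $L^\Phi(Q\times\Omega)$ converges weakly stochastically two-scale in the mean to $v_0\in L^\Phi(Q\times\Omega)$ if $$\lim_{\epsilon\to0}\iint_{Q\times\Omega}v_\epsilon(x,\omega)\,f(x,T(\epsilon^{-1}x)\omega)\,dx\,d\mu=\iint_{Q\times\Omega}v_0(x,\omega)\,f(x,\omega)\,dx\,d\mu$$ for every $f\in\mathcal C^\infty_0(Q)\otimes\mathcal C^\infty(\Omega)$, i.e. every finite sum $f(x,\omega)=\sum_j\varphi_j(x)\psi_j(\omega)$ with $\varphi_j\in\mathcal C_0^\infty(Q)$, $\psi_j\in\mathcal C^\infty(\Omega)$. For vector-valued sequences this is meant component by component. **Theorem (Compactness 2).** Let $\Phi\in\Delta_2$ and $\widetilde\Phi\in\Delta_2$, let $E=(\epsilon_n)_{n\ge0}$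 be a sequence of positive numbers with $\epsilon_n\to0$, and let $(u_\epsilon)_{\epsilon\in E}$ be a sequence in $W^1L^\Phi_{D_x}(Q;L^\Phi(\Omega))$ such that $(u_\epsilon)$ is bounded in $L^\Phi(Q\times\Omega)$ and $(D_xu_\epsilon)$ is bounded in $L^\Phi(Q\times\Omega)^N$. Then there exist $u_0\in W^1L^\Phi_{D_x}(Q;I^\Phi_{nv}(\Omega))$, $u_1\in L^1(Q;W^1_\#L^\Phi(\Omega))$ with $\overline D_\omega u_1\in L^\Phi(Q\times\Omega)^N$, and a subsequence $E'$ of $E$ such that, as $E'\ni\epsilon\to0$, * $u_\epsilon\to u_0$ weakly stochastically two-scale in the mean, and * $D_xu_\epsilon\to D_xu_0+\overline D_\omega u_1$ weakly stochastically two-scale in the mean. Moreover, if $\widetilde\Phi\in\Delta'$, then this $u_1$ belongs to $L^\Phi(Q;W^1_\#L^\Phi(\Omega))$. -/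

import Mathlib

open MeasureTheory Filter Topology Set
open scoped NNReal ENNReal

namespace StochTwoScale

/-- A Young function `Φ : [0,∞) → [0,∞)`: continuous, convex, positive off `0`, with
`Φ(t)/t → 0` as `t → 0` and `Φ(t)/t → ∞` as `t → ∞`. -/
structure YoungFunction where
  toFun : ℝ≥0 → ℝ≥0
  continuous' : Continuous toFun
  convex' : ConvexOn ℝ≥0 univ toFun
  pos' : ∀ t, 0 < t → 0 < toFun t
  tendsto_zero' : Tendsto (fun t => toFun t / t) (𝓝[>] 0) (𝓝 0)
  tendsto_top' : Tendsto (fun t => toFun t / t) atTop atTop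

instance : CoeFun YoungFunction (fun _ => ℝ≥0 → ℝ≥0) := ⟨YoungFunction.toFun⟩

/-- The Fenchel conjugate `t ↦ sup_{s ≥ 0} (s t - Φ(s))`. The subtraction is that of `ℝ≥0`
(truncated at `0`), which does not change the supremum, since the term `s = 0` is `0`. -/
noncomputable def YoungFunction.conj (Φ : YoungFunction) (t : ℝ≥0) : ℝ≥0 :=
  ⨆ s : ℝ≥0, (s * t - Φ s)

/-- The `Δ₂`-condition at infinity. -/
def Delta2 (Ψ : ℝ≥0 → ℝ≥0) : Prop :=
  ∃ t₀ k : ℝ≥0, 0 < t₀ ∧ 2 < k ∧ ∀ t, t₀ ≤ t → Ψ (2 * t) ≤ k * Ψ t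

/-- The `Δ'`-condition. -/
def DeltaPrime (Ψ : ℝ≥0 → ℝ≥0) : Prop :=
  ∃ β : ℝ≥0, 0 < β ∧ ∀ t s, Ψ (t * s) ≤ β * (Ψ t * Ψ s)

namespace YoungFunction

variable (Φ : YoungFunction)

theorem map_zero : Φ 0 = 0 := by
  have h1 : Tendsto (fun t : ℝ≥0 => Φ t / t * t) (𝓝[>] 0) (𝓝 (0 * 0)) :=
    Φ.tendsto_zero'.mul (tendsto_id.mono_left nhdsWithin_le_nhds)
  have h2 : Tendsto Φ (𝓝[>] 0) (𝓝 (Φ 0)) :=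
    (Φ.continuous'.tendsto 0).mono_left nhdsWithin_le_nhds
  have h3 : Tendsto Φ (𝓝[>] 0) (𝓝 (0 * 0)) := by
    refine h1.congr' ?_
    filter_upwards [self_mem_nhdsWithin] with t ht
    exact div_mul_cancel₀ _ (ne_of_gt ht)
  simpa using tendsto_nhds_unique h2 h3

theorem map_mul_le {c : ℝ≥0} (hc : c ≤ 1) (t : ℝ≥0) : Φ (c * t) ≤ c * Φ t := by
  have := Φ.convex'.2 (mem_univ t) (mem_univ 0) (zero_le (a := c)) (zero_le (a := 1 - c))
    (add_tsub_cancel_of_le hc)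
  simpa [Φ.map_zero] using this

theorem mono : Monotone Φ := by
  intro s t hst
  rcases eq_or_ne t 0 with rfl | ht
  · rw [nonpos_iff_eq_zero.1 hst]
  · have h : s / t ≤ 1 := div_le_one_of_le₀ hst zero_le
    calc Φ s = Φ (s / t * t) := by rw [div_mul_cancel₀ _ ht]
      _ ≤ s / t * Φ t := Φ.map_mul_le h t
      _ ≤ 1 * Φ t := by gcongr
      _ = Φ t := one_mul _

theorem map_add_div_le {a b : ℝ≥0} (ha : 0 < a) (hb : 0 < b) (s t : ℝ≥0) :
    Φ ((s + t) / (a + b)) ≤ a / (a + b) * Φ (s / a) + b / (a + b) * Φ (t / b) := by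
  have hab : a + b ≠ 0 := (add_pos ha hb).ne'
  have h := Φ.convex'.2 (mem_univ (s / a)) (mem_univ (t / b)) (zero_le (a := a / (a + b)))
    (zero_le (a := b / (a + b))) (by rw [← add_div, div_self hab])
  have e : (a / (a + b)) • (s / a) + (b / (a + b)) • (t / b) = (s + t) / (a + b) := by
    simp only [smul_eq_mul]
    field_simp
  rw [e] at h
  simpa using h

theorem exists_le_add : ∃ t₀ : ℝ≥0, ∀ t, t ≤ Φ t + t₀ := by
  obtain ⟨t₀, h⟩ := (tendsto_atTop.1 Φ.tendsto_top' 1).exists_forall_of_atTop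
  refine ⟨t₀, fun t => ?_⟩
  rcases le_total t t₀ with h1 | h1
  · exact h1.trans le_add_self
  · rcases eq_or_ne t 0 with rfl | ht
    · exact zero_le
    · have := h t h1
      rw [le_div_iff₀ (pos_iff_ne_zero.2 ht), one_mul] at this
      exact this.trans le_self_add

end YoungFunction

section Orlicz

variable {α : Type*} [MeasurableSpace α] {F : Type*} [NormedAddCommGroup F]

/-- The modular `∫ Φ(‖f‖/δ) dμ`. -/
noncomputable def modular (Φ : YoungFunction) (f : α → F) (μ : Measure α) (δ : ℝ≥0) : ℝ≥0∞ :=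
  ∫⁻ x, (Φ (‖f x‖₊ / δ) : ℝ≥0∞) ∂μ

/-- `f` is (strongly) measurable and `∫ Φ(‖f‖/δ) dμ < ∞` for some `δ > 0`. For real `f` this is
membership in the Orlicz space `L^Φ(μ)`, for `f` with values in a Banach space `F` it is membership
in the Orlicz-Bochner space `L^Φ(μ; F)`. -/
def MemOrlicz (Φ : YoungFunction) (f : α → F) (μ : Measure α) : Prop :=
  AEStronglyMeasurable f μ ∧ ∃ δ : ℝ≥0, 0 < δ ∧ modular Φ f μ δ < ∞

/-- The Luxemburg norm `inf {δ > 0 : ∫ Φ(‖f‖/δ) dμ ≤ 1}`. -/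
noncomputable def luxemburg (Φ : YoungFunction) (f : α → F) (μ : Measure α) : ℝ≥0 :=
  sInf {δ : ℝ≥0 | 0 < δ ∧ modular Φ f μ δ ≤ 1}

variable (Φ : YoungFunction) {μ : Measure α}

theorem modular_congr {f g : α → F} (h : f =ᵐ[μ] g) (δ : ℝ≥0) :
    modular Φ f μ δ = modular Φ g μ δ :=
  lintegral_congr_ae (h.mono fun x hx => by simp only [hx])

theorem modular_anti {f : α → F} {a b : ℝ≥0} (ha : 0 < a) (hab : a ≤ b) :
    modular Φ f μ b ≤ modular Φ f μ a :=
  lintegral_mono fun x => ENNReal.coe_le_coe.2 (Φ.mono (by gcongr))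

theorem aemeasurable_modular {f : α → F} (hf : AEStronglyMeasurable f μ) (δ : ℝ≥0) :
    AEMeasurable (fun x => (Φ (‖f x‖₊ / δ) : ℝ≥0∞)) μ := by
  have h1 : Measurable fun t : ℝ≥0 => (Φ (t / δ) : ℝ≥0∞) :=
    (Φ.continuous'.measurable.comp (measurable_id.div_const δ)).coe_nnreal_ennreal
  exact h1.comp_aemeasurable hf.nnnorm.aemeasurable

theorem modular_add_le {f g : α → F} (hf : AEStronglyMeasurable f μ) {a b : ℝ≥0}
    (ha : 0 < a) (hb : 0 < b) :
    modular Φ (f + g) μ (a + b) ≤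
      (a / (a + b) : ℝ≥0) * modular Φ f μ a + (b / (a + b) : ℝ≥0) * modular Φ g μ b := by
  unfold modular
  rw [← lintegral_const_mul' _ _ ENNReal.coe_ne_top, ← lintegral_const_mul' _ _ ENNReal.coe_ne_top,
    ← lintegral_add_left' ((aemeasurable_modular Φ hf a).const_mul _)]
  refine lintegral_mono fun x => ?_
  have : ‖(f + g) x‖₊ / (a + b) ≤ (‖f x‖₊ + ‖g x‖₊) / (a + b) := by
    gcongr
    exact nnnorm_add_le _ _
  have h := ENNReal.coe_le_coe.2 ((Φ.mono this).trans (Φ.map_add_div_le ha hb _ _))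
  rwa [ENNReal.coe_add, ENNReal.coe_mul, ENNReal.coe_mul] at h

theorem modular_add_le_one {f g : α → F} (hf : AEStronglyMeasurable f μ) {a b : ℝ≥0}
    (ha : 0 < a) (hb : 0 < b) (h1 : modular Φ f μ a ≤ 1) (h2 : modular Φ g μ b ≤ 1) :
    modular Φ (f + g) μ (a + b) ≤ 1 := by
  refine (modular_add_le Φ hf ha hb).trans ?_
  calc _ ≤ ((a / (a + b) : ℝ≥0) : ℝ≥0∞) * 1 + ((b / (a + b) : ℝ≥0) : ℝ≥0∞) * 1 := by gcongr
    _ = 1 := by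
      rw [mul_one, mul_one, ← ENNReal.coe_add, ← add_div, div_self (add_pos ha hb).ne']
      rfl

theorem modular_smul [NormedSpace ℝ F] (f : α → F) {c : ℝ} (hc : c ≠ 0) (δ : ℝ≥0) :
    modular Φ (c • f) μ (‖c‖₊ * δ) = modular Φ f μ δ := by
  unfold modular
  refine lintegral_congr fun x => ?_
  rw [Pi.smul_apply, nnnorm_smul, mul_div_mul_left _ _ (nnnorm_ne_zero_iff.2 hc)]

theorem exists_modular_le_one {f : α → F} (h : ∃ δ : ℝ≥0, 0 < δ ∧ modular Φ f μ δ < ∞) :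
    ∃ δ : ℝ≥0, 0 < δ ∧ modular Φ f μ δ ≤ 1 := by
  obtain ⟨δ, hδ, hf⟩ := h
  obtain ⟨M, hM⟩ : ∃ M : ℝ≥0, modular Φ f μ δ = M := ⟨_, (ENNReal.coe_toNNReal hf.ne).symm⟩
  have hK : (0 : ℝ≥0) < M + 1 := by positivity
  refine ⟨(M + 1) * δ, by positivity, ?_⟩
  calc modular Φ f μ ((M + 1) * δ)
      ≤ ∫⁻ x, ((M + 1)⁻¹ : ℝ≥0) * (Φ (‖f x‖₊ / δ) : ℝ≥0∞) ∂μ := by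
        refine lintegral_mono fun x => ?_
        rw [← ENNReal.coe_mul]
        refine ENNReal.coe_le_coe.2 ?_
        have e : ‖f x‖₊ / ((M + 1) * δ) = (M + 1)⁻¹ * (‖f x‖₊ / δ) := by
          field_simp
        rw [e]
        exact Φ.map_mul_le (inv_le_one_of_one_le₀ le_add_self) _
    _ = ((M + 1)⁻¹ : ℝ≥0) * (M : ℝ≥0∞) := by
        rw [lintegral_const_mul' _ _ ENNReal.coe_ne_top, ← hM]
        rfl
    _ ≤ 1 := by
        rw [← ENNReal.coe_mul]
        refine ENNReal.coe_le_one_iff.2 ?_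
        rw [inv_mul_le_iff₀ hK, mul_one]
        exact le_self_add

theorem modular_le_one_of_lt {f : α → F} (h : ∃ δ : ℝ≥0, 0 < δ ∧ modular Φ f μ δ < ∞)
    {a : ℝ≥0} (ha : luxemburg Φ f μ < a) : modular Φ f μ a ≤ 1 := by
  obtain ⟨b, ⟨hb, hb1⟩, hba⟩ := exists_lt_of_csInf_lt (exists_modular_le_one Φ h) ha
  exact (modular_anti Φ hb hba.le).trans hb1

theorem luxemburg_le {f : α → F} {a : ℝ≥0} (ha : 0 < a) (h : modular Φ f μ a ≤ 1) :
    luxemburg Φ f μ ≤ a :=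
  csInf_le' ⟨ha, h⟩

theorem modular_zero (δ : ℝ≥0) : modular Φ (0 : α → F) μ δ = 0 := by
  simp [modular, Φ.map_zero]

theorem luxemburg_congr {f g : α → F} (h : f =ᵐ[μ] g) : luxemburg Φ f μ = luxemburg Φ g μ := by
  unfold luxemburg
  simp only [modular_congr Φ h]

theorem luxemburg_zero : luxemburg Φ (0 : α → F) μ = 0 := by
  refine le_antisymm (le_of_forall_pos_le_add fun a ha => ?_) zero_le
  rw [zero_add]
  exact luxemburg_le Φ ha (by simp [modular_zero])

theorem luxemburg_add_le {f g : α → F} (hf : MemOrlicz Φ f μ) (hg : MemOrlicz Φ g μ) :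
    luxemburg Φ (f + g) μ ≤ luxemburg Φ f μ + luxemburg Φ g μ := by
  refine le_of_forall_pos_le_add fun ε hε => ?_
  have h2 : 0 < ε / 2 := half_pos hε
  have := luxemburg_le Φ (f := f + g) (a := (luxemburg Φ f μ + ε / 2) + (luxemburg Φ g μ + ε / 2))
    (by positivity) (modular_add_le_one Φ hf.1 (by positivity) (by positivity)
      (modular_le_one_of_lt Φ hf.2 (lt_add_of_pos_right _ h2))
      (modular_le_one_of_lt Φ hg.2 (lt_add_of_pos_right _ h2)))
  refine this.trans (le_of_eq ?_)
  rw [add_add_add_comm, add_halves]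

theorem luxemburg_smul_le [NormedSpace ℝ F] {f : α → F} (hf : MemOrlicz Φ f μ) (c : ℝ) :
    luxemburg Φ (c • f) μ ≤ ‖c‖₊ * luxemburg Φ f μ := by
  rcases eq_or_ne c 0 with rfl | hc
  · simp [luxemburg_zero]
  have hc' : 0 < ‖c‖₊ := nnnorm_pos.2 hc
  refine le_of_forall_pos_le_add fun ε hε => ?_
  have h := luxemburg_le Φ (f := c • f) (a := ‖c‖₊ * (luxemburg Φ f μ + ε / ‖c‖₊)) (by positivity)
    (by
      rw [modular_smul Φ f hc]
      exact modular_le_one_of_lt Φ hf.2 (lt_add_of_pos_right _ (by positivity)))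
  refine h.trans (le_of_eq ?_)
  rw [mul_add, mul_div_cancel₀ _ hc'.ne']

theorem MemOrlicz.add {f g : α → F} (hf : MemOrlicz Φ f μ) (hg : MemOrlicz Φ g μ) :
    MemOrlicz Φ (f + g) μ := by
  obtain ⟨a, ha, ha'⟩ := exists_modular_le_one Φ hf.2
  obtain ⟨b, hb, hb'⟩ := exists_modular_le_one Φ hg.2
  exact ⟨hf.1.add hg.1, a + b, add_pos ha hb,
    (modular_add_le_one Φ hf.1 ha hb ha' hb').trans_lt ENNReal.one_lt_top⟩

theorem MemOrlicz.zero : MemOrlicz Φ (0 : α → F) μ :=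
  ⟨aestronglyMeasurable_zero, 1, one_pos, by simp [modular_zero]⟩

theorem MemOrlicz.smul [NormedSpace ℝ F] {f : α → F} (hf : MemOrlicz Φ f μ) (c : ℝ) :
    MemOrlicz Φ (c • f) μ := by
  rcases eq_or_ne c 0 with rfl | hc
  · simpa using MemOrlicz.zero Φ
  obtain ⟨a, ha, ha'⟩ := hf.2
  exact ⟨hf.1.const_smul c, ‖c‖₊ * a, mul_pos (nnnorm_pos.2 hc) ha, by rwa [modular_smul Φ f hc]⟩

theorem MemOrlicz.congr {f g : α → F} (hf : MemOrlicz Φ f μ) (h : f =ᵐ[μ] g) :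
    MemOrlicz Φ g μ := by
  obtain ⟨a, ha, ha'⟩ := hf.2
  exact ⟨hf.1.congr h, a, ha, by rwa [← modular_congr Φ h]⟩

theorem ae_eq_zero_of_luxemburg_eq_zero {f : α → F} (hf : MemOrlicz Φ f μ)
    (h : luxemburg Φ f μ = 0) : f =ᵐ[μ] 0 := by
  obtain ⟨t₀, ht₀⟩ := Φ.exists_le_add
  have hle : ∀ n : ℕ, modular Φ f μ ((2⁻¹ : ℝ≥0) ^ n) ≤ 1 := fun n =>
    modular_le_one_of_lt Φ hf.2 (by rw [h]; positivity)
  have hfin : ∫⁻ x, liminf (fun n : ℕ => (Φ (‖f x‖₊ / (2⁻¹ : ℝ≥0) ^ n) : ℝ≥0∞)) atTop ∂μ ≤ 1 := by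
    refine (lintegral_liminf_le' fun n => aemeasurable_modular Φ hf.1 _).trans ?_
    exact liminf_le_of_le (by isBoundedDefault) fun b hb => by
      obtain ⟨n, hn⟩ := hb.exists
      exact hn.trans (hle n)
  have hmeas : AEMeasurable
      (fun x => liminf (fun n : ℕ => (Φ (‖f x‖₊ / (2⁻¹ : ℝ≥0) ^ n) : ℝ≥0∞)) atTop) μ := by
    simp only [liminf_eq_iSup_iInf_of_nat']
    exact AEMeasurable.iSup fun n => AEMeasurable.iInf fun i => aemeasurable_modular Φ hf.1 _
  have hae := ae_lt_top' hmeas (hfin.trans_lt ENNReal.one_lt_top).ne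
  filter_upwards [hae] with x hx
  by_contra hne
  have hpos : 0 < ‖f x‖₊ := nnnorm_pos.2 hne
  refine hx.ne (Tendsto.liminf_eq ?_)
  refine ENNReal.tendsto_coe_nhds_top.2 ?_
  have h1 : Tendsto Φ atTop atTop := by
    refine tendsto_atTop.2 fun b => ?_
    filter_upwards [eventually_ge_atTop (b + t₀)] with t ht
    exact le_of_add_le_add_right (ht.trans (ht₀ t))
  refine h1.comp ?_
  have h2 : Tendsto (fun n : ℕ => ‖f x‖₊ * (2 : ℝ≥0) ^ n) atTop atTop :=
    (tendsto_pow_atTop_atTop_of_one_lt one_lt_two).const_mul_atTop hpos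
  refine h2.congr fun n => ?_
  rw [inv_pow, div_inv_eq_mul]

variable (μ)

/-- The Orlicz space `L^Φ(μ)`, as a space of classes of a.e. equal measurable real functions. -/
def orliczSubmodule : Submodule ℝ (α →ₘ[μ] ℝ) where
  carrier := {f | MemOrlicz Φ f μ}
  add_mem' {f g} hf hg := (MemOrlicz.add Φ hf hg).congr Φ (AEEqFun.coeFn_add f g).symm
  zero_mem' := (MemOrlicz.zero Φ).congr Φ AEEqFun.coeFn_zero.symm
  smul_mem' c f hf := (MemOrlicz.smul Φ hf c).congr Φ (AEEqFun.coeFn_smul c f).symm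

/-- The Orlicz space `L^Φ(μ)`. -/
abbrev Orlicz : Type _ := orliczSubmodule Φ μ

noncomputable instance : CoeFun (Orlicz Φ μ) (fun _ => α → ℝ) := ⟨fun f => ((f : α →ₘ[μ] ℝ) : α → ℝ)⟩

/-- `L^Φ(μ)` carries the Luxemburg norm. -/
noncomputable instance : Norm (Orlicz Φ μ) := ⟨fun f => (luxemburg Φ f μ : ℝ)⟩

variable {μ}

theorem Orlicz.norm_def (f : Orlicz Φ μ) : ‖f‖ = (luxemburg Φ f μ : ℝ) := rfl

theorem Orlicz.core : NormedSpace.Core ℝ (Orlicz Φ μ) where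
  norm_nonneg f := NNReal.coe_nonneg _
  norm_smul c f := by
    have key : ∀ (c : ℝ) (f : Orlicz Φ μ), ‖c • f‖ ≤ ‖c‖ * ‖f‖ := fun c f => by
      have h := luxemburg_smul_le Φ f.2 c
      rw [← luxemburg_congr Φ (AEEqFun.coeFn_smul c (f : α →ₘ[μ] ℝ))] at h
      exact_mod_cast h
    refine le_antisymm (key c f) ?_
    rcases eq_or_ne c 0 with rfl | hc
    · rw [norm_zero, zero_mul]
      exact NNReal.coe_nonneg _
    · have h := key c⁻¹ (c • f)
      rw [inv_smul_smul₀ hc, norm_inv] at h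
      rwa [← le_inv_mul_iff₀ (norm_pos_iff.2 hc)]
  norm_triangle f g := by
    have h := luxemburg_add_le Φ f.2 g.2
    rw [← luxemburg_congr Φ (AEEqFun.coeFn_add (f : α →ₘ[μ] ℝ) (g : α →ₘ[μ] ℝ))] at h
    exact_mod_cast h
  norm_eq_zero_iff f := by
    constructor
    · intro h
      have h' : luxemburg Φ f μ = 0 := NNReal.coe_eq_zero.1 h
      have := ae_eq_zero_of_luxemburg_eq_zero Φ f.2 h'
      exact Subtype.ext (AEEqFun.ext (this.trans AEEqFun.coeFn_zero.symm))
    · rintro rfl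
      have : luxemburg Φ ((0 : Orlicz Φ μ) : α → ℝ) μ = 0 := by
        rw [← luxemburg_zero (F := ℝ) Φ (μ := μ)]
        exact luxemburg_congr Φ AEEqFun.coeFn_zero
      rw [Orlicz.norm_def, this]
      rfl

noncomputable instance : NormedAddCommGroup (Orlicz Φ μ) :=
  NormedAddCommGroup.ofCore (Orlicz.core Φ)

noncomputable instance : NormedSpace ℝ (Orlicz Φ μ) := NormedSpace.ofCore (Orlicz.core Φ)

end Orlicz

section OrliczComplete

variable {α : Type*} [MeasurableSpace α] (Φ : YoungFunction) {μ : Measure α}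

instance : CompleteSpace (Orlicz Φ μ) := by
  have hB : ∀ n : ℕ, (0 : ℝ≥0) < 4⁻¹ ^ n := fun n => by positivity
  refine Metric.complete_of_convergent_controlled_sequences (fun n => ((4⁻¹ ^ n : ℝ≥0) : ℝ))
    (fun n => NNReal.coe_pos.2 (hB n)) fun u hu => ?_
  have hmod : ∀ N n m : ℕ, N ≤ n → N ≤ m →
      modular Φ (fun x => u n x - u m x) μ (4⁻¹ ^ N) ≤ 1 := by
    intro N n m hn hm
    have h := hu N n m hn hm
    rw [dist_eq_norm, Orlicz.norm_def, NNReal.coe_lt_coe] at h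
    have h1 := modular_le_one_of_lt Φ (u n - u m).2.2 h
    exact le_of_eq_of_le (modular_congr Φ
      (AEEqFun.coeFn_sub (u n : α →ₘ[μ] ℝ) (u m : α →ₘ[μ] ℝ)).symm _) h1
  have hsm : ∀ n, AEStronglyMeasurable (u n : α → ℝ) μ := fun n => (u n).2.1
  have hmeas : ∀ n m N, AEMeasurable
      (fun x => (Φ (‖u n x - u m x‖₊ / 4⁻¹ ^ N) : ℝ≥0∞)) μ := fun n m N =>
    aemeasurable_modular Φ ((hsm n).sub (hsm m)) _
  obtain ⟨t₀, ht₀⟩ := Φ.exists_le_add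
  have hsum : ∫⁻ x, ∑' N : ℕ, ((2⁻¹ ^ N : ℝ≥0) : ℝ≥0∞) *
      (Φ (‖u N x - u (N + 1) x‖₊ / 4⁻¹ ^ N) : ℝ≥0∞) ∂μ < ⊤ := by
    rw [lintegral_tsum fun N => (hmeas _ _ _).const_mul _]
    refine lt_of_le_of_lt (ENNReal.tsum_le_tsum fun N => ?_)
      (b := ∑' N : ℕ, ((2⁻¹ ^ N : ℝ≥0) : ℝ≥0∞)) ?_
    · rw [lintegral_const_mul' _ _ ENNReal.coe_ne_top]
      calc _ ≤ ((2⁻¹ ^ N : ℝ≥0) : ℝ≥0∞) * 1 := by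
            gcongr
            exact hmod N N (N + 1) le_rfl (Nat.le_succ N)
        _ = _ := mul_one _
    · have : Summable fun N : ℕ => (2⁻¹ : ℝ≥0) ^ N :=
        NNReal.summable_geometric (inv_lt_one_of_one_lt₀ one_lt_two)
      exact (ENNReal.tsum_coe_ne_top_iff_summable.2 this).lt_top
  have hconv : ∀ᵐ x ∂μ, ∃ l, Tendsto (fun n => u n x) atTop (𝓝 l) := by
    filter_upwards [ae_lt_top' (AEMeasurable.tsum fun N => (hmeas _ _ _).const_mul _)
      hsum.ne] with x hx
    obtain ⟨C, hC⟩ : ∃ C : ℝ≥0, ∑' N : ℕ, ((2⁻¹ ^ N : ℝ≥0) : ℝ≥0∞) *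
      (Φ (‖u N x - u (N + 1) x‖₊ / 4⁻¹ ^ N) : ℝ≥0∞) = C := ⟨_, (ENNReal.coe_toNNReal hx.ne).symm⟩
    have hterm : ∀ N : ℕ, ‖u N x - u (N + 1) x‖₊ ≤ (C + t₀) * 2⁻¹ ^ N := by
      intro N
      have h1 : ((2⁻¹ ^ N : ℝ≥0) : ℝ≥0∞) *
          (Φ (‖u N x - u (N + 1) x‖₊ / 4⁻¹ ^ N) : ℝ≥0∞) ≤ C := hC ▸ ENNReal.le_tsum N
      rw [← ENNReal.coe_mul, ENNReal.coe_le_coe] at h1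
      have h2 := ht₀ (‖u N x - u (N + 1) x‖₊ / 4⁻¹ ^ N)
      have h3 : ((2⁻¹ : ℝ≥0) ^ N) * (‖u N x - u (N + 1) x‖₊ / 4⁻¹ ^ N) ≤ C + t₀ := by
        calc _ ≤ ((2⁻¹ : ℝ≥0) ^ N) * (Φ (‖u N x - u (N + 1) x‖₊ / 4⁻¹ ^ N) + t₀) := by gcongr
          _ = ((2⁻¹ : ℝ≥0) ^ N) * Φ (‖u N x - u (N + 1) x‖₊ / 4⁻¹ ^ N) + 2⁻¹ ^ N * t₀ := mul_add _ _ _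
          _ ≤ C + 1 * t₀ := by
            gcongr
            exact pow_le_one₀ zero_le (inv_le_one_of_one_le₀ one_le_two)
          _ = C + t₀ := by rw [one_mul]
      have e : ((2⁻¹ : ℝ≥0) ^ N) * (‖u N x - u (N + 1) x‖₊ / 4⁻¹ ^ N) * 2⁻¹ ^ N
          = ‖u N x - u (N + 1) x‖₊ := by
        have : (4 : ℝ≥0)⁻¹ ^ N = 2⁻¹ ^ N * 2⁻¹ ^ N := by
          rw [← mul_pow]
          norm_num
        rw [this]
        field_simp
      rw [← e]
      gcongr
    have hc : CauchySeq fun n => u n x :=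
      cauchySeq_of_le_geometric (2⁻¹ : ℝ) ((C + t₀ : ℝ≥0) : ℝ) (by norm_num) fun n => by
        rw [dist_eq_norm]
        have := NNReal.coe_le_coe.2 (hterm n)
        simpa using this
    exact cauchySeq_tendsto_of_complete hc
  obtain ⟨f, hf, hlim⟩ := exists_stronglyMeasurable_limit_of_tendsto_ae hsm hconv
  have hfm : ∀ N, modular Φ (fun x => f x - u N x) μ (4⁻¹ ^ N) ≤ 1 := by
    intro N
    calc modular Φ (fun x => f x - u N x) μ (4⁻¹ ^ N)
        = ∫⁻ x, liminf (fun n => (Φ (‖u n x - u N x‖₊ / 4⁻¹ ^ N) : ℝ≥0∞)) atTop ∂μ := by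
          refine lintegral_congr_ae ?_
          filter_upwards [hlim] with x hx
          refine (Tendsto.liminf_eq ?_).symm
          refine ENNReal.tendsto_coe.2 ((Φ.continuous'.tendsto _).comp ?_)
          exact ((hx.sub_const _).nnnorm).div_const _
      _ ≤ liminf (fun n => ∫⁻ x, (Φ (‖u n x - u N x‖₊ / 4⁻¹ ^ N) : ℝ≥0∞) ∂μ) atTop :=
          lintegral_liminf_le' fun n => hmeas _ _ _
      _ ≤ 1 := liminf_le_of_le (by isBoundedDefault) fun b hb => by
          obtain ⟨n, hn, hn'⟩ := (hb.and (eventually_ge_atTop N)).exists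
          exact hn.trans (hmod N n N hn' le_rfl)
  have hmem : MemOrlicz Φ f μ := by
    have h0 : MemOrlicz Φ (fun x => f x - u 0 x) μ :=
      ⟨hf.aestronglyMeasurable.sub (hsm 0), _, hB 0, (hfm 0).trans_lt ENNReal.one_lt_top⟩
    have := MemOrlicz.add Φ h0 (u 0).2
    exact this.congr Φ (ae_of_all _ fun x => sub_add_cancel _ _)
  let g : Orlicz Φ μ := ⟨AEEqFun.mk f hf.aestronglyMeasurable,
    hmem.congr Φ (AEEqFun.coeFn_mk f hf.aestronglyMeasurable).symm⟩
  have hg : (g : α → ℝ) =ᵐ[μ] f := AEEqFun.coeFn_mk f hf.aestronglyMeasurable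
  refine ⟨g, tendsto_iff_norm_sub_tendsto_zero.2 ?_⟩
  refine squeeze_zero (fun n => norm_nonneg _) (g := fun n => (4⁻¹ : ℝ) ^ n) (fun n => ?_)
    (tendsto_pow_atTop_nhds_zero_of_lt_one (by norm_num) (by norm_num))
  rw [norm_sub_rev, Orlicz.norm_def]
  have hle : luxemburg Φ (g - u n : Orlicz Φ μ) μ ≤ 4⁻¹ ^ n := by
    refine luxemburg_le Φ (hB n) ?_
    refine le_of_eq_of_le (modular_congr Φ ?_ _) (hfm n)
    filter_upwards [AEEqFun.coeFn_sub (g : α →ₘ[μ] ℝ) (u n : α →ₘ[μ] ℝ), hg] with x h1 h2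
    rw [← h2]
    exact h1
  have := NNReal.coe_le_coe.2 hle
  simpa using this

/-- The inclusion `L^∞(μ) ⊂ L^Φ(μ)` for a finite measure `μ`. -/
noncomputable def toOrlicz [IsFiniteMeasure μ] : Lp ℝ ⊤ μ →ₗ[ℝ] Orlicz Φ μ where
  toFun f := ⟨(f : α →ₘ[μ] ℝ), (Lp.memLp f).1, 1, one_pos, by
    obtain ⟨C, hC⟩ : ∃ C : ℝ≥0, eLpNorm f ⊤ μ = C :=
      ⟨_, (ENNReal.coe_toNNReal (Lp.memLp f).2.ne).symm⟩
    have hle : ∀ᵐ x ∂μ, ‖f x‖₊ ≤ C := by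
      filter_upwards [enorm_ae_le_eLpNormEssSup f μ] with x hx
      rw [← eLpNorm_exponent_top, hC] at hx
      exact ENNReal.coe_le_coe.1 hx
    calc modular Φ f μ 1 ≤ ∫⁻ _, (Φ C : ℝ≥0∞) ∂μ :=
          lintegral_mono_ae (hle.mono fun x hx => ENNReal.coe_le_coe.2 (Φ.mono (by simpa using hx)))
      _ < ⊤ := by
          rw [lintegral_const]
          exact ENNReal.mul_lt_top ENNReal.coe_lt_top (measure_lt_top _ _)⟩
  map_add' _ _ := rfl
  map_smul' _ _ := rfl

end OrliczComplete

section Dynamics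

/-- An `N`-dimensional dynamical system on the probability space `(Ω, μ)`: a group of measure
preserving maps `T(x) : Ω → Ω`, `x ∈ ℝᴺ`, such that `(x, ω) ↦ T(x)ω` is measurable for the product
of the `σ`-algebra of Lebesgue measurable sets of `ℝᴺ` with that of `Ω`. (Invertibility and
measurability of the inverses follow, as `T(x)⁻¹ = T(-x)`.) -/
structure DynamicalSystem (N : ℕ) {Ω : Type*} [MeasurableSpace Ω] (μ : Measure Ω) where
  toFun : EuclideanSpace ℝ (Fin N) → Ω → Ω
  map_zero' : ∀ ω, toFun 0 ω = ω
  map_add' : ∀ x y ω, toFun (x + y) ω = toFun x (toFun y ω)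
  measurePreserving' : ∀ x, MeasurePreserving (toFun x) μ μ
  measurable' : Measurable
    (fun p : NullMeasurableSpace (EuclideanSpace ℝ (Fin N)) volume × Ω => toFun p.1 p.2)

variable {N : ℕ} {Ω : Type*} [MeasurableSpace Ω] {μ : Measure Ω}

instance : CoeFun (DynamicalSystem N μ) (fun _ => EuclideanSpace ℝ (Fin N) → Ω → Ω) :=
  ⟨DynamicalSystem.toFun⟩

variable (T : DynamicalSystem N μ)

/-- The operator `U(x) f = f ∘ T(x)` on `L^∞(Ω)`. -/
noncomputable def koopman (x : EuclideanSpace ℝ (Fin N)) : Lp ℝ ⊤ μ →ₗ[ℝ] Lp ℝ ⊤ μ :=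
  Lp.compMeasurePreservingₗ ℝ (T x) (T.measurePreserving' x)

/-- `g` is the `i`-th stochastic derivative of `f` in `L^∞(Ω)`: the limit of
`(U(t eᵢ) f - f) / t` in the norm of `L^∞(Ω)` as `t → 0`. -/
def HasStochDeriv (i : Fin N) (f g : Lp ℝ ⊤ μ) : Prop :=
  Tendsto (fun t : ℝ => t⁻¹ • (koopman T (EuclideanSpace.single i t) f - f)) (𝓝[≠] 0) (𝓝 g)

/-- All iterated stochastic derivatives of `f` in `L^∞(Ω)` of order at most `n` exist. -/
def HasStochDerivs : ℕ → Lp ℝ ⊤ μ → Prop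
  | 0, _ => True
  | n + 1, f => ∀ i : Fin N, ∃ g, HasStochDeriv T i f g ∧ HasStochDerivs n g

theorem HasStochDeriv.add {i : Fin N} {f f' g g' : Lp ℝ ⊤ μ} (h : HasStochDeriv T i f g)
    (h' : HasStochDeriv T i f' g') : HasStochDeriv T i (f + f') (g + g') := by
  refine (Tendsto.add h h').congr fun t => ?_
  rw [map_add, ← smul_add, add_sub_add_comm]

theorem HasStochDeriv.smul {i : Fin N} {f g : Lp ℝ ⊤ μ} (c : ℝ) (h : HasStochDeriv T i f g) :
    HasStochDeriv T i (c • f) (c • g) := by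
  refine (Tendsto.const_smul h c).congr fun t => ?_
  rw [map_smul, ← smul_sub, smul_comm]

theorem HasStochDeriv.zero (i : Fin N) : HasStochDeriv T i 0 0 := by
  refine tendsto_const_nhds.congr fun t => ?_
  rw [map_zero, sub_zero, smul_zero]

theorem HasStochDeriv.unique {i : Fin N} {f g g' : Lp ℝ ⊤ μ} (h : HasStochDeriv T i f g)
    (h' : HasStochDeriv T i f g') : g = g' :=
  tendsto_nhds_unique h h'

/-- The space `C^∞(Ω)` of those `f ∈ L^∞(Ω)` all of whose iterated stochastic derivatives exist in
`L^∞(Ω)`. -/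
def smooth : Submodule ℝ (Lp ℝ ⊤ μ) where
  carrier := {f | ∀ n, HasStochDerivs T n f}
  add_mem' {f f'} hf hf' n := by
    have key : ∀ (n : ℕ) (f f' : Lp ℝ ⊤ μ), HasStochDerivs T n f → HasStochDerivs T n f' →
        HasStochDerivs T n (f + f') := by
      intro n
      induction n with
      | zero => exact fun _ _ _ _ => trivial
      | succ n ih =>
        intro f f' h h' i
        obtain ⟨g, hg, hg'⟩ := h i
        obtain ⟨k, hk, hk'⟩ := h' i
        exact ⟨g + k, hg.add T hk, ih g k hg' hk'⟩
    exact key n f f' (hf n) (hf' n)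
  zero_mem' n := by
    have key : ∀ n : ℕ, HasStochDerivs T n 0 := by
      intro n
      induction n with
      | zero => trivial
      | succ n ih => exact fun i => ⟨0, HasStochDeriv.zero T i, ih⟩
    exact key n
  smul_mem' c f hf n := by
    have key : ∀ (n : ℕ) (f : Lp ℝ ⊤ μ), HasStochDerivs T n f → HasStochDerivs T n (c • f) := by
      intro n
      induction n with
      | zero => exact fun _ _ => trivial
      | succ n ih =>
        intro f h i
        obtain ⟨g, hg, hg'⟩ := h i
        exact ⟨c • g, hg.smul T c, ih g hg'⟩
    exact key n f (hf n)

theorem smooth.exists_deriv (f : smooth T) (i : Fin N) : ∃ g, HasStochDeriv T i f g := by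
  obtain ⟨g, hg, -⟩ := f.2 1 i
  exact ⟨g, hg⟩

/-- The `i`-th stochastic derivative on `C^∞(Ω)`. -/
noncomputable def stochDeriv (i : Fin N) : smooth T →ₗ[ℝ] Lp ℝ ⊤ μ where
  toFun f := (smooth.exists_deriv T f i).choose
  map_add' f g := (smooth.exists_deriv T (f + g) i).choose_spec.unique T
    ((smooth.exists_deriv T f i).choose_spec.add T (smooth.exists_deriv T g i).choose_spec)
  map_smul' c f := (smooth.exists_deriv T (c • f) i).choose_spec.unique T
    ((smooth.exists_deriv T f i).choose_spec.smul T c)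

variable (Φ : YoungFunction)

section Sharp

variable [IsProbabilityMeasure μ]

/-- The gradient `D_ω f = (D₁ f, …, D_N f)` of `f ∈ C^∞(Ω)` in `L^Φ(Ω)ᴺ`, normed by
`∑ᵢ ‖vᵢ‖_{L^Φ(Ω)}`. (Limits in `L^∞(Ω)` are limits in `L^Φ(Ω)`, so these are also the stochastic
derivatives of `f` in `L^Φ(Ω)`.) -/
noncomputable def stochGrad : smooth T →ₗ[ℝ] PiLp 1 (fun _ : Fin N => Orlicz Φ μ) :=
  (WithLp.linearEquiv 1 ℝ (Fin N → Orlicz Φ μ)).symm.toLinearMap ∘ₗ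
    LinearMap.pi fun i => toOrlicz Φ ∘ₗ stochDeriv T i

/-- The space `C^∞(Ω)`, to be endowed with the seminorm `∑ᵢ ‖Dᵢ f‖_{L^Φ(Ω)}`. -/
def SmoothSharp (_ : YoungFunction) (T : DynamicalSystem N μ) : Type _ := smooth T

noncomputable instance : AddCommGroup (SmoothSharp Φ T) := inferInstanceAs (AddCommGroup (smooth T))

noncomputable instance : Module ℝ (SmoothSharp Φ T) := inferInstanceAs (Module ℝ (smooth T))

/-- The gradient as a map on `SmoothSharp`. -/
noncomputable def sharpGrad : SmoothSharp Φ T →ₗ[ℝ] PiLp 1 (fun _ : Fin N => Orlicz Φ μ) :=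
  stochGrad T Φ

/-- The seminorm `‖f‖_{#,Φ} = ∑ᵢ ‖Dᵢ f‖_{L^Φ(Ω)}` on `C^∞(Ω)`. -/
noncomputable instance : SeminormedAddCommGroup (SmoothSharp Φ T) :=
  SeminormedAddCommGroup.induced _ _ (sharpGrad T Φ)

noncomputable instance : NormedSpace ℝ (SmoothSharp Φ T) :=
  NormedSpace.induced ℝ _ _ (sharpGrad T Φ)

/-- The space `W¹_# L^Φ(Ω)`: the completion of `C^∞(Ω)` for the seminorm `‖·‖_{#,Φ}`. -/
abbrev WSharp : Type _ := UniformSpace.Completion (SmoothSharp Φ T)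

/-- The extension by continuity `D̄_ω : W¹_# L^Φ(Ω) → L^Φ(Ω)ᴺ` of the gradient. -/
noncomputable def gradBar : WSharp T Φ → PiLp 1 (fun _ : Fin N => Orlicz Φ μ) :=
  UniformSpace.Completion.extension (sharpGrad T Φ)

theorem isometry_sharpGrad : Isometry (sharpGrad T Φ) :=
  AddMonoidHomClass.isometry_of_norm _ fun _ => rfl

theorem norm_smoothSharp (f : SmoothSharp Φ T) :
    ‖f‖ = ∑ i, ‖toOrlicz Φ (stochDeriv T i f)‖ := by
  change ‖sharpGrad T Φ f‖ = _
  rw [PiLp.norm_eq_of_L1]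
  rfl

theorem gradBar_coe (f : SmoothSharp Φ T) : gradBar T Φ f = sharpGrad T Φ f :=
  UniformSpace.Completion.extension_coe (isometry_sharpGrad T Φ).uniformContinuous f

end Sharp

/-- `g` belongs to the space `I_nv^Φ(Ω)` of the functions in `L^Φ(Ω)` that are invariant for `T`. -/
def MemInv (g : Ω → ℝ) : Prop :=
  MemOrlicz Φ g μ ∧ ∀ y, (fun ω => g (T y ω)) =ᵐ[μ] g

/-- The measure `dx ⊗ μ` on `Q × Ω`. -/
noncomputable def prodMeasure (Q : Set (EuclideanSpace ℝ (Fin N))) (μ : Measure Ω) :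
    Measure (EuclideanSpace ℝ (Fin N) × Ω) :=
  (volume.restrict Q).prod μ

/-- `φ ∈ C_0^∞(Q)`. -/
def IsTest (Q : Set (EuclideanSpace ℝ (Fin N))) (φ : EuclideanSpace ℝ (Fin N) → ℝ) : Prop :=
  ContDiff ℝ ((⊤ : ℕ∞) : WithTop ℕ∞) φ ∧ HasCompactSupport φ ∧ tsupport φ ⊆ Q

/-- `g = ∂v/∂xᵢ` in the sense of distributions on `Q` (with values in functions of `ω`). -/
def HasWeakDeriv (Q : Set (EuclideanSpace ℝ (Fin N))) (μ : Measure Ω) (i : Fin N)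
    (v g : EuclideanSpace ℝ (Fin N) × Ω → ℝ) : Prop :=
  ∀ φ, IsTest Q φ → ∀ᵐ ω ∂μ,
    ∫ x in Q, v (x, ω) * fderiv ℝ φ x (EuclideanSpace.single i 1) = -∫ x in Q, g (x, ω) * φ x

/-- Weak stochastic two-scale convergence in the mean of `(u n)`, along the scales `ε n`, to `u₀`:
`∬ u n (x, ω) f(x, T(x / ε n) ω) → ∬ u₀ f` for every `f(x, ω) = ∑ⱼ φⱼ(x) ψⱼ(ω)` (a finite sum)
with `φⱼ ∈ C_0^∞(Q)` and `ψⱼ ∈ C^∞(Ω)`. -/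
def TwoScale (Q : Set (EuclideanSpace ℝ (Fin N))) (ε : ℕ → ℝ)
    (u : ℕ → Orlicz Φ (prodMeasure Q μ)) (u₀ : Orlicz Φ (prodMeasure Q μ)) : Prop :=
  ∀ (m : ℕ) (φ : Fin m → EuclideanSpace ℝ (Fin N) → ℝ) (ψ : Fin m → smooth T),
    (∀ j, IsTest Q (φ j)) →
    Tendsto
      (fun n => ∫ p, u n p * ∑ j, φ j p.1 * (ψ j : Lp ℝ ⊤ μ) (T ((ε n)⁻¹ • p.1) p.2)
        ∂(prodMeasure Q μ))
      atTop (𝓝 (∫ p, u₀ p * ∑ j, φ j p.1 * (ψ j : Lp ℝ ⊤ μ) p.2 ∂(prodMeasure Q μ)))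

end Dynamics

end StochTwoScale

open StochTwoScale

/-! Write `c = 1/ε` and let `S_c v(x, ω) = v(x, T(-cx)ω)` be the unfolding of `v`. Since each `T(z)`
preserves `μ`, `S_c` is isometric on `L^Φ(Q × Ω)`, and a change of variables moves the oscillation
from the test function onto `v` (`integral_mul_unfold`). Two-scale convergence thus follows from
convergence of the unfoldings against bounded functions. Bounded sequences have such limits along a
subsequence (`exists_subseq_pairing`), and under the two `Δ₂`-conditions these are weak limits
(`tendsto_of_pairing`). Let `u₀` and `ξᵢ` be the limits for `u_ε` and `∂ᵢu_ε`.

Let `M_ρ f = ∫ ρ(z) f∘T(z) dz` for a smooth compactly supported `ρ`. Everything about the limits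
comes from one integration by parts (`moll_sliceInt_unfold_add`): for a test function `φ` on `Q`,
`M_ρ(∫ φ S_c ∂ᵢu) + M_ρ(∫ ∂ᵢφ S_c u) = -c M_{∂ᵢρ}(∫ φ S_c u)`, with integrals over `x`. It is used
in three ways.

Divided by `c → ∞`, it gives `M_{∂ᵢρ}(∫ φ u₀) = 0` for all `ρ`, so `∫ φ u₀` is invariant. Paired
with an invariant bounded function, its right side disappears because `∫ ∂ᵢρ = 0`. Hence `∂ᵢu₀` is
the conditional expectation `E ξᵢ` of `ξᵢ` given the invariant sets. Finally, as a vector in `i`,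
the right side lies in the closure of the stochastic gradients of smooth functions. Closed subspaces
are weakly closed, so the limit `∫ φ (ξ - E ξ)` lies there too.

Varying `φ` localises these memberships to almost every `x` (`ae_mem_of_integral_smul_mem`). The
completion `W¹_# L^Φ(Ω)` is isometric, through `gradBar`, to the closure of the gradients, which
yields `u₁(x)` with `D̄_ω u₁ = ξ - E ξ`. If the conjugate satisfies `Δ'`, then `Φ(s)Φ(t) ≤ Φ(bst)`,
which bounds `Φ` of the norm of a slice by the modular of the slice (`map_nnnorm_le_modular`) and
gives the last integrability claim. -/

namespace StochTwoScale

/-! ### Young functions and their conjugates. -/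

namespace YoungFunction

variable (Φ : YoungFunction)

theorem bddAbove_conj (t : ℝ≥0) : BddAbove (range fun s : ℝ≥0 => s * t - Φ s) := by
  obtain ⟨s₀, h⟩ := (tendsto_atTop.1 Φ.tendsto_top' t).exists_forall_of_atTop
  refine ⟨s₀ * t, ?_⟩
  rintro _ ⟨s, rfl⟩
  rcases le_total s s₀ with hs | hs
  · exact tsub_le_self.trans (by gcongr)
  · rcases eq_or_ne s 0 with rfl | h0
    · simp
    · have := h s hs
      rw [le_div_iff₀ (pos_iff_ne_zero.2 h0), mul_comm] at this
      simp [tsub_eq_zero_of_le this]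

theorem young (s t : ℝ≥0) : s * t ≤ Φ s + Φ.conj t :=
  tsub_le_iff_left.1 (le_ciSup (Φ.bddAbove_conj t) s)

theorem conj_le {t b : ℝ≥0} (h : ∀ s, s * t ≤ Φ s + b) : Φ.conj t ≤ b :=
  ciSup_le fun s => tsub_le_iff_left.2 (h s)

theorem conj_mono : Monotone Φ.conj := fun _ t hst =>
  Φ.conj_le fun r => (mul_le_mul_right hst r).trans (Φ.young r t)

theorem conj_zero : Φ.conj 0 = 0 :=
  le_antisymm (Φ.conj_le fun s => by simp) zero_le

theorem conj_mul_le {c : ℝ≥0} (hc : c ≤ 1) (t : ℝ≥0) : Φ.conj (c * t) ≤ c * Φ.conj t := by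
  refine Φ.conj_le fun s => ?_
  calc s * (c * t) = c * (s * t) := by ring
    _ ≤ c * (Φ s + Φ.conj t) := by gcongr; exact Φ.young s t
    _ = c * Φ s + c * Φ.conj t := mul_add _ _ _
    _ ≤ 1 * Φ s + c * Φ.conj t := by gcongr
    _ = _ := by rw [one_mul]

/-- By convexity `Φ(r)/r` is nondecreasing, so `r Φ(t)/t` is at most `Φ(t)` for `r ≤ t` and at most
`Φ(r)` for `r ≥ t`. This makes `Φ(|g|)/|g|` an efficient test function for `g` in duality arguments.
-/
theorem conj_div_le (t : ℝ≥0) : Φ.conj (Φ t / t) ≤ Φ t := by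
  refine Φ.conj_le fun r => ?_
  rcases eq_or_ne t 0 with rfl | ht
  · simp
  rcases le_total r t with h | h
  · calc r * (Φ t / t) ≤ t * (Φ t / t) := by gcongr
      _ = Φ t := mul_div_cancel₀ _ ht
      _ ≤ _ := le_add_self
  · have hr : r ≠ 0 := (lt_of_lt_of_le (pos_iff_ne_zero.2 ht) h).ne'
    have h1 : Φ t ≤ t / r * Φ r := by
      have := Φ.map_mul_le (div_le_one_of_le₀ h zero_le) r
      rwa [div_mul_cancel₀ _ hr] at this
    calc r * (Φ t / t) ≤ r * (t / r * Φ r / t) := by gcongr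
      _ = Φ r := by field_simp
      _ ≤ _ := le_self_add

/-- Mirror image of `conj_div_le`, without regularity of the conjugate. If `v = rt - Φ(r) > 0`, then
`v/t = θr` with `θ = v/(rt) ≤ 1`, so `Φ(v/t) ≤ θΦ(r) ≤ θrt = v`. Such values `v` approach the
supremum, and `Φ` is continuous. -/
theorem map_conj_div_le (t : ℝ≥0) : Φ (Φ.conj t / t) ≤ Φ.conj t := by
  rcases eq_or_ne t 0 with rfl | ht
  · simp [Φ.map_zero]
  have key : ∀ r : ℝ≥0, Φ ((r * t - Φ r) / t) ≤ Φ.conj t := by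
    intro r
    set v := r * t - Φ r with hv
    have hvr : v ≤ r * t := tsub_le_self
    rcases eq_or_ne r 0 with rfl | hr
    · have : v = 0 := by simpa using hvr
      simp [this, Φ.map_zero]
    rcases le_total (r * t) (Φ r) with hle | hle
    · have : v = 0 := tsub_eq_zero_of_le hle
      simp [this, Φ.map_zero]
    have h1 : v / (r * t) ≤ 1 := div_le_one_of_le₀ hvr zero_le
    have h2 : v / t = v / (r * t) * r := by field_simp
    calc Φ (v / t) ≤ v / (r * t) * Φ r := by rw [h2]; exact Φ.map_mul_le h1 r
      _ ≤ v / (r * t) * (r * t) := by gcongr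
      _ = v := by field_simp
      _ ≤ _ := le_ciSup (Φ.bddAbove_conj t) r
  have h2 : Tendsto (fun v : ℝ≥0 => Φ (v / t)) (𝓝[<] (Φ.conj t)) (𝓝 (Φ (Φ.conj t / t))) :=
    (((Φ.continuous'.comp (continuous_id.div_const t)).tendsto _).mono_left nhdsWithin_le_nhds)
  rcases eq_or_ne (Φ.conj t) 0 with h0 | h0
  · simp [h0, Φ.map_zero]
  have : (𝓝[<] (Φ.conj t)).NeBot := nhdsLT_neBot_of_exists_lt ⟨0, pos_iff_ne_zero.2 h0⟩
  refine le_of_tendsto h2 ?_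
  filter_upwards [self_mem_nhdsWithin] with v hv
  obtain ⟨r, hr⟩ := exists_lt_of_lt_ciSup (show v < ⨆ s : ℝ≥0, (s * t - Φ s) from hv)
  refine (Φ.mono ?_).trans (key r)
  gcongr

/-- The `Δ'`-condition for the conjugate function yields the `∇'`-condition. -/
theorem exists_mul_le_of_deltaPrime_conj (h : DeltaPrime Φ.conj) :
    ∃ b : ℝ≥0, 0 < b ∧ ∀ s t, Φ s * Φ t ≤ Φ (b * (s * t)) := by
  obtain ⟨β, hβ, h⟩ := h
  -- Young's inequality for `(β + 1)st` and `(Φ(s)/s)(Φ(t)/t)` has left side `(β + 1)Φ(s)Φ(t)`. The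
  -- conjugate term absorbs `β` copies, by `Δ'` and `conj_div_le`, and one copy is left.
  refine ⟨β + 1, by positivity, fun s t => ?_⟩
  rcases eq_or_ne s 0 with rfl | hs
  · simp [Φ.map_zero]
  rcases eq_or_ne t 0 with rfl | ht
  · simp [Φ.map_zero]
  have h1 : Φ.conj (Φ s / s * (Φ t / t)) ≤ β * (Φ s * Φ t) :=
    (h _ _).trans (by gcongr <;> exact Φ.conj_div_le _)
  have h2 := Φ.young ((β + 1) * (s * t)) (Φ s / s * (Φ t / t))
  have e : (β + 1) * (s * t) * (Φ s / s * (Φ t / t)) = β * (Φ s * Φ t) + Φ s * Φ t := by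
    field_simp
  rw [e, add_comm] at h2
  exact le_of_add_le_add_right (h2.trans (by gcongr))

theorem tendsto_conj_zero : Tendsto Φ.conj (𝓝 0) (𝓝 0) := by
  have h : Tendsto (fun t : ℝ≥0 => t * Φ.conj 1) (𝓝 0) (𝓝 0) := by
    simpa using (tendsto_id (x := 𝓝 (0 : ℝ≥0))).mul_const (Φ.conj 1)
  refine tendsto_of_tendsto_of_tendsto_of_le_of_le' tendsto_const_nhds h
    (Eventually.of_forall fun _ => zero_le) ?_
  filter_upwards [Iic_mem_nhds (zero_lt_one' ℝ≥0)] with t ht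
  simpa using Φ.conj_mul_le ht 1

end YoungFunction

/-! ### The `Δ₂`-condition on finite measure spaces. -/

section Delta

variable {α : Type*} [MeasurableSpace α] {μ : Measure α}

/-- Below `t₀` doubling costs at most the constant `Ψ(2t₀)`, which is integrable because `μ` is
finite. Iterated doubling then reaches any factor `K ≤ 2ⁿ`. -/
theorem Delta2.lintegral_mul_lt_top [IsFiniteMeasure μ] {Ψ : ℝ≥0 → ℝ≥0} (hΨ : Delta2 Ψ)
    (hm : Monotone Ψ) {g : α → ℝ≥0} (hg : ∫⁻ x, (Ψ (g x) : ℝ≥0∞) ∂μ < ∞) (K : ℝ≥0) :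
    ∫⁻ x, (Ψ (K * g x) : ℝ≥0∞) ∂μ < ∞ := by
  obtain ⟨t₀, k, -, -, h⟩ := hΨ
  have h2 : ∀ t, Ψ (2 * t) ≤ Ψ (2 * t₀) + k * Ψ t := fun t => by
    rcases le_total t₀ t with ht | ht
    · exact (h t ht).trans le_add_self
    · exact (hm (by gcongr)).trans le_self_add
  have hpow : ∀ n : ℕ, ∫⁻ x, (Ψ (2 ^ n * g x) : ℝ≥0∞) ∂μ < ∞ := by
    intro n
    induction n with
    | zero => simpa using hg
    | succ n ih =>
      calc ∫⁻ x, (Ψ (2 ^ (n + 1) * g x) : ℝ≥0∞) ∂μ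
          ≤ ∫⁻ x, ((Ψ (2 * t₀) : ℝ≥0∞) + k * (Ψ (2 ^ n * g x) : ℝ≥0∞)) ∂μ := by
            refine lintegral_mono fun x => ?_
            have := h2 (2 ^ n * g x)
            rw [← mul_assoc, ← pow_succ'] at this
            exact (ENNReal.coe_le_coe.2 this).trans (by rw [ENNReal.coe_add, ENNReal.coe_mul])
        _ = (Ψ (2 * t₀) : ℝ≥0∞) * μ univ + k * ∫⁻ x, (Ψ (2 ^ n * g x) : ℝ≥0∞) ∂μ := by
            rw [lintegral_add_left measurable_const, lintegral_const,
              lintegral_const_mul' _ _ ENNReal.coe_ne_top]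
        _ < ∞ := ENNReal.add_lt_top.2
            ⟨ENNReal.mul_lt_top ENNReal.coe_lt_top (measure_lt_top _ _),
              ENNReal.mul_lt_top ENNReal.coe_lt_top ih⟩
  obtain ⟨n, hn⟩ := pow_unbounded_of_one_lt K (one_lt_two)
  refine lt_of_le_of_lt (lintegral_mono fun x => ?_) (hpow n)
  exact ENNReal.coe_le_coe.2 (hm (by gcongr))

variable (Φ : YoungFunction)

theorem modular_lt_top_of_delta2 [IsFiniteMeasure μ] (hΦ : Delta2 Φ) {F : Type*}
    [NormedAddCommGroup F] {f : α → F} (hf : MemOrlicz Φ f μ) {δ : ℝ≥0} (hδ : 0 < δ) :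
    modular Φ f μ δ < ∞ := by
  obtain ⟨-, a, ha, hfa⟩ := hf
  have := hΦ.lintegral_mul_lt_top Φ.mono hfa (a / δ)
  refine lt_of_eq_of_lt (lintegral_congr fun x => ?_) this
  congr 2
  field_simp

end Delta

/-! ### Norm estimates, order continuity, pairings with bounded functions and truncation. -/

section OrliczTools

variable {α : Type*} [MeasurableSpace α] {μ : Measure α} (Φ : YoungFunction)

/-- Young's inequality for `|f|/a` and `K|g|`. The free parameter `K` replaces the norm of the dual
space: a large `K` makes the prefactor small as long as the conjugate modular of `Kg` stays bounded.
-/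
theorem lintegral_mul_le_young {f g : α → ℝ} (hf : AEStronglyMeasurable f μ) {a K : ℝ≥0}
    (ha : 0 < a) (hK : 0 < K) :
    ∫⁻ x, ‖f x‖ₑ * ‖g x‖ₑ ∂μ ≤
      (a / K : ℝ≥0) * (modular Φ f μ a + ∫⁻ x, (Φ.conj (K * ‖g x‖₊) : ℝ≥0∞) ∂μ) := by
  unfold modular
  rw [← lintegral_add_left' (aemeasurable_modular Φ hf a),
    ← lintegral_const_mul' _ _ ENNReal.coe_ne_top]
  refine lintegral_mono fun x => ?_
  have h := Φ.young (‖f x‖₊ / a) (K * ‖g x‖₊)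
  have e : ‖f x‖₊ * ‖g x‖₊ = a / K * (‖f x‖₊ / a * (K * ‖g x‖₊)) := by field_simp
  have h2 : ‖f x‖₊ * ‖g x‖₊ ≤ a / K * (Φ (‖f x‖₊ / a) + Φ.conj (K * ‖g x‖₊)) := by
    rw [e]; gcongr
  simp only [enorm_eq_nnnorm]
  exact_mod_cast h2

theorem lintegral_enorm_le {f : α → ℝ} (hf : AEStronglyMeasurable f μ) {a : ℝ≥0} (ha : 0 < a) :
    ∫⁻ x, ‖f x‖ₑ ∂μ ≤ a * (modular Φ f μ a + Φ.conj 1 * μ univ) := by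
  simpa using lintegral_mul_le_young Φ (g := fun _ => 1) hf ha one_pos

theorem MemOrlicz.integrable [IsFiniteMeasure μ] {f : α → ℝ} (hf : MemOrlicz Φ f μ) :
    Integrable f μ := by
  obtain ⟨hm, a, ha, h⟩ := hf
  refine ⟨hm, (lintegral_enorm_le Φ hm ha).trans_lt ?_⟩
  exact ENNReal.mul_lt_top ENNReal.coe_lt_top (ENNReal.add_lt_top.2
    ⟨h, ENNReal.mul_lt_top ENNReal.coe_lt_top (measure_lt_top _ _)⟩)

theorem MemOrlicz.of_ae_bound [IsFiniteMeasure μ] {f : α → ℝ} (hf : AEStronglyMeasurable f μ)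
    {C : ℝ≥0} (hC : ∀ᵐ x ∂μ, ‖f x‖₊ ≤ C) : MemOrlicz Φ f μ := by
  refine ⟨hf, 1, one_pos, ?_⟩
  calc modular Φ f μ 1 ≤ ∫⁻ _, (Φ C : ℝ≥0∞) ∂μ :=
        lintegral_mono_ae (hC.mono fun x hx => ENNReal.coe_le_coe.2 (Φ.mono (by simpa using hx)))
    _ < ⊤ := by
        rw [lintegral_const]
        exact ENNReal.mul_lt_top ENNReal.coe_lt_top (measure_lt_top _ _)

theorem MemOrlicz.mono {F G : Type*} [NormedAddCommGroup F] [NormedAddCommGroup G]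
    {f : α → F} {g : α → G} (hg : MemOrlicz Φ g μ) (hf : AEStronglyMeasurable f μ)
    (h : ∀ᵐ x ∂μ, ‖f x‖₊ ≤ ‖g x‖₊) : MemOrlicz Φ f μ := by
  obtain ⟨-, a, ha, hga⟩ := hg
  refine ⟨hf, a, ha, lt_of_le_of_lt (lintegral_mono_ae (h.mono fun x hx => ?_)) hga⟩
  exact ENNReal.coe_le_coe.2 (Φ.mono (by gcongr))

/-- With `M` the modular at `a`, convexity bounds the modular at `a(1 + M)` by `M/(1 + M) ≤ 1`. A
bound on the norm that is affine in the modular can be integrated over slices. -/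
theorem luxemburg_le_mul_modular {F : Type*} [NormedAddCommGroup F] {f : α → F} {a : ℝ≥0}
    (ha : 0 < a) (h : modular Φ f μ a < ∞) :
    (luxemburg Φ f μ : ℝ≥0∞) ≤ a * (1 + modular Φ f μ a) := by
  obtain ⟨M, hM⟩ : ∃ M : ℝ≥0, modular Φ f μ a = M := ⟨_, (ENNReal.coe_toNNReal h.ne).symm⟩
  rw [hM]
  have hK : (0 : ℝ≥0) < 1 + M := by positivity
  have : luxemburg Φ f μ ≤ a * (1 + M) := by
    refine luxemburg_le Φ (by positivity) ?_
    calc modular Φ f μ (a * (1 + M))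
        ≤ ∫⁻ x, ((1 + M)⁻¹ : ℝ≥0) * (Φ (‖f x‖₊ / a) : ℝ≥0∞) ∂μ := by
          refine lintegral_mono fun x => ?_
          rw [← ENNReal.coe_mul]
          refine ENNReal.coe_le_coe.2 ?_
          have e : ‖f x‖₊ / (a * (1 + M)) = (1 + M)⁻¹ * (‖f x‖₊ / a) := by field_simp
          rw [e]
          exact Φ.map_mul_le (inv_le_one_of_one_le₀ le_self_add) _
      _ = ((1 + M)⁻¹ : ℝ≥0) * (M : ℝ≥0∞) := by
          rw [lintegral_const_mul' _ _ ENNReal.coe_ne_top, ← hM]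
          rfl
      _ ≤ 1 := by
          rw [← ENNReal.coe_mul]
          refine ENNReal.coe_le_one_iff.2 ?_
          rw [inv_mul_le_iff₀ hK, mul_one]
          exact le_add_self
  exact_mod_cast this

/-- Order continuity of the norm. By `Δ₂` the modular of `h` is finite at every `δ`, so dominated
convergence sends the modulars of `f n` to zero at every `δ`. -/
theorem tendsto_luxemburg_zero [IsFiniteMeasure μ] (hΦ : Delta2 Φ) {f : ℕ → α → ℝ} {h : α → ℝ}
    (hf : ∀ n, AEStronglyMeasurable (f n) μ) (hh : MemOrlicz Φ h μ)
    (hle : ∀ n, ∀ᵐ x ∂μ, ‖f n x‖₊ ≤ ‖h x‖₊)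
    (hlim : ∀ᵐ x ∂μ, Tendsto (fun n => f n x) atTop (𝓝 0)) :
    Tendsto (fun n => luxemburg Φ (f n) μ) atTop (𝓝 0) := by
  have key : ∀ δ : ℝ≥0, 0 < δ → Tendsto (fun n => modular Φ (f n) μ δ) atTop (𝓝 0) := by
    intro δ hδ
    have := tendsto_lintegral_of_dominated_convergence' (μ := μ)
      (F := fun n x => (Φ (‖f n x‖₊ / δ) : ℝ≥0∞)) (f := fun _ => 0)
      (fun x => (Φ (‖h x‖₊ / δ) : ℝ≥0∞)) (fun n => aemeasurable_modular Φ (hf n) δ)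
      (fun n => (hle n).mono fun x hx => ENNReal.coe_le_coe.2 (Φ.mono (by gcongr)))
      (modular_lt_top_of_delta2 Φ hΦ hh hδ).ne
      (hlim.mono fun x hx => by
        have h1 := (Φ.continuous'.tendsto _).comp ((hx.nnnorm).div_const δ)
        simp only [nnnorm_zero, zero_div, Φ.map_zero] at h1
        simpa using ENNReal.tendsto_coe.2 h1)
    rwa [lintegral_zero] at this
  refine tendsto_order.2 ⟨fun a ha => absurd ha not_lt_zero, fun a ha => ?_⟩
  filter_upwards [(key (a / 2) (half_pos ha)).eventually (gt_mem_nhds zero_lt_one)] with n hn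
  exact (luxemburg_le Φ (half_pos ha) hn.le).trans_lt (NNReal.half_lt_self ha.ne')

variable (μ) in
open Classical in
/-- The class of `f` in `L^Φ(μ)`, or `0` if `f` does not belong to this space. -/
noncomputable def Orlicz.ofFun (f : α → ℝ) : Orlicz Φ μ :=
  if h : MemOrlicz Φ f μ then
    ⟨AEEqFun.mk f h.1, h.congr Φ (AEEqFun.coeFn_mk f h.1).symm⟩
  else 0

namespace Orlicz

variable {Φ}

theorem coe_ofFun {f : α → ℝ} (h : MemOrlicz Φ f μ) : ofFun μ Φ f =ᵐ[μ] f := by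
  rw [ofFun, dif_pos h]
  exact AEEqFun.coeFn_mk f h.1

theorem ext {f g : Orlicz Φ μ} (h : f =ᵐ[μ] g) : f = g :=
  Subtype.ext (AEEqFun.ext h)

theorem coe_add (f g : Orlicz Φ μ) : ⇑(f + g : Orlicz Φ μ).1 =ᵐ[μ] fun x => f x + g x :=
  AEEqFun.coeFn_add (f : α →ₘ[μ] ℝ) (g : α →ₘ[μ] ℝ)

theorem coe_neg (f : Orlicz Φ μ) : ⇑(-f : Orlicz Φ μ).1 =ᵐ[μ] fun x => -f x :=
  AEEqFun.coeFn_neg (f : α →ₘ[μ] ℝ)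

theorem coe_smul (c : ℝ) (f : Orlicz Φ μ) : ⇑(c • f : Orlicz Φ μ).1 =ᵐ[μ] fun x => c * f x :=
  AEEqFun.coeFn_smul c (f : α →ₘ[μ] ℝ)

theorem coe_zero : ⇑(0 : Orlicz Φ μ).1 =ᵐ[μ] fun _ => 0 := AEEqFun.coeFn_zero

theorem ofFun_congr {f g : α → ℝ} (h : f =ᵐ[μ] g) : ofFun μ Φ f = ofFun μ Φ g := by
  by_cases hf : MemOrlicz Φ f μ
  · exact ext ((coe_ofFun hf).trans (h.trans (coe_ofFun (hf.congr Φ h)).symm))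
  · rw [ofFun, ofFun, dif_neg hf, dif_neg fun hg => hf (MemOrlicz.congr Φ hg h.symm)]

theorem ofFun_coe (f : Orlicz Φ μ) : ofFun μ Φ f = f := ext (coe_ofFun f.2)

theorem norm_ofFun {f : α → ℝ} (h : MemOrlicz Φ f μ) : ‖ofFun μ Φ f‖ = luxemburg Φ f μ := by
  rw [norm_def, luxemburg_congr Φ (coe_ofFun h)]

theorem norm_eq_of_ae (f : Orlicz Φ μ) {g : α → ℝ} (h : f =ᵐ[μ] g) : ‖f‖ = luxemburg Φ g μ := by
  rw [norm_def, luxemburg_congr Φ h]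

theorem ofFun_add {f g : α → ℝ} (hf : MemOrlicz Φ f μ) (hg : MemOrlicz Φ g μ) :
    ofFun μ Φ (fun x => f x + g x) = ofFun μ Φ f + ofFun μ Φ g := by
  refine ext ?_
  filter_upwards [coe_ofFun (hf.add Φ hg), coe_ofFun hf, coe_ofFun hg,
    coe_add (ofFun μ Φ f) (ofFun μ Φ g)] with x h1 h2 h3 h4
  rw [h4, h2, h3]
  exact h1

theorem ofFun_smul {f : α → ℝ} (hf : MemOrlicz Φ f μ) (c : ℝ) :
    ofFun μ Φ (fun x => c * f x) = c • ofFun μ Φ f := by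
  refine ext ?_
  filter_upwards [coe_ofFun (hf.smul Φ c), coe_ofFun hf, coe_smul c (ofFun μ Φ f)] with x h1 h2 h3
  rw [h3, h2]
  exact h1

theorem ofFun_sub {f g : α → ℝ} (hf : MemOrlicz Φ f μ) (hg : MemOrlicz Φ g μ) :
    ofFun μ Φ (fun x => f x - g x) = ofFun μ Φ f - ofFun μ Φ g := by
  have h := ofFun_add hf (hg.smul Φ (-1))
  have e : (fun x => f x - g x) = fun x => f x + ((-1 : ℝ) • g) x := by
    ext x; simp [sub_eq_add_neg]
  rw [e, h, sub_eq_add_neg]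
  congr 1
  exact (ofFun_smul hg (-1)).trans (by simp)

theorem modular_le_one (f : Orlicz Φ μ) {a : ℝ≥0} (h : ‖f‖ < a) : modular Φ f μ a ≤ 1 :=
  modular_le_one_of_lt Φ f.2.2 (NNReal.coe_lt_coe.1 h)

theorem integrable [IsFiniteMeasure μ] (f : Orlicz Φ μ) : Integrable f μ :=
  MemOrlicz.integrable Φ f.2

theorem coe_toOrlicz [IsFiniteMeasure μ] (f : Lp ℝ ⊤ μ) : ((toOrlicz Φ f).1 : α → ℝ) = f := rfl

theorem integral_norm_le [IsFiniteMeasure μ] (f : Orlicz Φ μ) :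
    ∫ x, ‖f x‖ ∂μ ≤ (1 + Φ.conj 1 * μ.real univ) * ‖f‖ := by
  have key : ∀ a : ℝ≥0, ‖f‖ < a → ∫ x, ‖f x‖ ∂μ ≤ (1 + Φ.conj 1 * μ.real univ) * a := by
    intro a ha
    have ha0 : 0 < a := by
      have := (norm_nonneg f).trans_lt ha
      exact_mod_cast this
    have h := lintegral_enorm_le Φ f.2.1 ha0
    rw [integral_norm_eq_lintegral_enorm f.2.1]
    refine ENNReal.toReal_le_of_le_ofReal (by positivity) (h.trans ?_)
    calc (a : ℝ≥0∞) * (modular Φ f μ a + Φ.conj 1 * μ univ)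
        ≤ a * (1 + Φ.conj 1 * μ univ) := by gcongr; exact modular_le_one f ha
      _ = ENNReal.ofReal ((1 + Φ.conj 1 * μ.real univ) * a) := by
        rw [ENNReal.ofReal_mul (by positivity), ENNReal.ofReal_add zero_le_one (by positivity),
          ENNReal.ofReal_mul (by positivity)]
        simp [mul_comm]
  refine le_of_forall_pos_le_add fun η hη => ?_
  have hK : 0 < 1 + (Φ.conj 1 : ℝ) * μ.real univ := by positivity
  have := key ⟨‖f‖ + η / (1 + Φ.conj 1 * μ.real univ), by positivity⟩
    (by change ‖f‖ < ‖f‖ + η / (1 + Φ.conj 1 * μ.real univ); linarith [div_pos hη hK])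
  refine this.trans (le_of_eq ?_)
  change (1 + (Φ.conj 1 : ℝ) * μ.real univ) * (‖f‖ + η / (1 + Φ.conj 1 * μ.real univ)) = _
  field_simp

theorem integrable_mul [IsFiniteMeasure μ] (f : Orlicz Φ μ) (χ : Lp ℝ ⊤ μ) :
    Integrable (fun x => f x * χ x) μ :=
  f.integrable.mul_of_top_left (Lp.memLp χ)

theorem ae_norm_le (χ : Lp ℝ ⊤ μ) : ∀ᵐ x ∂μ, ‖χ x‖ ≤ ‖χ‖ := by
  have h := ae_le_eLpNormEssSup (f := χ) (μ := μ)
  filter_upwards [h] with x hx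
  rw [Lp.norm_def, eLpNorm_exponent_top]
  have h2 : eLpNormEssSup χ μ ≠ ∞ := by
    rw [← eLpNorm_exponent_top]; exact (Lp.memLp χ).2.ne
  exact (ENNReal.ofReal_le_iff_le_toReal h2).1 (by rwa [ofReal_norm])

/-- The pairing `f ↦ ∫ f χ` of `L^Φ(μ)` with `χ ∈ L^∞(μ)`. -/
noncomputable def pairing [IsFiniteMeasure μ] (χ : Lp ℝ ⊤ μ) : Orlicz Φ μ →L[ℝ] ℝ :=
  LinearMap.mkContinuous
    { toFun := fun f => ∫ x, f x * χ x ∂μ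
      map_add' := fun f g => by
        rw [← integral_add (integrable_mul f χ) (integrable_mul g χ)]
        refine integral_congr_ae ?_
        filter_upwards [coe_add f g] with x hx
        rw [hx, add_mul]
      map_smul' := fun c f => by
        rw [RingHom.id_apply, smul_eq_mul, ← integral_const_mul]
        refine integral_congr_ae ?_
        filter_upwards [coe_smul c f] with x hx
        rw [hx, mul_assoc] }
    ((1 + Φ.conj 1 * μ.real univ) * ‖χ‖) fun f => by
      calc ‖∫ x, f x * χ x ∂μ‖ ≤ ∫ x, ‖f x‖ * ‖χ‖ ∂μ := by
            refine norm_integral_le_of_norm_le (f.integrable.norm.mul_const _) ?_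
            filter_upwards [ae_norm_le χ] with x hx
            rw [norm_mul]
            gcongr
        _ = (∫ x, ‖f x‖ ∂μ) * ‖χ‖ := integral_mul_const _ _
        _ ≤ (1 + Φ.conj 1 * μ.real univ) * ‖f‖ * ‖χ‖ := by
            gcongr
            exact integral_norm_le f
        _ = _ := by ring

theorem pairing_apply [IsFiniteMeasure μ] (χ : Lp ℝ ⊤ μ) (f : Orlicz Φ μ) :
    pairing χ f = ∫ x, f x * χ x ∂μ := rfl

/-- The bounded function `t ↦ t / (1 + |t|)`. -/
noncomputable def squash (t : ℝ) : ℝ := t / (1 + |t|)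

theorem abs_squash_le (t : ℝ) : |squash t| ≤ 1 := by
  rw [squash, abs_div, abs_of_pos (by positivity : 0 < 1 + |t|)]
  exact div_le_one_of_le₀ (by linarith) (by positivity)

theorem continuous_squash : Continuous squash :=
  continuous_id.div (by fun_prop) fun t => by positivity

theorem memLp_squash [IsFiniteMeasure μ] {f : α → ℝ} (hf : AEStronglyMeasurable f μ) :
    MemLp (fun x => squash (f x)) ⊤ μ :=
  memLp_top_of_bound (continuous_squash.comp_aestronglyMeasurable hf) 1
    (ae_of_all _ fun _ => abs_squash_le _)

/-- The product `t · squash t = t²/(1 + |t|)` is nonnegative and vanishes only at `0`. A function is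
thus detected by a bounded function of itself, which inherits any invariance it has. -/
theorem ae_eq_zero_of_integral_mul_squash {f : α → ℝ} (hf : Integrable f μ)
    (h : ∫ x, f x * squash (f x) ∂μ = 0) : f =ᵐ[μ] 0 := by
  have hint : Integrable (fun x => f x * squash (f x)) μ :=
    hf.mul_of_top_left (memLp_top_of_bound (continuous_squash.comp_aestronglyMeasurable hf.1) 1
      (ae_of_all _ fun _ => abs_squash_le _))
  have hnn : ∀ t, 0 ≤ t * squash t := fun t => by
    rw [squash, ← mul_div_assoc]
    exact div_nonneg (mul_self_nonneg t) (by positivity)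
  have := (integral_eq_zero_iff_of_nonneg (fun x => hnn (f x)) hint).1 h
  filter_upwards [this] with x hx
  simp only [Pi.zero_apply, mul_eq_zero, squash, div_eq_zero_iff] at hx
  rcases hx with hx | hx | hx
  · exact hx
  · exact hx
  · exact absurd hx (by positivity)

theorem eq_zero_of_pairing [IsFiniteMeasure μ] {f : Orlicz Φ μ} (h : ∀ χ, pairing χ f = 0) :
    f = 0 := by
  refine ext (EventuallyEq.trans ?_ coe_zero.symm)
  refine ae_eq_zero_of_integral_mul_squash f.integrable ?_
  rw [← h (memLp_squash f.2.1).toLp, pairing_apply]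
  refine integral_congr_ae ?_
  filter_upwards [(memLp_squash f.2.1).coeFn_toLp] with x hx
  rw [hx]

theorem tendsto_ofFun [IsFiniteMeasure μ] (hΦ : Delta2 Φ) {f : ℕ → α → ℝ} {g h : α → ℝ}
    (hf : ∀ n, AEStronglyMeasurable (f n) μ) (hh : MemOrlicz Φ h μ)
    (hle : ∀ n, ∀ᵐ x ∂μ, ‖f n x‖ ≤ ‖h x‖)
    (hlim : ∀ᵐ x ∂μ, Tendsto (fun n => f n x) atTop (𝓝 (g x))) :
    Tendsto (fun n => ofFun μ Φ (f n)) atTop (𝓝 (ofFun μ Φ g)) := by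
  have hgm : AEStronglyMeasurable g μ := aestronglyMeasurable_of_tendsto_ae _ hf hlim
  have hg : MemOrlicz Φ g μ := hh.mono Φ hgm (by
    filter_upwards [hlim, ae_all_iff.2 hle] with x h1 h2
    exact le_of_tendsto h1.nnnorm (Eventually.of_forall h2))
  have hfn : ∀ n, MemOrlicz Φ (f n) μ := fun n => hh.mono Φ (hf n) (hle n)
  rw [tendsto_iff_norm_sub_tendsto_zero]
  have h1 := tendsto_luxemburg_zero Φ hΦ (f := fun n x => f n x - g x) (h := fun x => 2 * h x)
    (fun n => (hf n).sub hgm) (hh.smul Φ 2) (fun n => by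
      filter_upwards [hlim, ae_all_iff.2 hle] with x h1 h2
      have h3 : ‖g x‖ ≤ ‖h x‖ := le_of_tendsto h1.norm (Eventually.of_forall h2)
      rw [← NNReal.coe_le_coe, coe_nnnorm, coe_nnnorm, norm_mul]
      have h4 : ‖(2 : ℝ)‖ = 2 := by norm_num
      rw [h4]
      linarith [norm_sub_le (f n x) (g x), h2 n])
    (by
      filter_upwards [hlim] with x hx
      simpa using hx.sub_const (g x))
  have h2 := (NNReal.tendsto_coe.2 h1)
  rw [NNReal.coe_zero] at h2
  refine h2.congr fun n => ?_
  rw [← ofFun_sub (hfn n) hg, norm_ofFun]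
  have := (hfn n).add Φ (hg.smul Φ (-1))
  refine this.congr Φ (ae_of_all _ fun x => ?_)
  simp [sub_eq_add_neg]

/-- The truncation of `t` at height `M`. -/
noncomputable def trunc (M t : ℝ) : ℝ := max (-M) (min t M)

theorem continuous_trunc (M : ℝ) : Continuous (trunc M) := by unfold trunc; fun_prop

theorem abs_trunc_le {M : ℝ} (hM : 0 ≤ M) (t : ℝ) : |trunc M t| ≤ M := by
  rw [trunc, abs_le]
  exact ⟨le_max_left _ _, max_le (by linarith) (min_le_right _ _)⟩

theorem trunc_of_abs_le {M t : ℝ} (h : |t| ≤ M) : trunc M t = t := by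
  rw [abs_le] at h
  rw [trunc, min_eq_left h.2, max_eq_right h.1]

theorem abs_trunc_le_abs {M : ℝ} (hM : 0 ≤ M) (t : ℝ) : |trunc M t| ≤ |t| := by
  rcases le_total |t| M with h | h
  · rw [trunc_of_abs_le h]
  · exact (abs_trunc_le hM t).trans h

theorem abs_sub_trunc_le {M : ℝ} (hM : 0 ≤ M) (t : ℝ) : |t - trunc M t| ≤ |t| := by
  rcases le_total |t| M with h | h
  · rw [trunc_of_abs_le h]; simp
  · rw [trunc]
    rcases le_total 0 t with ht | ht
    · rw [abs_of_nonneg ht] at h ⊢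
      rw [min_eq_right h, max_eq_right (by linarith), abs_of_nonneg (by linarith)]
      linarith
    · rw [abs_of_nonpos ht] at h ⊢
      rw [min_eq_left (by linarith), max_eq_left (by linarith), abs_of_nonpos (by linarith)]
      linarith

theorem dense_range_toOrlicz [IsFiniteMeasure μ] (hΦ : Delta2 Φ) :
    DenseRange (toOrlicz Φ : Lp ℝ ⊤ μ →ₗ[ℝ] Orlicz Φ μ) := by
  intro f
  have hm : ∀ n : ℕ, AEStronglyMeasurable (fun x => trunc n (f x)) μ := fun n =>
    (continuous_trunc _).comp_aestronglyMeasurable f.2.1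
  have hb : ∀ n : ℕ, MemLp (fun x => trunc n (f x)) ⊤ μ := fun n =>
    memLp_top_of_bound (hm n) n (ae_of_all _ fun x => abs_trunc_le n.cast_nonneg _)
  have h := tendsto_ofFun hΦ hm (g := f) f.2 (fun n => ae_of_all _ fun x =>
      abs_trunc_le_abs n.cast_nonneg _) (ae_of_all _ fun x => by
        obtain ⟨n, hn⟩ := exists_nat_ge |f x|
        refine tendsto_const_nhds.congr' ?_
        filter_upwards [eventually_ge_atTop n] with m hm
        exact (trunc_of_abs_le (hn.trans (by exact_mod_cast hm))).symm)
  rw [ofFun_coe] at h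
  refine mem_closure_of_tendsto h (Eventually.of_forall fun n => ⟨(hb n).toLp, ?_⟩)
  refine ext ((hb n).coeFn_toLp.trans (coe_ofFun ?_).symm)
  exact f.2.mono Φ (hm n) (ae_of_all _ fun x => abs_trunc_le_abs n.cast_nonneg _)

end Orlicz

end OrliczTools

end StochTwoScale

namespace StochTwoScale

/-! ### Representation of functionals and membership in Orlicz classes by duality. -/

section Representation

variable {α : Type*} [MeasurableSpace α] {μ : Measure α} [IsFiniteMeasure μ]

/-- An order continuous linear functional on `L^∞(μ)` is represented by an integrable function. -/
theorem exists_integrable_of_orderContinuous (L : Lp ℝ ⊤ μ →ₗ[ℝ] ℝ)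
    (hL : ∀ (f : ℕ → Lp ℝ ⊤ μ) (C : ℝ), (∀ n, ∀ᵐ x ∂μ, ‖f n x‖ ≤ C) →
      (∀ᵐ x ∂μ, Tendsto (fun n => f n x) atTop (𝓝 0)) → Tendsto (fun n => L (f n)) atTop (𝓝 0)) :
    ∃ g, Integrable g μ ∧ ∀ f : Lp ℝ ⊤ μ, L f = ∫ x, f x * g x ∂μ := by
  classical
  let e : ∀ {A : Set α}, MeasurableSet A → Lp ℝ ⊤ μ := fun {A} hA =>
    indicatorConstLp ⊤ hA (measure_ne_top μ A) 1
  have he : ∀ {A : Set α} (hA : MeasurableSet A), e hA =ᵐ[μ] A.indicator fun _ => (1 : ℝ) :=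
    fun hA => indicatorConstLp_coeFn
  have hind : ∀ (A : Set α) (x : α), 0 ≤ A.indicator (fun _ => (1 : ℝ)) x ∧
      A.indicator (fun _ => (1 : ℝ)) x ≤ 1 := fun A x => by
    by_cases hx : x ∈ A <;> simp [hx]
  have hsum : ∀ (f : ℕ → Set α) (hf : ∀ i, MeasurableSet (f i)) (_ : Pairwise (Function.onFun Disjoint f))
      (s : Finset ℕ), ∑ i ∈ s, e (hf i) = e (s.measurableSet_biUnion fun i _ => hf i) := by
    intro f hf hd s
    induction s using Finset.induction_on with
    | empty =>
      refine Lp.ext ?_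
      filter_upwards [he (Finset.measurableSet_biUnion ∅ fun i _ => hf i),
        Lp.coeFn_zero ℝ ⊤ μ] with x h1 h2
      rw [Finset.sum_empty, h1, h2]
      simp
    | insert a s ha ih =>
      rw [Finset.sum_insert ha, ih]
      have hdis : Disjoint (f a) (⋃ i ∈ s, f i) := by
        simp only [disjoint_iUnion_right]
        exact fun i hi => hd fun h => ha (h ▸ hi)
      rw [← indicatorConstLp_disjoint_union (hf a) _ _ _ hdis]
      refine Lp.ext ?_
      refine indicatorConstLp_coeFn.trans (EventuallyEq.trans (ae_of_all _ fun x => ?_)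
        indicatorConstLp_coeFn.symm)
      simp
  -- The set function `A ↦ L(1_A)`; order continuity of `L` is its countable additivity. Its
  -- Radon–Nikodym derivative is the required density.
  let m : SignedMeasure α :=
    { measureOf' := fun A => if hA : MeasurableSet A then L (e hA) else 0
      empty' := by
        rw [dif_pos MeasurableSet.empty]
        have : e (MeasurableSet.empty (α := α)) = 0 := indicatorConstLp_empty
        rw [this, map_zero]
      not_measurable' := fun A hA => dif_neg hA
      m_iUnion' := fun f hf hd => by
        have hU := MeasurableSet.iUnion hf
        simp only [dif_pos (hf _), dif_pos hU]
        rw [HasSum, SummationFilter.unconditional_filter]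
        -- The filter `atTop` on finite sets of integers is countably generated, so sequences of
        -- finite sets suffice, and to these `hL` applies.
        refine tendsto_of_seq_tendsto fun s hs => ?_
        have hz : Tendsto (fun k => L (e hU - ∑ i ∈ s k, e (hf i))) atTop (𝓝 0) := by
          have hco : ∀ k, ∀ᵐ x ∂μ, (e hU - ∑ i ∈ s k, e (hf i) : Lp ℝ ⊤ μ) x =
              (⋃ i, f i).indicator (fun _ => (1 : ℝ)) x -
                (⋃ i ∈ s k, f i).indicator (fun _ => (1 : ℝ)) x := fun k => by
            rw [hsum f hf hd]
            filter_upwards [Lp.coeFn_sub (e hU) (e ((s k).measurableSet_biUnion fun i _ => hf i)),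
              he hU, he ((s k).measurableSet_biUnion fun i _ => hf i)] with x h1 h2 h3
            rw [h1, Pi.sub_apply, h2, h3]
          refine hL _ 1 (fun k => ?_) ?_
          · filter_upwards [hco k] with x hx
            rw [hx, Real.norm_eq_abs, abs_le]
            have h1 := hind (⋃ i, f i) x
            have h2 := hind (⋃ i ∈ s k, f i) x
            constructor <;> linarith
          · filter_upwards [ae_all_iff.2 hco] with x hx
            refine Tendsto.congr (fun k => (hx k).symm) ?_
            by_cases hxU : x ∈ ⋃ i, f i
            · obtain ⟨j, hj⟩ := mem_iUnion.1 hxU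
              refine tendsto_const_nhds.congr' ?_
              filter_upwards [hs.eventually (eventually_ge_atTop {j})] with k hk
              have : x ∈ ⋃ i ∈ s k, f i :=
                mem_iUnion₂.2 ⟨j, hk (Finset.mem_singleton_self j), hj⟩
              rw [indicator_of_mem hxU, indicator_of_mem this, sub_self]
            · refine tendsto_const_nhds.congr fun k => ?_
              have : x ∉ ⋃ i ∈ s k, f i := fun h =>
                hxU (iUnion₂_subset (fun i _ => subset_iUnion f i) h)
              rw [indicator_of_notMem hxU, indicator_of_notMem this, sub_self]
        have := (tendsto_const_nhds (x := L (e hU))).sub hz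
        rw [sub_zero] at this
        refine this.congr fun k => ?_
        rw [map_sub, map_sum, sub_sub_cancel]
        rfl }
  have hm : ∀ {A : Set α} (hA : MeasurableSet A), m A = L (e hA) := fun hA => dif_pos hA
  have hac : m ≪ᵥ μ.toENNRealVectorMeasure := by
    refine VectorMeasure.AbsolutelyContinuous.mk fun A hA h0 => ?_
    rw [Measure.toENNRealVectorMeasure_apply_measurable hA] at h0
    rw [hm hA]
    have : e hA = 0 := by
      refine Lp.ext ((he hA).trans (EventuallyEq.trans ?_ (Lp.coeFn_zero ℝ ⊤ μ).symm))
      exact indicator_meas_zero h0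
    rw [this, map_zero]
  refine ⟨m.rnDeriv μ, SignedMeasure.integrable_rnDeriv _ _, ?_⟩
  set g := m.rnDeriv μ with hg
  have hgi : Integrable g μ := SignedMeasure.integrable_rnDeriv _ _
  have hmg : ∀ {A : Set α} (hA : MeasurableSet A), L (e hA) = ∫ x in A, g x ∂μ := fun hA => by
    rw [← hm hA, ← SignedMeasure.withDensityᵥ_rnDeriv_eq m μ hac, withDensityᵥ_apply hgi hA]
  have hsimple : ∀ (s : SimpleFunc α ℝ) (h : MemLp s ⊤ μ), L h.toLp = ∫ x, s x * g x ∂μ := by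
    intro s
    induction s using SimpleFunc.induction with
    | @const c A hA =>
      intro h
      have h1 : h.toLp = c • e hA := by
        refine Lp.ext ?_
        filter_upwards [h.coeFn_toLp, he hA, Lp.coeFn_smul c (e hA)] with x h1 h2 h3
        rw [h1, h3, Pi.smul_apply, h2]
        by_cases hx : x ∈ A <;> simp [hx]
      rw [h1, map_smul, hmg hA, smul_eq_mul, ← integral_const_mul, ← integral_indicator hA]
      refine integral_congr_ae (ae_of_all _ fun x => ?_)
      by_cases hx : x ∈ A <;> simp [hx]
    | @add f f' hd hf hf' =>
      intro h
      have m1 : MemLp f ⊤ μ := f.memLp_top μ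
      have m2 : MemLp f' ⊤ μ := f'.memLp_top μ
      have h1 : h.toLp = m1.toLp + m2.toLp := by
        rw [← MemLp.toLp_add]
        rfl
      rw [h1, map_add, hf m1, hf' m2, ← integral_add
        (show Integrable (fun x => f x * g x) μ from hgi.mul_of_top_right m1)
        (show Integrable (fun x => f' x * g x) μ from hgi.mul_of_top_right m2)]
      refine integral_congr_ae (ae_of_all _ fun x => ?_)
      simp [add_mul]
  intro f
  have hfs : StronglyMeasurable f := Lp.stronglyMeasurable f
  have hfb : ∀ᵐ x ∂μ, ‖f x‖ ≤ ‖f‖ := Orlicz.ae_norm_le f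
  let s := hfs.approxBounded ‖f‖
  have hs1 : ∀ n x, ‖s n x‖ ≤ ‖f‖ := fun n x => hfs.norm_approxBounded_le (norm_nonneg f) n x
  have hs2 : ∀ᵐ x ∂μ, Tendsto (fun n => s n x) atTop (𝓝 (f x)) := hfs.tendsto_approxBounded_ae hfb
  have hs3 : ∀ n, MemLp (s n) ⊤ μ := fun n => (s n).memLp_top μ
  have hs4 : ∀ n, ∀ᵐ x ∂μ, ((hs3 n).toLp - f : Lp ℝ ⊤ μ) x = s n x - f x := fun n => by
    filter_upwards [Lp.coeFn_sub (hs3 n).toLp f, (hs3 n).coeFn_toLp] with x h1 h2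
    rw [h1, Pi.sub_apply, h2]
  have t1 : Tendsto (fun n => L ((hs3 n).toLp - f)) atTop (𝓝 0) := by
    refine hL _ (‖f‖ + ‖f‖) (fun n => ?_) ?_
    · filter_upwards [hs4 n, hfb] with x h1 h2
      rw [h1]
      exact (norm_sub_le _ _).trans (add_le_add (hs1 n x) h2)
    · filter_upwards [ae_all_iff.2 hs4, hs2] with x h1 h2
      have h3 := h2.sub_const (f x)
      rw [sub_self] at h3
      exact h3.congr fun n => (h1 n).symm
  have t2 : Tendsto (fun n => ∫ x, s n x * g x ∂μ) atTop (𝓝 (∫ x, f x * g x ∂μ)) := by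
    refine tendsto_integral_of_dominated_convergence (fun x => ‖f‖ * ‖g x‖) (fun n => ?_)
      (hgi.norm.const_mul _) (fun n => ae_of_all _ fun x => ?_) ?_
    · exact (hgi.mul_of_top_right (hs3 n)).1
    · rw [norm_mul]
      gcongr
      exact hs1 n x
    · filter_upwards [hs2] with x hx
      exact hx.mul_const _
  have t3 : Tendsto (fun n => L (hs3 n).toLp - L f) atTop (𝓝 (∫ x, f x * g x ∂μ - L f)) := by
    simp only [hsimple]
    exact t2.sub_const _
  have := tendsto_nhds_unique t1 (t3.congr fun n => (map_sub L _ _).symm)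
  linarith

/-- Membership in an Orlicz class by duality: it suffices to test with bounded functions of `g`. -/
theorem lintegral_le_one_of_test {g : α → ℝ} (hg : Integrable g μ) {A B : ℝ≥0 → ℝ≥0}
    (hA : Monotone A) (hA0 : A 0 = 0) (hB0 : B 0 = 0)
    (hBA : ∀ t, B (A t / t) ≤ A t) {a : ℝ≥0} (ha : 0 < a)
    (h : ∀ F : ℝ → ℝ, Measurable F → (∃ C, ∀ s, ‖F s‖ ≤ C) →
      ENNReal.ofReal (∫ x, g x * F (g x) ∂μ) ≤ a * (1 + ∫⁻ x, (B ‖F (g x)‖₊ : ℝ≥0∞) ∂μ)) :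
    ∫⁻ x, (A (‖g x‖₊ / (2 * a)) : ℝ≥0∞) ∂μ ≤ 1 := by
  -- Cutting off both large and small values keeps the test function bounded, since it contains a
  -- division by `|s|`, and keeps the integral to be estimated finite.
  let S : ℕ → Set ℝ := fun n => {s | ‖s‖ ≤ n ∧ (n + 1 : ℝ)⁻¹ ≤ ‖s‖}
  have hS : ∀ n, MeasurableSet (S n) := fun n =>
    (measurableSet_le measurable_norm measurable_const).inter
      (measurableSet_le measurable_const measurable_norm)
  let θ : ℝ → ℝ≥0 := fun s => ‖s‖₊ / (2 * a)
  have hθ : Measurable θ := measurable_nnnorm.div_const _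
  have hθ0 : ∀ s, s ≠ 0 → θ s ≠ 0 := fun s hs => by
    have := nnnorm_pos.2 hs
    positivity
  have hpt : ∀ n : ℕ, ∫⁻ x, ((g ⁻¹' S n).indicator (fun x => (A (θ (g x)) : ℝ≥0∞))) x ∂μ ≤ 1 := by
    intro n
    -- On `S n` one has `s F(s) = 2a A(θ)` and `B(|F(s)|) ≤ A(θ)`. With `J` the integral of
    -- `A(θ(g))` over `g ∈ S n`, the hypothesis reads `2aJ ≤ a(1 + J)`, so `J ≤ 1` because `J` is
    -- finite. The factor `2` in `θ` is what allows this absorption.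
    let F : ℝ → ℝ := (S n).indicator fun s => SignType.sign s * (A (θ s) / θ s : ℝ≥0)
    have hFm : Measurable F := by
      refine Measurable.indicator ?_ (hS n)
      have h1 : Measurable fun s : ℝ => ((SignType.sign s : SignType) : ℝ) := by
        have : (fun s : ℝ => ((SignType.sign s : SignType) : ℝ)) =
            fun s => if 0 < s then 1 else if s < 0 then -1 else 0 := by
          ext s
          rcases lt_trichotomy s 0 with hs | rfl | hs
          · simp [hs, hs.not_gt]
          · simp
          · simp [hs]
        rw [this]
        exact Measurable.ite measurableSet_Ioi measurable_const
          (Measurable.ite measurableSet_Iio measurable_const measurable_const)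
      exact h1.mul ((hA.measurable.comp hθ).div hθ).coe_nnreal_real
    have hFn : ∀ s, ‖F s‖₊ = (S n).indicator (fun s => A (θ s) / θ s) s := by
      intro s
      by_cases hs : s ∈ S n
      · have hs0 : s ≠ 0 := by
          rintro rfl
          have := hs.2
          simp only [norm_zero] at this
          exact absurd this (not_le.2 (by positivity))
        simp only [F, indicator_of_mem hs, nnnorm_mul]
        have : ‖((SignType.sign s : SignType) : ℝ)‖₊ = 1 := by
          rcases lt_or_gt_of_ne hs0 with h | h <;> simp [h]
        rw [this, one_mul, NNReal.nnnorm_eq]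
      · simp [F, indicator_of_notMem hs]
    have hFs : ∀ s, s * F s = (S n).indicator (fun s => 2 * a * (A (θ s) : ℝ)) s := by
      intro s
      by_cases hs : s ∈ S n
      · have hs0 : s ≠ 0 := by
          rintro rfl
          have := hs.2
          simp only [norm_zero] at this
          exact absurd this (not_le.2 (by positivity))
        simp only [F, indicator_of_mem hs]
        rw [← mul_assoc, mul_comm s, sign_mul_self]
        have ha' : (a : ℝ) ≠ 0 := by exact_mod_cast ha.ne'
        have hs' : |s| ≠ 0 := abs_ne_zero.2 hs0
        simp only [θ, NNReal.coe_div, NNReal.coe_mul, coe_nnnorm, Real.norm_eq_abs,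
          NNReal.coe_ofNat]
        field_simp
      · simp [F, indicator_of_notMem hs]
    have hAb : ∀ s ∈ S n, A (θ s) ≤ A (n / (2 * a)) := fun s hs => hA (by
      have h1 : ‖s‖₊ ≤ n := by
        have := hs.1
        rw [← NNReal.coe_le_coe]
        simpa using this
      simp only [θ]
      gcongr)
    have hFb : ∃ C, ∀ s, ‖F s‖ ≤ C := by
      refine ⟨(A (n / (2 * a)) / ((n + 1 : ℝ≥0)⁻¹ / (2 * a)) : ℝ≥0), fun s => ?_⟩
      rw [← coe_nnnorm, NNReal.coe_le_coe, hFn]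
      by_cases hs : s ∈ S n
      swap
      · rw [indicator_of_notMem hs]
        exact zero_le
      rw [indicator_of_mem hs]
      refine div_le_div₀ zero_le (hAb s hs) (by positivity) ?_
      simp only [θ]
      have : (n + 1 : ℝ≥0)⁻¹ ≤ ‖s‖₊ := by
        rw [← NNReal.coe_le_coe]
        simpa using hs.2
      gcongr
    have hJ : ∫⁻ x, (B ‖F (g x)‖₊ : ℝ≥0∞) ∂μ ≤
        ∫⁻ x, ((g ⁻¹' S n).indicator (fun x => (A (θ (g x)) : ℝ≥0∞))) x ∂μ := by
      refine lintegral_mono fun x => ?_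
      rw [hFn]
      by_cases hx : g x ∈ S n
      · rw [indicator_of_mem hx, indicator_of_mem (show x ∈ g ⁻¹' S n from hx)]
        exact ENNReal.coe_le_coe.2 (hBA _)
      · rw [indicator_of_notMem hx, hB0, ENNReal.coe_zero]
        exact zero_le
    have hI : ENNReal.ofReal (∫ x, g x * F (g x) ∂μ) =
        (2 * a : ℝ≥0) * ∫⁻ x, ((g ⁻¹' S n).indicator (fun x => (A (θ (g x)) : ℝ≥0∞))) x ∂μ := by
      obtain ⟨C, hC⟩ := hFb
      rw [ofReal_integral_eq_lintegral_ofReal, ← lintegral_const_mul' _ _ ENNReal.coe_ne_top]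
      · refine lintegral_congr fun x => ?_
        rw [hFs]
        by_cases hx : g x ∈ S n
        · rw [indicator_of_mem hx, indicator_of_mem (show x ∈ g ⁻¹' S n from hx),
            ← ENNReal.coe_mul, ← ENNReal.ofReal_coe_nnreal]
          simp
        · rw [indicator_of_notMem hx, indicator_of_notMem (show x ∉ g ⁻¹' S n from hx)]
          simp
      · exact hg.mul_of_top_left (memLp_top_of_bound
          (hFm.comp_aemeasurable hg.1.aemeasurable).aestronglyMeasurable C
          (ae_of_all _ fun x => hC _))
      · refine ae_of_all _ fun x => ?_
        simp only [hFs]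
        exact indicator_nonneg (fun _ _ => by positivity) _
    have hfin : ∫⁻ x, ((g ⁻¹' S n).indicator (fun x => (A (θ (g x)) : ℝ≥0∞))) x ∂μ < ∞ := by
      calc _ ≤ ∫⁻ _, (A (n / (2 * a)) : ℝ≥0∞) ∂μ := by
            refine lintegral_mono fun x => ?_
            by_cases hx : g x ∈ S n
            · rw [indicator_of_mem (show x ∈ g ⁻¹' S n from hx)]
              exact ENNReal.coe_le_coe.2 (hAb _ hx)
            · rw [indicator_of_notMem (show x ∉ g ⁻¹' S n from hx)]
              exact zero_le
        _ < ∞ := by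
          rw [lintegral_const]
          exact ENNReal.mul_lt_top ENNReal.coe_lt_top (measure_lt_top _ _)
    have h1 := h F hFm hFb
    rw [hI] at h1
    have h2 := h1.trans (mul_le_mul_right (add_le_add_right hJ 1) (a : ℝ≥0∞))
    obtain ⟨J, hJ'⟩ : ∃ J : ℝ≥0, ∫⁻ x, ((g ⁻¹' S n).indicator
      (fun x => (A (θ (g x)) : ℝ≥0∞))) x ∂μ = J := ⟨_, (ENNReal.coe_toNNReal hfin.ne).symm⟩
    rw [hJ'] at h2 ⊢
    have h3 : 2 * a * J ≤ a * (1 + J) := by exact_mod_cast h2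
    have h4 : 2 * J ≤ 1 + J := by
      refine le_of_mul_le_mul_left ?_ ha
      calc a * (2 * J) = 2 * a * J := by ring
        _ ≤ _ := h3
    have h5 : J ≤ 1 := by
      rw [two_mul] at h4
      exact le_of_add_le_add_right h4
    exact_mod_cast h5
  have hmono : ∀ x, Monotone fun n : ℕ =>
      ((g ⁻¹' S n).indicator (fun x => (A (θ (g x)) : ℝ≥0∞))) x := by
    intro x n k hnk
    have hsub : g ⁻¹' S n ⊆ g ⁻¹' S k := fun y hy =>
      ⟨hy.1.trans (by exact_mod_cast hnk), le_trans (by gcongr) hy.2⟩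
    change (g ⁻¹' S n).indicator _ x ≤ (g ⁻¹' S k).indicator _ x
    by_cases hx : x ∈ g ⁻¹' S n
    · rw [indicator_of_mem hx, indicator_of_mem (hsub hx)]
    · rw [indicator_of_notMem hx]
      exact zero_le
  have hmeas : ∀ n, AEMeasurable ((g ⁻¹' S n).indicator (fun x => (A (θ (g x)) : ℝ≥0∞))) μ := by
    intro n
    have h1 : Measurable ((S n).indicator fun s => (A (θ s) : ℝ≥0∞)) :=
      Measurable.indicator (hA.measurable.comp hθ).coe_nnreal_ennreal (hS n)
    exact h1.comp_aemeasurable hg.1.aemeasurable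
  have hlim : ∀ x, Tendsto (fun n : ℕ =>
      ((g ⁻¹' S n).indicator (fun x => (A (θ (g x)) : ℝ≥0∞))) x) atTop
      (𝓝 (A (θ (g x)) : ℝ≥0∞)) := by
    intro x
    by_cases hx : g x = 0
    · have : ∀ n, x ∉ g ⁻¹' S n := fun n hn => by
        have := hn.2
        rw [hx, norm_zero] at this
        exact absurd this (not_le.2 (by positivity))
      simp only [indicator_of_notMem (this _), θ, hx, nnnorm_zero, zero_div, hA0, ENNReal.coe_zero]
      exact tendsto_const_nhds
    · refine tendsto_const_nhds.congr' ?_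
      obtain ⟨n₁, h1⟩ := exists_nat_ge ‖g x‖
      obtain ⟨n₂, h2⟩ := exists_nat_ge ‖g x‖⁻¹
      filter_upwards [eventually_ge_atTop n₁, eventually_ge_atTop n₂] with n hn1 hn2
      have hmem : x ∈ g ⁻¹' S n := by
        refine ⟨h1.trans (by exact_mod_cast hn1), ?_⟩
        refine inv_le_of_inv_le₀ (norm_pos_iff.2 hx) (h2.trans ?_)
        have : (n₂ : ℝ) ≤ n := by exact_mod_cast hn2
        linarith
      rw [indicator_of_mem hmem]
  have := lintegral_tendsto_of_tendsto_of_monotone hmeas (ae_of_all _ hmono) (ae_of_all _ hlim)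
  exact le_of_tendsto this (Eventually.of_forall hpt)

end Representation

end StochTwoScale

/-! ### Weak sequential compactness of bounded sequences in Orlicz spaces. -/

namespace StochTwoScale

theorem cauchySeq_of_forall_approx {a : ℕ → ℝ}
    (h : ∀ η > 0, ∃ b : ℕ → ℝ, CauchySeq b ∧ ∀ n, |a n - b n| ≤ η) : CauchySeq a := by
  refine Metric.cauchySeq_iff'.2 fun η hη => ?_
  obtain ⟨b, hb, hab⟩ := h (η / 4) (by positivity)
  obtain ⟨n₀, hn₀⟩ := Metric.cauchySeq_iff'.1 hb (η / 4) (by positivity)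
  refine ⟨n₀, fun n hn => ?_⟩
  have h1 := hn₀ n hn
  rw [Real.dist_eq] at h1 ⊢
  have h2 := hab n
  have h3 := hab n₀
  rw [abs_lt] at h1 ⊢
  rw [abs_le] at h2 h3
  constructor <;> linarith [h1.1, h1.2, h2.1, h2.2, h3.1, h3.2]

/-- Countably many bounded sequences in a Hilbert space have a common weakly Cauchy subsequence. -/
theorem exists_subseq_inner {H : Type*} [NormedAddCommGroup H] [InnerProductSpace ℝ H]
    [CompleteSpace H] {κ : Type*} [Countable κ] (h : ℕ → κ → H) (B : κ → ℝ)
    (hB : ∀ n j, ‖h n j‖ ≤ B j) :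
    ∃ k : ℕ → ℕ, StrictMono k ∧ ∀ j f, CauchySeq fun n => inner ℝ f (h (k n) j) := by
  have hB0 : ∀ j, 0 ≤ B j := fun j => (norm_nonneg _).trans (hB 0 j)
  -- All mutual inner products form a point of a countable product of compact intervals, so one
  -- subsequence makes them all converge. This settles the vectors `f` in the span of the sequences,
  -- then those in its closure.
  let a : ℕ → (ℕ × κ × κ → ℝ) := fun n p => inner ℝ (h p.1 p.2.1) (h n p.2.2)
  have hK : IsCompact (Set.pi univ fun p : ℕ × κ × κ =>
      Icc (-(B p.2.1 * B p.2.2)) (B p.2.1 * B p.2.2)) :=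
    isCompact_univ_pi fun p => isCompact_Icc
  have ha : ∀ n, a n ∈ Set.pi univ fun p : ℕ × κ × κ =>
      Icc (-(B p.2.1 * B p.2.2)) (B p.2.1 * B p.2.2) := fun n p _ => by
    rw [mem_Icc, ← abs_le]
    exact (abs_real_inner_le_norm _ _).trans
      (mul_le_mul (hB _ _) (hB _ _) (norm_nonneg _) (hB0 _))
  obtain ⟨l, -, k, hk, hl⟩ := hK.tendsto_subseq ha
  refine ⟨k, hk, fun j => ?_⟩
  have hl' := tendsto_pi_nhds.1 hl
  let V : Submodule ℝ H := (Submodule.span ℝ (range fun p : ℕ × κ => h p.1 p.2)).topologicalClosure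
  have hspan : ∀ f ∈ Submodule.span ℝ (range fun p : ℕ × κ => h p.1 p.2),
      ∃ l, Tendsto (fun n => inner ℝ f (h (k n) j)) atTop (𝓝 l) := by
    intro f hf
    induction hf using Submodule.span_induction with
    | mem x hx =>
      obtain ⟨p, rfl⟩ := hx
      exact ⟨_, hl' (p.1, p.2, j)⟩
    | zero => exact ⟨0, by simp⟩
    | add x y _ _ h1 h2 =>
      obtain ⟨l1, h1⟩ := h1
      obtain ⟨l2, h2⟩ := h2
      exact ⟨l1 + l2, (h1.add h2).congr fun n => (inner_add_left _ _ _).symm⟩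
    | smul c x _ h1 =>
      obtain ⟨l1, h1⟩ := h1
      exact ⟨c * l1, (h1.const_mul c).congr fun n => (real_inner_smul_left _ _ _).symm⟩
  have hV : ∀ f ∈ V, CauchySeq fun n => inner ℝ f (h (k n) j) := by
    intro f hf
    refine cauchySeq_of_forall_approx fun η hη => ?_
    have hBj : 0 < B j + 1 := by linarith [hB0 j]
    obtain ⟨f', hf', hff⟩ := Metric.mem_closure_iff.1 hf (η / (B j + 1)) (by positivity)
    obtain ⟨l, hl⟩ := hspan f' hf'
    refine ⟨fun n => inner ℝ f' (h (k n) j), hl.cauchySeq, fun n => ?_⟩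
    rw [← inner_sub_left]
    refine (abs_real_inner_le_norm _ _).trans ?_
    rw [← dist_eq_norm]
    calc dist f f' * ‖h (k n) j‖ ≤ η / (B j + 1) * (B j + 1) := by
          refine mul_le_mul hff.le ((hB _ _).trans (by linarith)) (norm_nonneg _) (by positivity)
      _ = η := by field_simp
  intro f
  have : CompleteSpace V := (Submodule.isClosed_topologicalClosure _).completeSpace_coe
  -- The component of `f` orthogonal to `V` has zero inner product with every `h (k n) j`.
  have hproj := hV (V.starProjection f) (V.starProjection_apply_mem f)
  convert hproj using 2 with n
  have hmem : h (k n) j ∈ V :=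
    Submodule.le_topologicalClosure _ (Submodule.subset_span ⟨(k n, j), rfl⟩)
  have h0 := Submodule.starProjection_inner_eq_zero f (h (k n) j) hmem
  rw [inner_sub_left] at h0
  linarith

section Compactness

variable {α : Type*} [MeasurableSpace α] {μ : Measure α} {Φ : YoungFunction}

namespace Orlicz

theorem ofReal_abs_integral_mul_le (f : Orlicz Φ μ) (χ : α → ℝ) {a K : ℝ≥0} (ha : ‖f‖ < a)
    (hK : 0 < K) :
    ENNReal.ofReal |∫ x, f x * χ x ∂μ| ≤
      (a / K : ℝ≥0) * (1 + ∫⁻ x, (Φ.conj (K * ‖χ x‖₊) : ℝ≥0∞) ∂μ) := by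
  have ha0 : 0 < a := by
    have := (norm_nonneg f).trans_lt ha
    exact_mod_cast this
  rw [← Real.norm_eq_abs, ofReal_norm]
  refine (enorm_integral_le_lintegral_enorm _).trans ?_
  simp only [enorm_mul]
  refine (lintegral_mul_le_young Φ f.2.1 ha0 hK).trans ?_
  gcongr
  exact modular_le_one f ha

theorem memLp_comp {F : ℝ → ℝ} (hF : Measurable F) {C : ℝ} (hC : ∀ s, ‖F s‖ ≤ C) {g : α → ℝ}
    (hg : AEStronglyMeasurable g μ) : MemLp (fun x => F (g x)) ⊤ μ :=
  memLp_top_of_bound (hF.comp_aemeasurable hg.aemeasurable).aestronglyMeasurable C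
    (ae_of_all _ fun _ => hC _)

/-- Superlinear growth of `Φ` makes norm-bounded sets uniformly integrable: where `|f| ≥ M ≥ a t₀`
one has `|f| ≤ η Φ(|f|/a)`, and the modular at `a` is at most `1`. -/
theorem exists_trunc_integral_le {a : ℝ≥0} (ha : 0 < a) {η : ℝ} (hη : 0 < η) :
    ∃ M : ℕ, ∀ f : Orlicz Φ μ, ‖f‖ < a → ∫ x, |f x - trunc M (f x)| ∂μ ≤ η := by
  lift η to ℝ≥0 using hη.le
  obtain ⟨t₀, ht₀⟩ := (tendsto_atTop.1 Φ.tendsto_top' (a / η)).exists_forall_of_atTop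
  obtain ⟨M, hM⟩ := exists_nat_ge (a * t₀)
  refine ⟨M, fun f hf => ?_⟩
  have hη' : 0 < η := by exact_mod_cast hη
  have hpt : ∀ x, ‖f x - trunc M (f x)‖₊ ≤ η * Φ (‖f x‖₊ / a) := by
    intro x
    rcases le_total |f x| M with h | h
    · rw [trunc_of_abs_le h]; simp
    · have h1 : ‖f x - trunc M (f x)‖₊ ≤ ‖f x‖₊ := abs_sub_trunc_le M.cast_nonneg _
      have h2 : t₀ ≤ ‖f x‖₊ / a := by
        rw [le_div_iff₀ ha, mul_comm]
        refine hM.trans ?_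
        rw [← NNReal.coe_le_coe]
        simpa using h
      refine h1.trans ?_
      rcases eq_or_ne ‖f x‖₊ 0 with h0 | h0
      · rw [h0]; exact zero_le
      have h3 := ht₀ _ h2
      have h4 : 0 < ‖f x‖₊ / a := div_pos (pos_iff_ne_zero.2 h0) ha
      rw [le_div_iff₀ h4] at h3
      calc ‖f x‖₊ = η * (a / η * (‖f x‖₊ / a)) := by field_simp
        _ ≤ _ := by gcongr
  have hm : AEStronglyMeasurable (fun x => f x - trunc M (f x)) μ :=
    f.2.1.sub ((continuous_trunc _).comp_aestronglyMeasurable f.2.1)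
  simp only [← Real.norm_eq_abs]
  rw [integral_norm_eq_lintegral_enorm hm]
  refine ENNReal.toReal_le_of_le_ofReal hη.le ?_
  calc ∫⁻ x, ‖f x - trunc M (f x)‖ₑ ∂μ
      ≤ ∫⁻ x, (η : ℝ≥0∞) * (Φ (‖f x‖₊ / a) : ℝ≥0∞) ∂μ := by
        refine lintegral_mono fun x => ?_
        rw [← ENNReal.coe_mul, enorm_eq_nnnorm]
        exact ENNReal.coe_le_coe.2 (hpt x)
    _ = (η : ℝ≥0∞) * modular Φ f μ a :=
        lintegral_const_mul' _ _ ENNReal.coe_ne_top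
    _ ≤ (η : ℝ≥0∞) * 1 := by gcongr; exact modular_le_one f hf
    _ = ENNReal.ofReal η := by
        rw [mul_one, ENNReal.ofReal_coe_nnreal]

variable [IsFiniteMeasure μ]

theorem pairing_add (χ χ' : Lp ℝ ⊤ μ) (f : Orlicz Φ μ) :
    pairing (χ + χ') f = pairing χ f + pairing χ' f := by
  rw [pairing_apply, pairing_apply, pairing_apply,
    ← integral_add (integrable_mul f χ) (integrable_mul f χ')]
  refine integral_congr_ae ?_
  filter_upwards [Lp.coeFn_add χ χ'] with x hx
  rw [hx, Pi.add_apply, mul_add]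

theorem pairing_smul (c : ℝ) (χ : Lp ℝ ⊤ μ) (f : Orlicz Φ μ) :
    pairing (c • χ) f = c * pairing χ f := by
  rw [pairing_apply, pairing_apply, ← integral_const_mul]
  refine integral_congr_ae ?_
  filter_upwards [Lp.coeFn_smul c χ] with x hx
  rw [hx, Pi.smul_apply, smul_eq_mul]
  ring

theorem tendsto_lintegral_conj {f : ℕ → α → ℝ} (hf : ∀ n, AEStronglyMeasurable (f n) μ) {C : ℝ}
    (hC : ∀ n, ∀ᵐ x ∂μ, ‖f n x‖ ≤ C) (hlim : ∀ᵐ x ∂μ, Tendsto (fun n => f n x) atTop (𝓝 0))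
    (K : ℝ≥0) :
    Tendsto (fun n => ∫⁻ x, (Φ.conj (K * ‖f n x‖₊) : ℝ≥0∞) ∂μ) atTop (𝓝 0) := by
  have := tendsto_lintegral_of_dominated_convergence' (μ := μ)
    (F := fun n x => (Φ.conj (K * ‖f n x‖₊) : ℝ≥0∞)) (f := fun _ => 0)
    (fun x => (Φ.conj (K * C.toNNReal) : ℝ≥0∞)) (fun n => ?_) (fun n => ?_) ?_ ?_
  · rwa [lintegral_zero] at this
  · exact (Φ.conj_mono.measurable.comp (measurable_const_mul K)).coe_nnreal_ennreal.comp_aemeasurable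
      (hf n).nnnorm.aemeasurable
  · filter_upwards [hC n] with x hx
    refine ENNReal.coe_le_coe.2 (Φ.conj_mono ?_)
    gcongr
    exact NNReal.le_toNNReal_of_coe_le hx
  · rw [lintegral_const]
    exact (ENNReal.mul_lt_top ENNReal.coe_lt_top (measure_lt_top _ _)).ne
  · filter_upwards [hlim] with x hx
    have h1 : Tendsto (fun n => K * ‖f n x‖₊) atTop (𝓝 0) := by
      simpa using hx.nnnorm.const_mul K
    exact ENNReal.tendsto_coe.2 (Φ.tendsto_conj_zero.comp h1)

theorem memOrlicz_of_test {g : α → ℝ} (hg : Integrable g μ) {a : ℝ≥0} (ha : 0 < a)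
    (h : ∀ F : ℝ → ℝ, Measurable F → (∃ C, ∀ s, ‖F s‖ ≤ C) →
      ENNReal.ofReal (∫ x, g x * F (g x) ∂μ) ≤
        a * (1 + ∫⁻ x, (Φ.conj ‖F (g x)‖₊ : ℝ≥0∞) ∂μ)) : MemOrlicz Φ g μ :=
  ⟨hg.1, 2 * a, by positivity, (lintegral_le_one_of_test hg Φ.mono Φ.map_zero
    Φ.conj_zero Φ.conj_div_le ha h).trans_lt ENNReal.one_lt_top⟩

theorem pairing_toLp {χ : α → ℝ} (hχ : MemLp χ ⊤ μ) (f : Orlicz Φ μ) :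
    pairing hχ.toLp f = ∫ x, f x * χ x ∂μ := by
  rw [pairing_apply]
  refine integral_congr_ae ?_
  filter_upwards [hχ.coeFn_toLp] with x hx
  rw [hx]

/-- Countably many bounded sequences in `L^Φ(μ)` have a common subsequence that converges against
bounded functions. -/
theorem exists_subseq_pairing {ι : Type*} [Countable ι] (w : ℕ → ι → Orlicz Φ μ) {C : ℝ}
    (hw : ∀ n i, ‖w n i‖ ≤ C) :
    ∃ (k : ℕ → ℕ) (w₀ : ι → Orlicz Φ μ), StrictMono k ∧
      ∀ i χ, Tendsto (fun n => pairing χ (w (k n) i)) atTop (𝓝 (pairing χ (w₀ i))) := by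
  let a : ℝ≥0 := C.toNNReal + 1
  have ha : 0 < a := by positivity
  have hwa : ∀ n i, ‖w n i‖ < a := fun n i => by
    refine ((hw n i).trans (Real.le_coe_toNNReal C)).trans_lt ?_
    exact_mod_cast lt_add_one C.toNNReal
  have hm : ∀ n i (M : ℕ), AEStronglyMeasurable (fun x => trunc M (w n i x)) μ := fun n i M =>
    (continuous_trunc _).comp_aestronglyMeasurable (w n i).2.1
  have hL2 : ∀ n i (M : ℕ), MemLp (fun x => trunc M (w n i x)) 2 μ := fun n i M =>
    MemLp.of_bound (hm n i M) M (ae_of_all _ fun x => abs_trunc_le M.cast_nonneg _)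
  -- The truncations at each integer height are bounded in `L²`, so one subsequence serves all
  -- indices and all heights. By `exists_trunc_integral_le` the remainders are uniformly small in
  -- `L¹`.
  obtain ⟨k, hk, hcau⟩ := exists_subseq_inner (κ := ι × ℕ)
    (fun n p => (hL2 n p.1 p.2).toLp) (fun p => measureUnivNNReal μ ^ (2 : ℝ≥0∞).toReal⁻¹ * p.2)
    (fun n p => by
      refine Lp.norm_le_of_ae_bound p.2.cast_nonneg ?_
      filter_upwards [(hL2 n p.1 p.2).coeFn_toLp] with x hx
      rw [hx]
      exact abs_trunc_le p.2.cast_nonneg _)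
  have hcau' : ∀ i (χ : Lp ℝ ⊤ μ), CauchySeq fun n => pairing χ (w (k n) i) := by
    intro i χ
    refine cauchySeq_of_forall_approx fun η hη => ?_
    have hχ0 : 0 < ‖χ‖ + 1 := by positivity
    obtain ⟨M, hM⟩ := exists_trunc_integral_le (Φ := Φ) (μ := μ) ha (div_pos hη hχ0)
    have hχ2 : MemLp χ 2 μ := (Lp.memLp χ).mono_exponent le_top
    refine ⟨_, hcau (i, M) hχ2.toLp, fun n => ?_⟩
    have e1 : inner ℝ hχ2.toLp (hL2 (k n) i M).toLp =
        ∫ x, trunc M (w (k n) i x) * χ x ∂μ := by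
      rw [L2.inner_def]
      refine integral_congr_ae ?_
      filter_upwards [hχ2.coeFn_toLp, (hL2 (k n) i M).coeFn_toLp] with x h1 h2
      rw [h1, h2]
      rfl
    have hti : Integrable (fun x => trunc M (w (k n) i x)) μ :=
      (hL2 (k n) i M).integrable (by norm_num)
    rw [e1, pairing_apply, ← integral_sub (integrable_mul _ χ)
      (show Integrable (fun x => trunc M (w (k n) i x) * χ x) μ from
        hti.mul_of_top_left (Lp.memLp χ))]
    calc |∫ x, (w (k n) i x * χ x - trunc M (w (k n) i x) * χ x) ∂μ|
        ≤ ∫ x, |w (k n) i x - trunc M (w (k n) i x)| * ‖χ‖ ∂μ := by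
          rw [← Real.norm_eq_abs]
          refine norm_integral_le_of_norm_le
            (((w (k n) i).integrable.sub hti).norm.mul_const _) ?_
          filter_upwards [ae_norm_le χ] with x hx
          rw [← sub_mul, norm_mul, Real.norm_eq_abs]
          gcongr
      _ = (∫ x, |w (k n) i x - trunc M (w (k n) i x)| ∂μ) * ‖χ‖ := integral_mul_const _ _
      _ ≤ η / (‖χ‖ + 1) * (‖χ‖ + 1) := by
          refine mul_le_mul (hM _ (hwa _ _)) (by linarith) (norm_nonneg _) (by positivity)
      _ = η := by field_simp
  choose L hL using fun i χ => cauchySeq_tendsto_of_complete (hcau' i χ)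
  let L' : ι → Lp ℝ ⊤ μ →ₗ[ℝ] ℝ := fun i =>
    { toFun := L i
      map_add' := fun χ χ' => tendsto_nhds_unique (hL i (χ + χ'))
        (((hL i χ).add (hL i χ')).congr fun n => (pairing_add _ _ _).symm)
      map_smul' := fun c χ => tendsto_nhds_unique (hL i (c • χ))
        (((hL i χ).const_mul c).congr fun n => (pairing_smul _ _ _).symm) }
  -- The Young bound, with its free `K`, passes to the limit functional. Large `K` gives order
  -- continuity, hence a density, and `K = 1` puts that density in `L^Φ`.
  have hLb : ∀ i χ (K : ℝ≥0), 0 < K → ENNReal.ofReal |L i χ| ≤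
      (a / K : ℝ≥0) * (1 + ∫⁻ x, (Φ.conj (K * ‖χ x‖₊) : ℝ≥0∞) ∂μ) := by
    intro i χ K hK
    have h1 := ((ENNReal.continuous_ofReal.comp continuous_abs).tendsto _).comp (hL i χ)
    exact le_of_tendsto h1 (Eventually.of_forall fun n =>
      ofReal_abs_integral_mul_le _ _ (hwa _ _) hK)
  have hrep : ∀ i, ∃ g, Integrable g μ ∧ ∀ χ : Lp ℝ ⊤ μ, L i χ = ∫ x, χ x * g x ∂μ := by
    intro i
    refine exists_integrable_of_orderContinuous (L' i) fun f B hB hlim => ?_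
    change Tendsto (fun n => L i (f n)) atTop (𝓝 0)
    refine squeeze_zero_norm' (a := fun n => |L i (f n)|) (Eventually.of_forall fun n => le_rfl) ?_
    refine tendsto_order.2 ⟨fun b hb => Eventually.of_forall fun n => hb.trans_le (abs_nonneg _),
      fun η hη => ?_⟩
    lift η to ℝ≥0 using hη.le
    have hη' : 0 < η := by exact_mod_cast hη
    -- Once the conjugate modular is below `1`, the bound `(a/K)(1 + 1)` equals `2η/3 < η`.
    let K : ℝ≥0 := 3 * a / η
    have hK : 0 < K := by positivity
    have h1 := tendsto_lintegral_conj (Φ := Φ) (fun n => (Lp.memLp (f n)).1) hB hlim K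
    filter_upwards [h1.eventually (gt_mem_nhds zero_lt_one)] with n hn
    have h2 := (hLb i (f n) K hK).trans (mul_le_mul_right (add_le_add_right hn.le 1) _)
    have h3 : (((a / K : ℝ≥0) : ℝ≥0∞) * (1 + 1)) = ENNReal.ofReal (2 / 3 * η) := by
      rw [one_add_one_eq_two, ← ENNReal.coe_ofNat, ← ENNReal.coe_mul, ← ENNReal.ofReal_coe_nnreal]
      congr 1
      have : a / K = η / 3 := by simp only [K]; field_simp
      rw [this]
      push_cast
      ring
    rw [h3, ENNReal.ofReal_le_ofReal_iff (by positivity)] at h2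
    linarith
  choose g hg hLg using hrep
  have hmem : ∀ i, MemOrlicz Φ (g i) μ := by
    intro i
    refine memOrlicz_of_test (hg i) ha fun F hF ⟨B, hB⟩ => ?_
    have hF' := memLp_comp hF hB (hg i).1
    have h1 := hLb i hF'.toLp 1 one_pos
    have e1 : L i hF'.toLp = ∫ x, g i x * F (g i x) ∂μ := by
      rw [hLg]
      refine integral_congr_ae ?_
      filter_upwards [hF'.coeFn_toLp] with x hx
      rw [hx, mul_comm]
    rw [e1, div_one] at h1
    refine (ENNReal.ofReal_le_ofReal (le_abs_self _)).trans (h1.trans (le_of_eq ?_))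
    congr 2
    refine lintegral_congr_ae ?_
    filter_upwards [hF'.coeFn_toLp] with x hx
    rw [hx, one_mul]
  refine ⟨k, fun i => ofFun μ Φ (g i), hk, fun i χ => ?_⟩
  have : pairing χ (ofFun μ Φ (g i)) = L i χ := by
    rw [pairing_apply, hLg]
    refine integral_congr_ae ?_
    filter_upwards [coe_ofFun (hmem i)] with x hx
    rw [hx, mul_comm]
  rw [this]
  exact hL i χ

/-- The functionals on `L^Φ(μ)` are approximated in norm by the pairings with bounded functions. -/
theorem exists_pairing_approx (hΦ : Delta2 Φ) (hΦ' : Delta2 Φ.conj) (ℓ : Orlicz Φ μ →L[ℝ] ℝ)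
    {η : ℝ} (hη : 0 < η) :
    ∃ χ : Lp ℝ ⊤ μ, ∀ f, |ℓ f - pairing χ f| ≤ η * ‖f‖ := by
  have hofFun : ∀ f : Lp ℝ ⊤ μ, toOrlicz Φ f = ofFun μ Φ f := fun f =>
    (ofFun_coe (toOrlicz Φ f)).symm
  -- By `Δ₂` for `Φ`, bounded pointwise convergence implies norm convergence, so `ℓ` is order
  -- continuous on `L^∞` and is given there by a density `g`.
  obtain ⟨g, hg, hℓg⟩ := exists_integrable_of_orderContinuous
    (ℓ.toLinearMap ∘ₗ toOrlicz Φ) fun f B hB hlim => by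
      have h1 := tendsto_ofFun (Φ := Φ) hΦ (f := fun n => f n) (g := fun _ => 0) (h := fun _ => B)
        (fun n => (Lp.memLp (f n)).1)
        (MemOrlicz.of_ae_bound Φ aestronglyMeasurable_const (ae_of_all _ fun _ => le_rfl))
        (fun n => (hB n).mono fun x hx => hx.trans (le_abs_self B)) hlim
      have h0 : ofFun μ Φ (fun _ => 0) = 0 := ext ((coe_ofFun (MemOrlicz.zero Φ)).trans coe_zero.symm)
      rw [h0] at h1
      have h2 := (ℓ.continuous.tendsto 0).comp h1
      rw [map_zero] at h2
      refine h2.congr fun n => ?_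
      change ℓ (ofFun μ Φ (f n)) = ℓ (toOrlicz Φ (f n))
      rw [hofFun]
  simp only [LinearMap.comp_apply, ContinuousLinearMap.coe_coe] at hℓg
  let c : ℝ≥0 := ‖ℓ‖₊ + 1
  have hc : 0 < c := by positivity
  -- The duality test with the roles of `Φ` and its conjugate exchanged, whence the need for
  -- `map_conj_div_le`.
  have hconj : ∫⁻ x, (Φ.conj (‖g x‖₊ / (2 * c)) : ℝ≥0∞) ∂μ ≤ 1 := by
    refine lintegral_le_one_of_test hg Φ.conj_mono Φ.conj_zero Φ.map_zero Φ.map_conj_div_le hc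
      fun F hF ⟨B, hB⟩ => ?_
    have hF' := memLp_comp hF hB hg.1
    have e1 : ∫ x, g x * F (g x) ∂μ = ℓ (toOrlicz Φ hF'.toLp) := by
      rw [hℓg]
      refine integral_congr_ae ?_
      filter_upwards [hF'.coeFn_toLp] with x hx
      rw [hx, mul_comm]
    have hmem : MemOrlicz Φ (fun x => F (g x)) μ :=
      MemOrlicz.of_ae_bound Φ hF'.1 (C := B.toNNReal)
        (ae_of_all _ fun x => NNReal.le_toNNReal_of_coe_le (hB _))
    have e2 : ‖toOrlicz Φ hF'.toLp‖ = luxemburg Φ (fun x => F (g x)) μ :=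
      norm_eq_of_ae _ hF'.coeFn_toLp
    have hfin : modular Φ (fun x => F (g x)) μ 1 < ∞ := by
      calc modular Φ (fun x => F (g x)) μ 1 ≤ ∫⁻ _, (Φ B.toNNReal : ℝ≥0∞) ∂μ :=
            lintegral_mono fun x => ENNReal.coe_le_coe.2 (Φ.mono (by
              rw [div_one]; exact NNReal.le_toNNReal_of_coe_le (hB _)))
        _ < ⊤ := by
            rw [lintegral_const]
            exact ENNReal.mul_lt_top ENNReal.coe_lt_top (measure_lt_top _ _)
    have h2 := luxemburg_le_mul_modular Φ one_pos hfin
    have h3 : ℓ (toOrlicz Φ hF'.toLp) ≤ c * luxemburg Φ (fun x => F (g x)) μ := by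
      refine (le_abs_self _).trans ((ℓ.le_opNorm _).trans ?_)
      rw [e2]
      gcongr
      simp [c]
    rw [e1]
    refine (ENNReal.ofReal_le_ofReal h3).trans ?_
    rw [← NNReal.coe_mul, ENNReal.ofReal_coe_nnreal, ENNReal.coe_mul]
    gcongr
    simpa [modular] using h2
  lift η to ℝ≥0 using hη.le
  have hη' : 0 < η := by exact_mod_cast hη
  -- For this `K` the bound `(a/K)(1 + 1)` equals `ηa`. By `Δ₂` for the conjugate, the conjugate
  -- modular of `Kg` is finite, so that of `K(g - χ M)` tends to zero.
  let K : ℝ≥0 := 2 / η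
  have hK : 0 < K := by positivity
  have hKg : ∫⁻ x, (Φ.conj (K * ‖g x‖₊) : ℝ≥0∞) ∂μ < ∞ := by
    have := hΦ'.lintegral_mul_lt_top Φ.conj_mono (hconj.trans_lt ENNReal.one_lt_top) (K * (2 * c))
    refine lt_of_eq_of_lt (lintegral_congr fun x => ?_) this
    congr 2
    field_simp
  let χ : ℕ → α → ℝ := fun M x => if ‖g x‖ ≤ M then g x else 0
  have hχm : ∀ M, AEStronglyMeasurable (χ M) μ := fun M => by
    have h1 : Measurable fun t : ℝ => if ‖t‖ ≤ M then t else 0 :=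
      Measurable.ite (measurableSet_le measurable_norm measurable_const) measurable_id
        measurable_const
    exact (h1.comp_aemeasurable hg.1.aemeasurable).aestronglyMeasurable
  have hχ : ∀ M, MemLp (χ M) ⊤ μ := fun M => by
    refine memLp_top_of_bound (hχm M) M (ae_of_all _ fun x => ?_)
    by_cases h : ‖g x‖ ≤ M <;> simp only [χ, h, if_true, if_false]
    simp
  have hlim : Tendsto (fun M : ℕ => ∫⁻ x, (Φ.conj (K * ‖g x - χ M x‖₊) : ℝ≥0∞) ∂μ) atTop (𝓝 0) := by
    have := tendsto_lintegral_of_dominated_convergence' (μ := μ)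
      (F := fun M x => (Φ.conj (K * ‖g x - χ M x‖₊) : ℝ≥0∞)) (f := fun _ => 0)
      (fun x => (Φ.conj (K * ‖g x‖₊) : ℝ≥0∞)) (fun M => ?_) (fun M => ae_of_all _ fun x => ?_)
      hKg.ne (ae_of_all _ fun x => ?_)
    · rwa [lintegral_zero] at this
    · exact (Φ.conj_mono.measurable.comp
        (measurable_const_mul K)).coe_nnreal_ennreal.comp_aemeasurable
        (hg.1.sub (hχm M)).nnnorm.aemeasurable
    · refine ENNReal.coe_le_coe.2 (Φ.conj_mono ?_)
      gcongr
      by_cases h : ‖g x‖ ≤ M <;> simp only [χ, h, if_true, if_false] <;> simp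
    · obtain ⟨n, hn⟩ := exists_nat_ge ‖g x‖
      refine tendsto_const_nhds.congr' ?_
      filter_upwards [eventually_ge_atTop n] with M hM
      have : ‖g x‖ ≤ M := hn.trans (by exact_mod_cast hM)
      simp only [χ, this, if_true, sub_self, nnnorm_zero, mul_zero, Φ.conj_zero, ENNReal.coe_zero]
  obtain ⟨M, hM⟩ := (hlim.eventually (gt_mem_nhds zero_lt_one)).exists
  refine ⟨(hχ M).toLp, fun f => ?_⟩
  refine (dense_range_toOrlicz hΦ).induction_on (p := fun f : Orlicz Φ μ => |ℓ f - pairing (hχ M).toLp f| ≤ η * ‖f‖) f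
    (isClosed_le (by fun_prop) (by fun_prop)) fun ψ => ?_
  have e1 : ℓ (toOrlicz Φ ψ) - pairing (hχ M).toLp (toOrlicz Φ ψ) =
      ∫ x, toOrlicz Φ ψ x * (g x - χ M x) ∂μ := by
    rw [hℓg, pairing_toLp, coe_toOrlicz,
      ← integral_sub (show Integrable (fun x => ψ x * g x) μ from hg.mul_of_top_right (Lp.memLp ψ))
        (show Integrable (fun x => ψ x * χ M x) μ from
          ((hχ M).integrable le_top).mul_of_top_right (Lp.memLp ψ))]
    simp only [mul_sub]
  rw [e1]
  have key : ∀ a : ℝ≥0, ‖toOrlicz Φ ψ‖ < a →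
      |∫ x, toOrlicz Φ ψ x * (g x - χ M x) ∂μ| ≤ η * a := by
    intro a ha
    have h1 := (ofReal_abs_integral_mul_le _ (fun x => g x - χ M x) ha hK).trans
      (mul_le_mul_right (add_le_add_right hM.le 1) _)
    have h3 : (((a / K : ℝ≥0) : ℝ≥0∞) * (1 + 1)) = ENNReal.ofReal (η * a) := by
      rw [one_add_one_eq_two, ← ENNReal.coe_ofNat, ← ENNReal.coe_mul, ← ENNReal.ofReal_coe_nnreal]
      congr 1
      have : a / K * 2 = η * a := by simp only [K]; field_simp
      rw [this, NNReal.coe_mul]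
    rw [h3, ENNReal.ofReal_le_ofReal_iff (by positivity)] at h1
    exact h1
  refine le_of_forall_pos_le_add fun δ hδ => ?_
  have := key ⟨‖toOrlicz Φ ψ‖ + δ / η, by positivity⟩
    (by change ‖toOrlicz Φ ψ‖ < ‖toOrlicz Φ ψ‖ + δ / η; linarith [div_pos hδ hη])
  refine this.trans (le_of_eq ?_)
  change η * (‖toOrlicz Φ ψ‖ + δ / η) = _
  field_simp

/-- A bounded sequence that converges against bounded functions converges weakly. -/
theorem tendsto_of_pairing (hΦ : Delta2 Φ) (hΦ' : Delta2 Φ.conj) {f : ℕ → Orlicz Φ μ}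
    {f₀ : Orlicz Φ μ} {C : ℝ} (hC : ∀ n, ‖f n‖ ≤ C)
    (h : ∀ χ, Tendsto (fun n => pairing χ (f n)) atTop (𝓝 (pairing χ f₀)))
    (ℓ : Orlicz Φ μ →L[ℝ] ℝ) : Tendsto (fun n => ℓ (f n)) atTop (𝓝 (ℓ f₀)) := by
  refine Metric.tendsto_atTop.2 fun η hη => ?_
  have hC0 : 0 ≤ C := (norm_nonneg _).trans (hC 0)
  obtain ⟨χ, hχ⟩ := exists_pairing_approx hΦ hΦ' ℓ (η := η / (3 * (C + ‖f₀‖ + 1))) (by positivity)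
  have hb : ∀ g : Orlicz Φ μ, ‖g‖ ≤ C + ‖f₀‖ + 1 → |ℓ g - pairing χ g| ≤ η / 3 := fun g hg =>
    (hχ g).trans (by
      calc η / (3 * (C + ‖f₀‖ + 1)) * ‖g‖ ≤ η / (3 * (C + ‖f₀‖ + 1)) * (C + ‖f₀‖ + 1) := by gcongr
        _ = η / 3 := by field_simp)
  obtain ⟨n₀, hn₀⟩ := Metric.tendsto_atTop.1 (h χ) (η / 3) (by positivity)
  refine ⟨n₀, fun n hn => ?_⟩
  have h1 := hn₀ n hn
  have h2 := hb (f n) (by linarith [hC n, norm_nonneg f₀])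
  have h3 := hb f₀ (by linarith)
  rw [Real.dist_eq, abs_lt] at h1 ⊢
  rw [abs_le] at h2 h3
  constructor <;> linarith [h1.1, h1.2, h2.1, h2.2, h3.1, h3.2]

end Orlicz

end Compactness

end StochTwoScale

namespace StochTwoScale

/-! ### Slices of functions on a product as maps into an Orlicz space. -/

section Slice

variable {X Ω : Type*} [MeasurableSpace X] [MeasurableSpace Ω] {κ : Measure X} {μ : Measure Ω}
  {Φ : YoungFunction}

variable (μ Φ) in
/-- The slice `v(x, ·)`, as an element of `L^Φ(μ)`. -/
noncomputable def slice (v : X × Ω → ℝ) (x : X) : Orlicz Φ μ := Orlicz.ofFun μ Φ fun ω => v (x, ω)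

theorem slice_congr [SFinite μ] {v v' : X × Ω → ℝ} (h : v =ᵐ[κ.prod μ] v') :
    slice μ Φ v =ᵐ[κ] slice μ Φ v' := by
  filter_upwards [Measure.ae_ae_of_ae_prod h] with x hx
  exact Orlicz.ofFun_congr hx

omit [MeasurableSpace X] in
theorem coe_slice {v : X × Ω → ℝ} {x : X} (h : MemOrlicz Φ (fun ω => v (x, ω)) μ) :
    slice μ Φ v x =ᵐ[μ] fun ω => v (x, ω) := Orlicz.coe_ofFun h

/-- Since `L^Φ(Ω)` need not be separable, Borel measurability would not be enough. Slices of
rectangles take two values, and the property passes to complements and to countable disjoint unions,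
the latter by order continuity of the norm under `Δ₂`; Dynkin's theorem concludes. -/
theorem stronglyMeasurable_slice_indicator [IsFiniteMeasure μ] (hΦ : Delta2 Φ) {A : Set (X × Ω)}
    (hA : MeasurableSet A) : StronglyMeasurable (slice μ Φ (A.indicator fun _ => (1 : ℝ))) := by
  have hmem : ∀ {A : Set (X × Ω)} (_ : MeasurableSet A) x,
      MemOrlicz Φ (fun ω => A.indicator (fun _ => (1 : ℝ)) (x, ω)) μ := fun {A} hA x => by
    refine MemOrlicz.of_ae_bound Φ (C := 1) ?_ (ae_of_all _ fun ω => ?_)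
    · exact ((measurable_const.indicator hA).comp measurable_prodMk_left).aestronglyMeasurable
    · by_cases h : (x, ω) ∈ A <;> simp [h]
  induction A, hA using MeasurableSpace.induction_on_inter generateFrom_prod.symm isPiSystem_prod with
  | empty =>
    have : slice μ Φ ((∅ : Set (X × Ω)).indicator fun _ => (1 : ℝ)) =
        fun _ => Orlicz.ofFun μ Φ fun _ => 0 := by
      ext1 x
      simp [slice]
    rw [this]
    exact stronglyMeasurable_const
  | basic A hA =>
    obtain ⟨s, hs, t, ht, rfl⟩ := hA
    have : slice μ Φ ((s ×ˢ t).indicator fun _ => (1 : ℝ)) =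
        s.indicator fun _ => Orlicz.ofFun μ Φ (t.indicator fun _ => (1 : ℝ)) := by
      ext1 x
      by_cases hx : x ∈ s
      · rw [indicator_of_mem hx]
        refine Orlicz.ofFun_congr (ae_of_all _ fun ω => ?_)
        by_cases hω : ω ∈ t <;> simp [hx, hω]
      · rw [indicator_of_notMem hx]
        refine Orlicz.ext ((Orlicz.coe_ofFun (hmem (hs.prod ht) x)).trans
          (EventuallyEq.trans (ae_of_all _ fun ω => ?_) Orlicz.coe_zero.symm))
        simp [hx]
    rw [this]
    exact stronglyMeasurable_const.indicator hs
  | compl A hA ih =>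
    have : slice μ Φ (Aᶜ.indicator fun _ => (1 : ℝ)) = fun x =>
        Orlicz.ofFun μ Φ (fun _ => 1) - slice μ Φ (A.indicator fun _ => (1 : ℝ)) x := by
      ext1 x
      rw [slice, slice, ← Orlicz.ofFun_sub (MemOrlicz.of_ae_bound Φ (C := 1)
        aestronglyMeasurable_const (ae_of_all _ fun _ => by simp)) (hmem hA x)]
      congr 1
      ext ω
      by_cases h : (x, ω) ∈ A <;> simp [h]
    rw [this]
    exact stronglyMeasurable_const.sub ih
  | iUnion f hd hf ih =>
    have h1 : ∀ n : ℕ, (∀ x, MemOrlicz Φ (fun ω => ∑ i ∈ Finset.range n,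
          (f i).indicator (fun _ => (1 : ℝ)) (x, ω)) μ) ∧
        StronglyMeasurable (slice μ Φ fun p => ∑ i ∈ Finset.range n,
          (f i).indicator (fun _ => (1 : ℝ)) p) := by
      intro n
      induction n with
      | zero =>
        simp only [Finset.range_zero, Finset.sum_empty]
        exact ⟨fun _ => MemOrlicz.zero Φ, stronglyMeasurable_const⟩
      | succ n ihn =>
        simp only [Finset.sum_range_succ]
        refine ⟨fun x => (ihn.1 x).add Φ (hmem (hf n) x), ?_⟩
        have : slice μ Φ (fun p => ∑ i ∈ Finset.range n, (f i).indicator (fun _ => (1 : ℝ)) p +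
            (f n).indicator (fun _ => (1 : ℝ)) p) =
            (slice μ Φ fun p => ∑ i ∈ Finset.range n, (f i).indicator (fun _ => (1 : ℝ)) p) +
              slice μ Φ ((f n).indicator fun _ => (1 : ℝ)) := by
          ext1 x
          exact Orlicz.ofFun_add (ihn.1 x) (hmem (hf n) x)
        rw [this]
        exact ihn.2.add (ih n)
    have hval : ∀ p j, p ∈ f j → ∀ n, ∑ i ∈ Finset.range n, (f i).indicator (fun _ => (1 : ℝ)) p =
        if j < n then 1 else 0 := by
      intro p j hj n
      have : ∀ i, (f i).indicator (fun _ => (1 : ℝ)) p = if j = i then 1 else 0 := by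
        intro i
        by_cases hij : j = i
        · subst hij; simp [hj]
        · rw [if_neg hij, indicator_of_notMem fun h => (hd hij).le_bot ⟨hj, h⟩]
      simp only [this, Finset.sum_ite_eq, Finset.mem_range]
    have hval0 : ∀ p, p ∉ ⋃ i, f i → ∀ n,
        ∑ i ∈ Finset.range n, (f i).indicator (fun _ => (1 : ℝ)) p = 0 := by
      intro p hp n
      refine Finset.sum_eq_zero fun i _ => indicator_of_notMem (fun h => hp ?_) _
      exact mem_iUnion.2 ⟨i, h⟩
    refine stronglyMeasurable_of_tendsto atTop (fun n => (h1 n).2) (tendsto_pi_nhds.2 fun x => ?_)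
    refine Orlicz.tendsto_ofFun hΦ (h := fun _ => 1) (fun n => ((h1 n).1 x).1)
      (MemOrlicz.of_ae_bound Φ (C := 1) aestronglyMeasurable_const (ae_of_all _ fun _ => by simp))
      (fun n => ae_of_all _ fun ω => ?_) (ae_of_all _ fun ω => ?_)
    · by_cases hp : (x, ω) ∈ ⋃ i, f i
      · obtain ⟨j, hj⟩ := mem_iUnion.1 hp
        beta_reduce
        rw [hval _ j hj]
        split_ifs <;> simp
      · beta_reduce
        rw [hval0 _ hp]
        simp
    · by_cases hp : (x, ω) ∈ ⋃ i, f i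
      · obtain ⟨j, hj⟩ := mem_iUnion.1 hp
        rw [indicator_of_mem hp]
        refine tendsto_const_nhds.congr' ?_
        filter_upwards [eventually_gt_atTop j] with n hn
        rw [hval _ j hj, if_pos hn]
      · rw [indicator_of_notMem hp]
        simp only [hval0 _ hp]
        exact tendsto_const_nhds

theorem stronglyMeasurable_slice_simpleFunc [IsFiniteMeasure μ] (hΦ : Delta2 Φ)
    (s : SimpleFunc (X × Ω) ℝ) : (∀ x, MemOrlicz Φ (fun ω => s (x, ω)) μ) ∧
      StronglyMeasurable (slice μ Φ s) := by
  have hmem : ∀ (s : SimpleFunc (X × Ω) ℝ) x, MemOrlicz Φ (fun ω => s (x, ω)) μ := fun s x => by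
    obtain ⟨C, hC⟩ := s.exists_forall_norm_le
    refine MemOrlicz.of_ae_bound Φ (C := C.toNNReal)
      (s.measurable.comp measurable_prodMk_left).aestronglyMeasurable (ae_of_all _ fun ω => ?_)
    exact NNReal.le_toNNReal_of_coe_le (hC _)
  refine ⟨hmem s, ?_⟩
  induction s using SimpleFunc.induction with
  | @const c A hA =>
    have : slice μ Φ (SimpleFunc.piecewise A hA (SimpleFunc.const _ c) (SimpleFunc.const _ 0)) =
        c • slice μ Φ (A.indicator fun _ => (1 : ℝ)) := by
      ext1 x
      rw [Pi.smul_apply, slice, slice, ← Orlicz.ofFun_smul]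
      · refine Orlicz.ofFun_congr (ae_of_all _ fun ω => ?_)
        by_cases h : (x, ω) ∈ A <;> simp [h]
      · have := hmem (SimpleFunc.piecewise A hA (SimpleFunc.const _ 1) (SimpleFunc.const _ 0)) x
        refine this.congr Φ (ae_of_all _ fun ω => ?_)
        by_cases h : (x, ω) ∈ A <;> simp [h]
    rw [this]
    exact (stronglyMeasurable_slice_indicator hΦ hA).const_smul c
  | @add f f' hd hf hf' =>
    have : slice μ Φ (f + f') = slice μ Φ f + slice μ Φ f' := by
      ext1 x
      exact Orlicz.ofFun_add (hmem f x) (hmem f' x)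
    rw [this]
    exact hf.add hf'

theorem aestronglyMeasurable_slice [IsFiniteMeasure μ] (hΦ : Delta2 Φ) {v : X × Ω → ℝ}
    (hv : AEStronglyMeasurable v (κ.prod μ)) (hm : ∀ᵐ x ∂κ, MemOrlicz Φ (fun ω => v (x, ω)) μ) :
    AEStronglyMeasurable (slice μ Φ v) κ := by
  obtain ⟨v', hv', hvv'⟩ := hv
  refine AEStronglyMeasurable.congr ?_ (slice_congr hvv').symm
  have hm' : ∀ᵐ x ∂κ, MemOrlicz Φ (fun ω => v' (x, ω)) μ := by
    filter_upwards [hm, Measure.ae_ae_of_ae_prod hvv'] with x h1 h2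
    exact h1.congr Φ h2
  let s := SimpleFunc.approxOn v' hv'.measurable univ 0 (mem_univ _)
  refine aestronglyMeasurable_of_tendsto_ae atTop
    (fun n => (stronglyMeasurable_slice_simpleFunc hΦ (s n)).2.aestronglyMeasurable) ?_
  filter_upwards [hm'] with x hx
  refine Orlicz.tendsto_ofFun hΦ (h := fun ω => 2 * v' (x, ω))
    (fun n => ((stronglyMeasurable_slice_simpleFunc hΦ (s n)).1 x).1) (hx.smul Φ 2)
    (fun n => ae_of_all _ fun ω => ?_) (ae_of_all _ fun ω => ?_)
  · refine (SimpleFunc.norm_approxOn_zero_le hv'.measurable (mem_univ _) (x, ω) n).trans ?_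
    rw [norm_mul, Real.norm_ofNat, two_mul]
  · exact SimpleFunc.tendsto_approxOn hv'.measurable (mem_univ _) (by simp)

theorem lintegral_modular_slice [SFinite μ] {v : X × Ω → ℝ}
    (hv : AEStronglyMeasurable v (κ.prod μ)) (a : ℝ≥0) :
    ∫⁻ x, modular Φ (fun ω => v (x, ω)) μ a ∂κ = modular Φ v (κ.prod μ) a :=
  (lintegral_prod _ (aemeasurable_modular Φ hv a)).symm

theorem aemeasurable_modular_slice [SFinite μ] {v : X × Ω → ℝ}
    (hv : AEStronglyMeasurable v (κ.prod μ)) (a : ℝ≥0) :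
    AEMeasurable (fun x => modular Φ (fun ω => v (x, ω)) μ a) κ :=
  (aemeasurable_modular Φ hv a).lintegral_prod_right'

theorem memOrlicz_slice [SFinite μ] {v : X × Ω → ℝ} (hv : MemOrlicz Φ v (κ.prod μ)) :
    ∀ᵐ x ∂κ, MemOrlicz Φ (fun ω => v (x, ω)) μ := by
  obtain ⟨h, a, ha, hva⟩ := hv
  rw [← lintegral_modular_slice h] at hva
  filter_upwards [h.prodMk_left, ae_lt_top' (aemeasurable_modular_slice h a) hva.ne] with x h1 h2
  exact ⟨h1, a, ha, h2⟩

theorem lintegral_enorm_slice_le [SFinite μ] {v : X × Ω → ℝ}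
    (hv : AEStronglyMeasurable v (κ.prod μ)) {a : ℝ≥0} (ha : 0 < a)
    (hva : modular Φ v (κ.prod μ) a < ∞) :
    ∫⁻ x, ‖slice μ Φ v x‖ₑ ∂κ ≤ a * (κ univ + modular Φ v (κ.prod μ) a) := by
  have hva' := hva
  rw [← lintegral_modular_slice hv] at hva'
  calc ∫⁻ x, ‖slice μ Φ v x‖ₑ ∂κ
      ≤ ∫⁻ x, (a : ℝ≥0∞) * (1 + modular Φ (fun ω => v (x, ω)) μ a) ∂κ := by
        refine lintegral_mono_ae ?_
        filter_upwards [memOrlicz_slice ⟨hv, a, ha, hva⟩,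
          ae_lt_top' (aemeasurable_modular_slice hv a) hva'.ne] with x h1 h2
        refine le_trans (le_of_eq ?_) (luxemburg_le_mul_modular Φ ha h2)
        rw [← ofReal_norm, slice, Orlicz.norm_ofFun h1, ENNReal.ofReal_coe_nnreal]
    _ = a * (κ univ + modular Φ v (κ.prod μ) a) := by
        rw [lintegral_const_mul' _ _ ENNReal.coe_ne_top, lintegral_add_left measurable_const,
          lintegral_const, one_mul, lintegral_modular_slice hv]

theorem integrable_slice [IsFiniteMeasure κ] [IsFiniteMeasure μ] (hΦ : Delta2 Φ) {v : X × Ω → ℝ}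
    (hv : MemOrlicz Φ v (κ.prod μ)) : Integrable (slice μ Φ v) κ := by
  refine ⟨aestronglyMeasurable_slice hΦ hv.1 (memOrlicz_slice hv), ?_⟩
  obtain ⟨h, a, ha, hva⟩ := hv
  refine (lintegral_enorm_slice_le h ha hva).trans_lt ?_
  exact ENNReal.mul_lt_top ENNReal.coe_lt_top (ENNReal.add_lt_top.2 ⟨measure_lt_top _ _, hva⟩)

theorem integrable_of_integrable_slice [SFinite κ] [IsFiniteMeasure μ] {v : X × Ω → ℝ}
    (hv : AEStronglyMeasurable v (κ.prod μ)) (hm : ∀ᵐ x ∂κ, MemOrlicz Φ (fun ω => v (x, ω)) μ)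
    (hs : Integrable (slice μ Φ v) κ) : Integrable v (κ.prod μ) := by
  refine (integrable_prod_iff hv).2 ⟨hm.mono fun x hx => hx.integrable, ?_⟩
  refine Integrable.mono' (hs.norm.const_mul (1 + Φ.conj 1 * μ.real univ))
    hv.norm.integral_prod_right' ?_
  filter_upwards [hm] with x hx
  rw [Real.norm_of_nonneg (integral_nonneg fun _ => norm_nonneg _)]
  refine le_trans (le_of_eq ?_) (Orlicz.integral_norm_le (slice μ Φ v x))
  refine integral_congr_ae ?_
  filter_upwards [coe_slice hx] with ω hω
  rw [hω]

/-- The Bochner integral of the slices is computed pointwise. -/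
theorem coe_integral_slice [SFinite κ] [IsFiniteMeasure μ] {v : X × Ω → ℝ}
    (hv : AEStronglyMeasurable v (κ.prod μ)) (hm : ∀ᵐ x ∂κ, MemOrlicz Φ (fun ω => v (x, ω)) μ)
    (hs : Integrable (slice μ Φ v) κ) :
    ⇑(∫ x, slice μ Φ v x ∂κ : Orlicz Φ μ).1 =ᵐ[μ] fun ω => ∫ x, v (x, ω) ∂κ := by
  have hint := integrable_of_integrable_slice hv hm hs
  have hI : Integrable (fun ω => ∫ x, v (x, ω) ∂κ) μ := hint.integral_prod_right
  set F : Orlicz Φ μ := ∫ x, slice μ Φ v x ∂κ with hF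
  have hsub : Integrable (fun ω => F ω - ∫ x, v (x, ω) ∂κ) μ := F.integrable.sub hI
  -- Pairings commute with the Bochner integral, and Fubini does the rest. The two functions then
  -- agree by testing with `squash` of their difference.
  have key : ∀ χ : Lp ℝ ⊤ μ, ∫ ω, F ω * χ ω ∂μ = ∫ ω, (∫ x, v (x, ω) ∂κ) * χ ω ∂μ := by
    intro χ
    rw [← Orlicz.pairing_apply, hF, ← ContinuousLinearMap.integral_comp_comm _ hs]
    have h1 : ∀ᵐ x ∂κ, Orlicz.pairing χ (slice μ Φ v x) = ∫ ω, v (x, ω) * χ ω ∂μ := by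
      filter_upwards [hm] with x hx
      rw [Orlicz.pairing_apply]
      refine integral_congr_ae ?_
      filter_upwards [coe_slice hx] with ω hω
      rw [hω]
    have hχ : MemLp (fun p : X × Ω => χ p.2) ⊤ (κ.prod μ) := by
      refine memLp_top_of_bound (Lp.memLp χ).1.comp_snd ‖χ‖ ?_
      exact Measure.quasiMeasurePreserving_snd.ae (Orlicz.ae_norm_le χ)
    rw [integral_congr_ae h1, integral_integral_swap (f := fun x ω => v (x, ω) * χ ω)
      (hint.mul_of_top_left hχ)]
    exact integral_congr_ae (ae_of_all _ fun ω => integral_mul_const _ _)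
  have h0 := Orlicz.ae_eq_zero_of_integral_mul_squash hsub (by
    have hm := Orlicz.memLp_squash hsub.1
    have h1 := key hm.toLp
    have h2 : ∀ g : Ω → ℝ, ∫ ω, g ω * (hm.toLp : Lp ℝ ⊤ μ) ω ∂μ =
        ∫ ω, g ω * Orlicz.squash (F ω - ∫ x, v (x, ω) ∂κ) ∂μ := fun g =>
      integral_congr_ae (by filter_upwards [hm.coeFn_toLp] with x hx; rw [hx])
    rw [h2, h2] at h1
    simp only [sub_mul]
    exact (integral_sub (F.integrable.mul_of_top_left hm) (hI.mul_of_top_left hm)).trans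
      (sub_eq_zero.2 h1))
  filter_upwards [h0] with ω hω
  exact sub_eq_zero.1 hω

end Slice

/-! ### Localisation of averages in a closed subspace. -/

section ClosedSubmodule

variable {B : Type*} [NormedAddCommGroup B] [NormedSpace ℝ B] [CompleteSpace B]

/-- The fundamental lemma of the calculus of variations, applied to the class of `s` in the quotient
`B ⧸ S`, a normed space because `S` is closed. -/
theorem ae_mem_of_integral_smul_mem (S : Submodule ℝ B) (hS : IsClosed (S : Set B)) {N : ℕ}
    {Q : Set (EuclideanSpace ℝ (Fin N))} (hQ : IsOpen Q) {s : EuclideanSpace ℝ (Fin N) → B}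
    (hs : Integrable s (volume.restrict Q))
    (h : ∀ φ, IsTest Q φ → ∫ x in Q, φ x • s x ∈ S) :
    ∀ᵐ x ∂(volume.restrict Q), s x ∈ S := by
  have := hS
  let π : B →L[ℝ] B ⧸ S := S.mkQ.mkContinuous 1 fun b => by
    rw [one_mul]
    exact Submodule.Quotient.norm_mk_le S b
  have hπ : ∀ b, π b = 0 ↔ b ∈ S := fun b => Submodule.Quotient.mk_eq_zero S
  have h0 := hQ.ae_eq_zero_of_integral_contDiff_smul_eq_zero (μ := volume)
    (f := fun x => π (s x)) (IntegrableOn.locallyIntegrableOn (π.integrable_comp hs))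
    fun φ h1 h2 h3 => by
      have hi : Integrable (fun x => φ x • s x) (volume.restrict Q) := by
        obtain ⟨C, hC⟩ := h1.continuous.bounded_above_of_compact_support h2
        exact hs.smul_of_top_right (memLp_top_of_bound h1.continuous.aestronglyMeasurable C
          (ae_of_all _ hC))
      rw [← setIntegral_eq_integral_of_forall_compl_eq_zero (s := Q)]
      · have h4 := π.integral_comp_comm hi
        simp only [map_smul] at h4
        rw [h4, hπ]
        exact h φ ⟨h1, h2, h3⟩
      · intro x hx
        rw [image_eq_zero_of_notMem_tsupport fun h => hx (h3 h), zero_smul]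
  rw [ae_restrict_iff' hQ.measurableSet]
  filter_upwards [h0] with x hx hxQ
  exact (hπ _).1 (hx hxQ)

end ClosedSubmodule

end StochTwoScale

namespace StochTwoScale

/-! ### Measurability and invariance of integrals under `(x, ω) ↦ (x, T(a(x))ω)`. -/

section Shift

variable {N : ℕ} {Ω : Type*} [MeasurableSpace Ω] {μ : Measure Ω} (T : DynamicalSystem N μ)
  {A : Type*} [MeasurableSpace A] {κ : Measure A} {a : A → EuclideanSpace ℝ (Fin N)}

theorem DynamicalSystem.measurable_shift {B : Type*} [MeasurableSpace B] {e : B → A}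
    (he : Measurable e) {b : B → NullMeasurableSpace (EuclideanSpace ℝ (Fin N)) volume}
    (hb : Measurable b) : Measurable (fun p : B × Ω => (e p.1, T (b p.1) p.2)) :=
  (he.comp measurable_fst).prodMk
    (T.measurable'.comp ((hb.comp measurable_fst).prodMk measurable_snd))

/-- The action is measurable only for Lebesgue measurable sets of `ℝᴺ`. Their preimages under the
quasi-measure-preserving `a` are `κ`-null-measurable, and the product of the completed `σ`-algebra
with that of `Ω` lies inside the completion for `κ.prod μ`. -/
theorem DynamicalSystem.nullMeasurable_shift [SFinite μ] [SFinite κ]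
    (ha : Measure.QuasiMeasurePreserving a κ volume) :
    NullMeasurable (fun p : A × Ω => (p.1, T (a p.1) p.2)) (κ.prod μ) := by
  have h1 := @DynamicalSystem.measurable_shift N Ω _ μ T A _ A
    (@NullMeasurableSpace.instMeasurableSpace A _ κ) id
    (fun s hs => (show NullMeasurableSet s κ from hs.nullMeasurableSet)) a
    (fun s hs => show NullMeasurableSet (a ⁻¹' s) κ from
      NullMeasurableSet.preimage (μb := (volume : Measure (EuclideanSpace ℝ (Fin N))))
        (show @NullMeasurableSet (EuclideanSpace ℝ (Fin N)) _ s volume from hs) ha)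
  have hle : @Prod.instMeasurableSpace A Ω (@NullMeasurableSpace.instMeasurableSpace A _ κ) _ ≤
      @NullMeasurableSpace.instMeasurableSpace (A × Ω) _ (κ.prod μ) := by
    refine sup_le ?_ ?_
    · rintro _ ⟨s, hs, rfl⟩
      exact NullMeasurableSet.preimage (show NullMeasurableSet s κ from hs)
        Measure.quasiMeasurePreserving_fst
    · rintro _ ⟨s, hs, rfl⟩
      exact (hs.preimage measurable_snd).nullMeasurableSet
  intro s hs
  exact hle _ (h1 hs)

variable [SFinite μ] [SFinite κ] (ha : Measure.QuasiMeasurePreserving a κ volume)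

include ha

theorem DynamicalSystem.lintegral_shift_of_measurable {f : A × Ω → ℝ≥0∞} (hf : Measurable f) :
    ∫⁻ p, f (p.1, T (a p.1) p.2) ∂(κ.prod μ) = ∫⁻ p, f p ∂(κ.prod μ) := by
  have hm : AEMeasurable (fun p => f (p.1, T (a p.1) p.2)) (κ.prod μ) :=
    (hf.comp_nullMeasurable (T.nullMeasurable_shift ha)).aemeasurable
  rw [lintegral_prod _ hm, lintegral_prod _ hf.aemeasurable]
  refine lintegral_congr fun x => ?_
  exact (T.measurePreserving' (a x)).lintegral_comp (hf.comp measurable_prodMk_left)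

/-- On each slice the shift is `T(a(x))`, which preserves `μ`; by Fubini the preimage of a
measurable null set is null. -/
theorem DynamicalSystem.ae_shift {P : A × Ω → Prop} (hP : ∀ᵐ p ∂(κ.prod μ), P p) :
    ∀ᵐ p ∂(κ.prod μ), P (p.1, T (a p.1) p.2) := by
  obtain ⟨s, hs, hsm, hs0⟩ := exists_measurable_superset_of_null (ae_iff.1 hP)
  have hf : Measurable (s.indicator (1 : A × Ω → ℝ≥0∞)) := measurable_one.indicator hsm
  have hm : AEMeasurable (fun p => s.indicator (1 : A × Ω → ℝ≥0∞) (p.1, T (a p.1) p.2))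
      (κ.prod μ) := (hf.comp_nullMeasurable (T.nullMeasurable_shift ha)).aemeasurable
  have h1 := T.lintegral_shift_of_measurable (μ := μ) ha hf
  rw [lintegral_indicator_one hsm, hs0, lintegral_eq_zero_iff' hm] at h1
  filter_upwards [h1] with p hp
  by_contra h
  have : (p.1, T (a p.1) p.2) ∈ s := hs h
  simp [this] at hp

theorem DynamicalSystem.aestronglyMeasurable_shift {f : A × Ω → ℝ}
    (hf : AEStronglyMeasurable f (κ.prod μ)) :
    AEStronglyMeasurable (fun p => f (p.1, T (a p.1) p.2)) (κ.prod μ) := by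
  obtain ⟨g, hg, hfg⟩ := hf
  have hm : AEMeasurable (fun p => g (p.1, T (a p.1) p.2)) (κ.prod μ) :=
    (hg.measurable.comp_nullMeasurable (T.nullMeasurable_shift ha)).aemeasurable
  have h : (fun p => f (p.1, T (a p.1) p.2)) =ᵐ[κ.prod μ] fun p => g (p.1, T (a p.1) p.2) :=
    T.ae_shift ha hfg
  exact hm.aestronglyMeasurable.congr h.symm

theorem DynamicalSystem.lintegral_shift {f : A × Ω → ℝ≥0∞} (hf : AEMeasurable f (κ.prod μ)) :
    ∫⁻ p, f (p.1, T (a p.1) p.2) ∂(κ.prod μ) = ∫⁻ p, f p ∂(κ.prod μ) := by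
  obtain ⟨g, hg, hfg⟩ := hf
  rw [lintegral_congr_ae hfg, ← T.lintegral_shift_of_measurable ha hg]
  exact lintegral_congr_ae (T.ae_shift ha hfg)

theorem DynamicalSystem.modular_shift (Φ : YoungFunction) {f : A × Ω → ℝ}
    (hf : AEStronglyMeasurable f (κ.prod μ)) (δ : ℝ≥0) :
    modular Φ (fun p => f (p.1, T (a p.1) p.2)) (κ.prod μ) δ = modular Φ f (κ.prod μ) δ :=
  T.lintegral_shift ha (aemeasurable_modular Φ hf δ)

theorem DynamicalSystem.memOrlicz_shift {Φ : YoungFunction} {f : A × Ω → ℝ}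
    (hf : MemOrlicz Φ f (κ.prod μ)) :
    MemOrlicz Φ (fun p => f (p.1, T (a p.1) p.2)) (κ.prod μ) := by
  obtain ⟨h, δ, hδ, hfδ⟩ := hf
  exact ⟨T.aestronglyMeasurable_shift ha h, δ, hδ, by rwa [T.modular_shift ha Φ h]⟩

theorem DynamicalSystem.luxemburg_shift (Φ : YoungFunction) {f : A × Ω → ℝ}
    (hf : AEStronglyMeasurable f (κ.prod μ)) :
    luxemburg Φ (fun p => f (p.1, T (a p.1) p.2)) (κ.prod μ) = luxemburg Φ f (κ.prod μ) := by
  unfold luxemburg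
  simp only [T.modular_shift ha Φ hf]

end Shift

/-! ### The isometric action on `L^Φ(Ω)` and mollification along it. -/

section Action

variable {N : ℕ} {Ω : Type*} [MeasurableSpace Ω] {μ : Measure Ω} (T : DynamicalSystem N μ)
  {Φ : YoungFunction}

namespace DynamicalSystem

theorem modular_comp {f : Ω → ℝ} (hf : AEStronglyMeasurable f μ)
    (z : EuclideanSpace ℝ (Fin N)) (δ : ℝ≥0) :
    modular Φ (fun ω => f (T z ω)) μ δ = modular Φ f μ δ := by
  have h := (T.measurePreserving' z).map_eq
  conv_rhs => rw [← h]
  unfold modular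
  rw [lintegral_map' _ (T.measurePreserving' z).aemeasurable]
  rw [h]
  exact aemeasurable_modular Φ hf δ

theorem memOrlicz_comp {f : Ω → ℝ} (hf : MemOrlicz Φ f μ) (z : EuclideanSpace ℝ (Fin N)) :
    MemOrlicz Φ (fun ω => f (T z ω)) μ := by
  obtain ⟨h, δ, hδ, hfδ⟩ := hf
  exact ⟨h.comp_measurePreserving (T.measurePreserving' z), δ, hδ, by rwa [T.modular_comp h]⟩

variable (Φ) in
/-- The isometry `f ↦ f ∘ T(z)` of `L^Φ(Ω)`. -/
noncomputable def act (z : EuclideanSpace ℝ (Fin N)) : Orlicz Φ μ →ₗᵢ[ℝ] Orlicz Φ μ where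
  toFun f := Orlicz.ofFun μ Φ fun ω => f (T z ω)
  map_add' f g := by
    rw [← Orlicz.ofFun_add (T.memOrlicz_comp f.2 z) (T.memOrlicz_comp g.2 z)]
    exact Orlicz.ofFun_congr ((T.measurePreserving' z).quasiMeasurePreserving.ae (Orlicz.coe_add f g))
  map_smul' c f := by
    rw [RingHom.id_apply, ← Orlicz.ofFun_smul (T.memOrlicz_comp f.2 z)]
    exact Orlicz.ofFun_congr ((T.measurePreserving' z).quasiMeasurePreserving.ae (Orlicz.coe_smul c f))
  norm_map' f := by
    change ‖Orlicz.ofFun μ Φ fun ω => f (T z ω)‖ = _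
    rw [Orlicz.norm_ofFun (T.memOrlicz_comp f.2 z), Orlicz.norm_def]
    unfold luxemburg
    simp only [T.modular_comp f.2.1]

theorem act_def (z : EuclideanSpace ℝ (Fin N)) (f : Orlicz Φ μ) :
    T.act Φ z f = Orlicz.ofFun μ Φ fun ω => f (T z ω) := rfl

theorem coe_act (z : EuclideanSpace ℝ (Fin N)) (f : Orlicz Φ μ) :
    T.act Φ z f =ᵐ[μ] fun ω => f (T z ω) := Orlicz.coe_ofFun (T.memOrlicz_comp f.2 z)

theorem act_act (x y : EuclideanSpace ℝ (Fin N)) (f : Orlicz Φ μ) :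
    T.act Φ x (T.act Φ y f) = T.act Φ (y + x) f := by
  refine Orlicz.ext ?_
  filter_upwards [T.coe_act x (T.act Φ y f), T.coe_act (y + x) f,
    (T.measurePreserving' x).quasiMeasurePreserving.ae (T.coe_act y f)] with ω h1 h2 h3
  rw [h1, h2, h3, T.map_add']

theorem act_zero (f : Orlicz Φ μ) : T.act Φ 0 f = f := by
  refine Orlicz.ext ?_
  filter_upwards [T.coe_act 0 f] with ω h1
  rw [h1, T.map_zero']

variable [IsProbabilityMeasure μ]

theorem aestronglyMeasurable_comp {f : Ω → ℝ} (hf : AEStronglyMeasurable f μ) :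
    AEStronglyMeasurable (fun p : EuclideanSpace ℝ (Fin N) × Ω => f (T p.1 p.2))
      (volume.prod μ) :=
  T.aestronglyMeasurable_shift (a := id) (Measure.QuasiMeasurePreserving.id _) hf.comp_snd

theorem ae_comp {P : Ω → Prop} (hP : ∀ᵐ ω ∂μ, P ω) :
    ∀ᵐ p : EuclideanSpace ℝ (Fin N) × Ω ∂(volume.prod μ), P (T p.1 p.2) :=
  T.ae_shift (a := id) (Measure.QuasiMeasurePreserving.id _)
    (Measure.quasiMeasurePreserving_snd.ae hP)

theorem aestronglyMeasurable_act (hΦ : Delta2 Φ) (f : Orlicz Φ μ) :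
    AEStronglyMeasurable (fun z => T.act Φ z f) volume :=
  aestronglyMeasurable_slice (v := fun p : EuclideanSpace ℝ (Fin N) × Ω => f (T p.1 p.2)) hΦ
    (T.aestronglyMeasurable_comp f.2.1) (ae_of_all _ fun z => T.memOrlicz_comp f.2 z)

theorem integrable_smul_act (hΦ : Delta2 Φ) {ρ : EuclideanSpace ℝ (Fin N) → ℝ}
    (hρ : Integrable ρ) (f : Orlicz Φ μ) : Integrable fun z => ρ z • T.act Φ z f := by
  refine hρ.smul_of_top_left (memLp_top_of_bound (T.aestronglyMeasurable_act hΦ f) ‖f‖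
    (ae_of_all _ fun z => ?_))
  rw [LinearIsometry.norm_map]

theorem locallyIntegrable_act (hΦ : Delta2 Φ) (f : Orlicz Φ μ) :
    LocallyIntegrable (fun z => T.act Φ z f) volume :=
  (locallyIntegrable_const ‖f‖).mono (T.aestronglyMeasurable_act hΦ f)
    (ae_of_all _ fun z => by simp)

/-- The mollification `∫ ρ(z) f ∘ T(z) dz` of `f ∈ L^Φ(Ω)` along the dynamical system. -/
noncomputable def moll (ρ : EuclideanSpace ℝ (Fin N) → ℝ) (f : Orlicz Φ μ) : Orlicz Φ μ :=
  ∫ z, ρ z • T.act Φ z f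

omit [IsProbabilityMeasure μ] in
theorem norm_moll_le (ρ : EuclideanSpace ℝ (Fin N) → ℝ) (f : Orlicz Φ μ) :
    ‖T.moll ρ f‖ ≤ (∫ z, |ρ z|) * ‖f‖ := by
  refine (norm_integral_le_integral_norm _).trans (le_of_eq ?_)
  rw [← integral_mul_const]
  simp [norm_smul]

/-- The mollification as a continuous linear map. -/
noncomputable def mollL (hΦ : Delta2 Φ) {ρ : EuclideanSpace ℝ (Fin N) → ℝ} (hρ : Integrable ρ) :
    Orlicz Φ μ →L[ℝ] Orlicz Φ μ :=
  LinearMap.mkContinuous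
    { toFun := T.moll ρ
      map_add' := fun f g => by
        unfold moll
        rw [← integral_add (T.integrable_smul_act hΦ hρ f) (T.integrable_smul_act hΦ hρ g)]
        simp
      map_smul' := fun c f => by
        unfold moll
        rw [RingHom.id_apply, ← integral_smul]
        simp [smul_comm c] }
    (∫ z, |ρ z|) fun f => T.norm_moll_le ρ f

theorem mollL_apply (hΦ : Delta2 Φ) {ρ : EuclideanSpace ℝ (Fin N) → ℝ} (hρ : Integrable ρ)
    (f : Orlicz Φ μ) : T.mollL hΦ hρ f = T.moll ρ f := rfl

theorem coe_moll (hΦ : Delta2 Φ) {ρ : EuclideanSpace ℝ (Fin N) → ℝ} (hρ : Integrable ρ)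
    (f : Orlicz Φ μ) {g : Ω → ℝ} (hfg : f =ᵐ[μ] g) :
    T.moll ρ f =ᵐ[μ] fun ω => ∫ z, ρ z * g (T z ω) := by
  have hgm : AEStronglyMeasurable g μ := f.2.1.congr hfg
  have hg : MemOrlicz Φ g μ := f.2.congr Φ hfg
  let v : EuclideanSpace ℝ (Fin N) × Ω → ℝ := fun p => ρ p.1 * g (T p.1 p.2)
  have hs : slice μ Φ v = fun z => ρ z • T.act Φ z f := by
    ext1 z
    rw [act_def, ← Orlicz.ofFun_smul (T.memOrlicz_comp f.2 z)]
    refine Orlicz.ofFun_congr ?_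
    filter_upwards [(T.measurePreserving' z).quasiMeasurePreserving.ae hfg] with ω hω
    simp only [v, hω]
  have h := coe_integral_slice (Φ := Φ) (κ := volume) (v := v)
    (hρ.1.comp_fst.mul (T.aestronglyMeasurable_comp hgm))
    (ae_of_all _ fun z => (T.memOrlicz_comp hg z).smul Φ (ρ z))
    (by rw [hs]; exact T.integrable_smul_act hΦ hρ f)
  rw [hs] at h
  exact h

theorem act_moll (hΦ : Delta2 Φ) {ρ : EuclideanSpace ℝ (Fin N) → ℝ} (hρ : Integrable ρ)
    (x : EuclideanSpace ℝ (Fin N)) (f : Orlicz Φ μ) :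
    T.act Φ x (T.moll ρ f) = T.moll (fun z => ρ (z - x)) f := by
  unfold moll
  have h := (T.act Φ x).toContinuousLinearMap.integral_comp_comm (T.integrable_smul_act hΦ hρ f)
  rw [LinearIsometry.coe_toContinuousLinearMap] at h
  rw [← h, ← integral_sub_right_eq_self _ x]
  refine integral_congr_ae (ae_of_all _ fun z => ?_)
  simp only [map_smul, act_act, sub_add_cancel]

/-- No continuity of the orbit maps `z ↦ f ∘ T(z)` is assumed, only measurability and boundedness.
Lebesgue differentiation provides one point `x` at which the averages of the orbit converge; the
isometry `act (-x)` carries this convergence to the origin. The point may depend on `f`, but the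
kernels do not. -/
theorem exists_mollifier (hΦ : Delta2 Φ) :
    ∃ ρ : ℕ → EuclideanSpace ℝ (Fin N) → ℝ,
      (∀ k, ContDiff ℝ ((⊤ : ℕ∞) : WithTop ℕ∞) (ρ k) ∧ HasCompactSupport (ρ k)) ∧
      ∀ f : Orlicz Φ μ, Tendsto (fun k => T.moll (ρ k) f) atTop (𝓝 f) := by
  let φ : ℕ → ContDiffBump (0 : EuclideanSpace ℝ (Fin N)) := fun k =>
    ⟨(k + 1 : ℝ)⁻¹, 2 * (k + 1 : ℝ)⁻¹, by positivity, by
      have : 0 < (k + 1 : ℝ)⁻¹ := by positivity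
      linarith⟩
  refine ⟨fun k => (φ k).normed volume, fun k => ⟨(φ k).contDiff_normed, (φ k).hasCompactSupport_normed⟩,
    fun f => ?_⟩
  have h1 : Tendsto (fun k => (φ k).rOut) atTop (𝓝 0) := by
    have := (tendsto_one_div_add_atTop_nhds_zero_nat (𝕜 := ℝ)).const_mul 2
    simpa [φ] using this
  obtain ⟨x, hx⟩ := (ContDiffBump.ae_convolution_tendsto_right_of_locallyIntegrable
    (μ := volume) (K := 2) h1 (Eventually.of_forall fun k => le_rfl)
    (T.locallyIntegrable_act hΦ f)).exists
  have h2 := ((T.act Φ (-x)).continuous.tendsto _).comp hx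
  rw [act_act, add_neg_cancel, act_zero] at h2
  refine h2.congr fun k => ?_
  have hi : Integrable (fun t => (φ k).normed volume t • T.act Φ (x - t) f) := by
    have h3 := T.integrable_smul_act hΦ (ρ := fun t => (φ k).normed volume (x - t))
      ((φ k).integrable_normed.comp_sub_left x) f
    simpa using h3.comp_sub_left x
  have h4 := (T.act Φ (-x)).toContinuousLinearMap.integral_comp_comm hi
  rw [LinearIsometry.coe_toContinuousLinearMap] at h4
  change T.act Φ (-x) (∫ t, (φ k).normed volume t • T.act Φ (x - t) f) = _
  -- The convolution carries `act (-t)`, while `moll` uses `act z`; the reflection `z = -t` leaves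
  -- the bump unchanged because it is even.
  rw [← h4, moll, ← integral_neg_eq_self]
  refine integral_congr_ae (ae_of_all _ fun z => ?_)
  simp only [map_smul, act_act, ContDiffBump.normed_neg]
  congr 2
  abel_nf

end DynamicalSystem

end Action

end StochTwoScale

namespace StochTwoScale

/-! ### Smooth kernels and their difference quotients in `L¹`. -/

section PartialDerivative

variable {N : ℕ} {ρ : EuclideanSpace ℝ (Fin N) → ℝ}

/-- The smooth functions with compact support. -/
structure IsBump (ρ : EuclideanSpace ℝ (Fin N) → ℝ) : Prop where
  contDiff : ContDiff ℝ ((⊤ : ℕ∞) : WithTop ℕ∞) ρ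
  hasCompactSupport : HasCompactSupport ρ

/-- The partial derivative `∂ᵢρ`. -/
noncomputable def pderiv (i : Fin N) (ρ : EuclideanSpace ℝ (Fin N) → ℝ)
    (z : EuclideanSpace ℝ (Fin N)) : ℝ := fderiv ℝ ρ z (EuclideanSpace.single i 1)

namespace IsBump

theorem pderiv (h : IsBump ρ) (i : Fin N) : IsBump (pderiv i ρ) :=
  ⟨(h.1.fderiv_right (m := ((⊤ : ℕ∞) : WithTop ℕ∞)) (by exact_mod_cast le_top)).clm_apply
    contDiff_const, h.2.fderiv_apply (𝕜 := ℝ) _⟩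

theorem neg (h : IsBump ρ) : IsBump fun z => -ρ z := ⟨h.1.neg, h.2.neg⟩

theorem continuous (h : IsBump ρ) : Continuous ρ := h.1.continuous

theorem integrable (h : IsBump ρ) : Integrable ρ := h.continuous.integrable_of_hasCompactSupport h.2

theorem exists_bound (h : IsBump ρ) : ∃ C, ∀ x, ‖ρ x‖ ≤ C :=
  h.continuous.bounded_above_of_compact_support h.2

theorem differentiable (h : IsBump ρ) : Differentiable ℝ ρ :=
  h.1.differentiable (by simp)

theorem mul_comp_add_smul (h : IsBump ρ) {φ : EuclideanSpace ℝ (Fin N) → ℝ} (hφ : IsBump φ)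
    (y : EuclideanSpace ℝ (Fin N)) (c : ℝ) : IsBump fun x => ρ (y + c • x) * φ x :=
  ⟨(h.1.comp (contDiff_const.add (contDiff_id.const_smul c))).mul hφ.1, hφ.2.mul_left⟩

/-- The difference quotients of `ρ` converge in `L¹`. -/
theorem tendsto_integral_slope (h : IsBump ρ) (v : EuclideanSpace ℝ (Fin N)) :
    Tendsto (fun t : ℝ => ∫ z, |t⁻¹ * (ρ (z - t • v) - ρ z) + fderiv ℝ ρ z v|)
      (𝓝[≠] 0) (𝓝 0) := by
  obtain ⟨K, hK⟩ := ContDiff.lipschitzWith_of_hasCompactSupport h.2 h.1 (by simp)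
  have hcomp : IsCompact (Metric.cthickening ‖v‖ (tsupport ρ)) := h.2.cthickening
  have hmain := tendsto_integral_filter_of_dominated_convergence
    (μ := (volume : Measure (EuclideanSpace ℝ (Fin N)))) (l := 𝓝[≠] (0 : ℝ))
    (F := fun t z => |t⁻¹ * (ρ (z - t • v) - ρ z) + fderiv ℝ ρ z v|) (f := fun _ => 0)
    -- For `|t| < 1` the integrand vanishes off the `‖v‖`-thickening of the support; on it, each of
    -- the two terms is at most `K‖v‖` by the Lipschitz bound.
    ((Metric.cthickening ‖v‖ (tsupport ρ)).indicator fun _ => 2 * (K * ‖v‖))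
    (Eventually.of_forall fun t => ?_) ?_ ?_ ?_
  · rwa [integral_zero] at hmain
  · have h1 : Continuous fun z => fderiv ℝ ρ z v :=
      (h.1.continuous_fderiv (by simp)).clm_apply continuous_const
    have h2 := h.continuous
    exact Continuous.aestronglyMeasurable (by fun_prop)
  · have h1 : ∀ᶠ t : ℝ in 𝓝[≠] 0, |t| < 1 := by
      refine eventually_nhdsWithin_of_eventually_nhds ?_
      have : Tendsto (fun t : ℝ => |t|) (𝓝 0) (𝓝 0) := by
        simpa using (continuous_abs (G := ℝ)).tendsto 0
      exact this.eventually (gt_mem_nhds one_pos)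
    filter_upwards [h1, self_mem_nhdsWithin] with t ht ht0
    refine ae_of_all _ fun z => ?_
    by_cases hz : z ∈ Metric.cthickening ‖v‖ (tsupport ρ)
    · rw [indicator_of_mem hz, Real.norm_eq_abs, abs_abs, two_mul]
      refine (abs_add_le _ _).trans (add_le_add ?_ ?_)
      · have h2 := hK.dist_le_mul (z - t • v) z
        rw [Real.dist_eq, dist_eq_norm, sub_sub_cancel_left, norm_neg, norm_smul,
          Real.norm_eq_abs] at h2
        have h3 : 0 < |t| := abs_pos.2 ht0
        rw [abs_mul, abs_inv, inv_mul_le_iff₀ h3]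
        linarith
      · rw [← Real.norm_eq_abs]
        refine (ContinuousLinearMap.le_opNorm _ _).trans ?_
        gcongr
        exact norm_fderiv_le_of_lipschitz ℝ hK
    · rw [indicator_of_notMem hz]
      have hz0 : z ∉ tsupport ρ := fun h' => hz (Metric.self_subset_cthickening _ h')
      have hz1 : z - t • v ∉ tsupport ρ := fun h' => hz (Metric.mem_cthickening_of_dist_le _ _ _ _ h' (by
        rw [dist_eq_norm, sub_sub_cancel, norm_smul, Real.norm_eq_abs]
        nlinarith [norm_nonneg v]))
      have hz2 : fderiv ℝ ρ z = 0 := image_eq_zero_of_notMem_tsupport fun h' =>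
        hz0 (tsupport_fderiv_subset ℝ h')
      rw [image_eq_zero_of_notMem_tsupport hz0, image_eq_zero_of_notMem_tsupport hz1, hz2]
      simp
  · exact (integrable_indicator_iff hcomp.measurableSet).2
      (integrableOn_const hcomp.measure_lt_top.ne)
  · refine ae_of_all _ fun z => ?_
    have h1 : HasDerivAt (fun t : ℝ => ρ (z - t • v)) (fderiv ℝ ρ z (-v)) 0 := by
      have h2 : HasDerivAt (fun t : ℝ => z - t • v) (-v) 0 := by
        simpa using ((hasDerivAt_id (0 : ℝ)).smul_const v).const_sub z
      have h3 : HasFDerivAt ρ (fderiv ℝ ρ z) (z - (0 : ℝ) • v) := by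
        simpa using (h.differentiable z).hasFDerivAt
      exact h3.comp_hasDerivAt 0 h2
    have h2 := (hasDerivAt_iff_tendsto_slope_zero.1 h1).add_const (fderiv ℝ ρ z v)
    simp only [zero_add, zero_smul, sub_zero, map_neg, neg_add_cancel, smul_eq_mul] at h2
    simpa using h2.abs

end IsBump

end PartialDerivative

/-! ### Smoothness of mollified functions, gradients and invariance. -/

section Smoothing

variable {N : ℕ} {Ω : Type*} [MeasurableSpace Ω] {μ : Measure Ω} [IsProbabilityMeasure μ]
  (T : DynamicalSystem N μ) {Φ : YoungFunction} {ρ : EuclideanSpace ℝ (Fin N) → ℝ}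

namespace DynamicalSystem

theorem ae_ae_comp {P : Ω → Prop} (hP : ∀ᵐ ω ∂μ, P ω) :
    ∀ᵐ ω ∂μ, ∀ᵐ z : EuclideanSpace ℝ (Fin N), P (T z ω) :=
  Measure.ae_ae_of_ae_prod
    (Measure.measurePreserving_swap.quasiMeasurePreserving.ae (T.ae_comp hP))

theorem integrable_mul_comp (hρ : Integrable ρ) (χ : Lp ℝ ⊤ μ) :
    Integrable (fun p : EuclideanSpace ℝ (Fin N) × Ω => ρ p.1 * χ (T p.1 p.2))
      (volume.prod μ) :=
  (hρ.comp_fst μ).mul_of_top_left (memLp_top_of_bound (T.aestronglyMeasurable_comp (Lp.memLp χ).1)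
    ‖χ‖ (T.ae_comp (Orlicz.ae_norm_le χ)))

theorem ae_integrable_mul_comp (hρ : Integrable ρ) (χ : Lp ℝ ⊤ μ) :
    ∀ᵐ ω ∂μ, Integrable fun z => ρ z * χ (T z ω) :=
  (T.integrable_mul_comp hρ χ).prod_left_ae

theorem ae_abs_integral_le (ρ : EuclideanSpace ℝ (Fin N) → ℝ) (χ : Lp ℝ ⊤ μ) :
    ∀ᵐ ω ∂μ, Integrable ρ → |∫ z, ρ z * χ (T z ω)| ≤ (∫ z, |ρ z|) * ‖χ‖ := by
  filter_upwards [T.ae_ae_comp (Orlicz.ae_norm_le χ)] with ω hω hρ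
  rw [← integral_mul_const, ← Real.norm_eq_abs]
  refine norm_integral_le_of_norm_le (hρ.norm.mul_const _) ?_
  filter_upwards [hω] with z hz
  rw [norm_mul]
  exact mul_le_mul_of_nonneg_left hz (norm_nonneg _)

theorem memLp_moll (hρ : Integrable ρ) (χ : Lp ℝ ⊤ μ) :
    MemLp (fun ω => ∫ z, ρ z * χ (T z ω)) ⊤ μ :=
  memLp_top_of_bound (T.integrable_mul_comp hρ χ).1.prod_swap.integral_prod_right'
    ((∫ z, |ρ z|) * ‖χ‖) ((T.ae_abs_integral_le ρ χ).mono fun _ h => h hρ)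

/-- The mollification of a bounded function along the dynamical system. -/
noncomputable def mollTop (hρ : Integrable ρ) (χ : Lp ℝ ⊤ μ) : Lp ℝ ⊤ μ :=
  (T.memLp_moll hρ χ).toLp

theorem coe_mollTop (hρ : Integrable ρ) (χ : Lp ℝ ⊤ μ) :
    T.mollTop hρ χ =ᵐ[μ] fun ω => ∫ z, ρ z * χ (T z ω) := (T.memLp_moll hρ χ).coeFn_toLp

theorem toOrlicz_mollTop (hΦ : Delta2 Φ) (hρ : Integrable ρ) (χ : Lp ℝ ⊤ μ) :
    toOrlicz Φ (T.mollTop hρ χ) = T.moll ρ (toOrlicz Φ χ) := by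
  refine Orlicz.ext ?_
  filter_upwards [T.coe_mollTop hρ χ, T.coe_moll hΦ hρ (toOrlicz Φ χ) (EventuallyEq.refl _ _)]
    with ω h1 h2
  rw [h2, Orlicz.coe_toOrlicz, h1]
  rfl

theorem coe_koopman_mollTop (hρ : Integrable ρ) (χ : Lp ℝ ⊤ μ) (x : EuclideanSpace ℝ (Fin N)) :
    koopman T x (T.mollTop hρ χ) =ᵐ[μ] fun ω => ∫ z, ρ (z - x) * χ (T z ω) := by
  have h1 : koopman T x (T.mollTop hρ χ) =ᵐ[μ] T.mollTop hρ χ ∘ T x :=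
    Lp.coeFn_compMeasurePreserving _ (T.measurePreserving' x)
  filter_upwards [h1, (T.measurePreserving' x).quasiMeasurePreserving.ae (T.coe_mollTop hρ χ)]
    with ω h2 h3
  rw [h2, Function.comp_apply, h3, ← integral_sub_right_eq_self _ x]
  refine integral_congr_ae (ae_of_all _ fun z => ?_)
  simp only
  rw [← T.map_add', sub_add_cancel]

/-- Acting by `t eᵢ` turns the kernel `ρ(z)` into `ρ(z - t eᵢ)`, so the derivative has kernel
`-∂ᵢρ`. The error in `L^∞(Ω)` is at most the `L¹` error of the difference quotients times `‖χ‖`. -/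
theorem hasStochDeriv_mollTop (hρ : IsBump ρ) (χ : Lp ℝ ⊤ μ) (i : Fin N) :
    HasStochDeriv T i (T.mollTop hρ.integrable χ)
      (T.mollTop (hρ.pderiv i).neg.integrable χ) := by
  refine tendsto_iff_norm_sub_tendsto_zero.2 ?_
  have h0 := (hρ.tendsto_integral_slope (EuclideanSpace.single i 1)).mul_const ‖χ‖
  rw [zero_mul] at h0
  refine squeeze_zero (fun t => norm_nonneg _) (fun t => ?_) h0
  have e : (EuclideanSpace.single i t : EuclideanSpace ℝ (Fin N)) =
      t • EuclideanSpace.single i 1 := by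
    ext j
    by_cases hj : j = i <;> simp [hj]
  set v : EuclideanSpace ℝ (Fin N) := EuclideanSpace.single i 1 with hv
  have hi1 : Integrable fun z => ρ (z - t • v) := hρ.integrable.comp_sub_right _
  have hi2 : Integrable fun z => fderiv ℝ ρ z v := (hρ.pderiv i).integrable
  have hi : Integrable fun z => t⁻¹ * (ρ (z - t • v) - ρ z) + fderiv ℝ ρ z v :=
    ((hi1.sub hρ.integrable).const_mul _).add hi2
  refine (Lp.norm_le_of_ae_bound (C := (∫ z, |t⁻¹ * (ρ (z - t • v) - ρ z) + fderiv ℝ ρ z v|) * ‖χ‖)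
    (by positivity) ?_).trans (by simp)
  rw [e]
  filter_upwards [Lp.coeFn_sub (t⁻¹ • (koopman T (t • v) (T.mollTop hρ.integrable χ) -
      T.mollTop hρ.integrable χ)) (T.mollTop (hρ.pderiv i).neg.integrable χ),
    Lp.coeFn_smul t⁻¹ (koopman T (t • v) (T.mollTop hρ.integrable χ) - T.mollTop hρ.integrable χ),
    Lp.coeFn_sub (koopman T (t • v) (T.mollTop hρ.integrable χ)) (T.mollTop hρ.integrable χ),
    T.coe_koopman_mollTop hρ.integrable χ (t • v), T.coe_mollTop hρ.integrable χ,
    T.coe_mollTop (hρ.pderiv i).neg.integrable χ, T.ae_integrable_mul_comp hρ.integrable χ,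
    T.ae_integrable_mul_comp hi1 χ, T.ae_integrable_mul_comp hi2 χ, T.ae_abs_integral_le _ χ]
    with ω h1 h2 h3 h4 h5 h6 h7 h8 h9 h10
  refine le_trans (le_of_eq ?_) (h10 hi)
  rw [h1, Pi.sub_apply, h2, Pi.smul_apply, h3, Pi.sub_apply, h4, h5, h6, Real.norm_eq_abs,
    smul_eq_mul, ← integral_sub h8 h7, ← integral_const_mul]
  simp only [StochTwoScale.pderiv, neg_mul, integral_neg, sub_neg_eq_add]
  rw [← integral_add (by simpa using (h8.sub h7).const_mul t⁻¹) h9]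
  congr 1
  refine integral_congr_ae (ae_of_all _ fun z => ?_)
  simp only
  ring

theorem mollTop_mem_smooth (hρ : IsBump ρ) (χ : Lp ℝ ⊤ μ) :
    T.mollTop hρ.integrable χ ∈ smooth T := by
  have key : ∀ n (ρ : EuclideanSpace ℝ (Fin N) → ℝ) (hρ : IsBump ρ),
      HasStochDerivs T n (T.mollTop hρ.integrable χ) := by
    intro n
    induction n with
    | zero => exact fun _ _ => trivial
    | succ n ih => exact fun ρ hρ i => ⟨_, T.hasStochDeriv_mollTop hρ χ i, ih _ (hρ.pderiv i).neg⟩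
  exact fun n => key n ρ hρ

variable (Φ) in
/-- The closure in `L^Φ(Ω)ᴺ` of the gradients of the functions in `C^∞(Ω)`. -/
noncomputable def gradClosure : Submodule ℝ (PiLp 1 (fun _ : Fin N => Orlicz Φ μ)) :=
  (LinearMap.range (sharpGrad T Φ)).topologicalClosure

theorem isClosed_gradClosure : IsClosed (T.gradClosure Φ : Set (PiLp 1 fun _ : Fin N => Orlicz Φ μ)) :=
  Submodule.isClosed_topologicalClosure _

/-- For bounded `f` this vector is minus the gradient of the smooth function `mollTop`. Bounded
functions are dense under `Δ₂`, and the condition is closed in `f`. -/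
theorem toLp_moll_pderiv_mem (hΦ : Delta2 Φ) (hρ : IsBump ρ) (f : Orlicz Φ μ) :
    WithLp.toLp 1 (fun i => T.moll (pderiv i ρ) f) ∈ T.gradClosure Φ := by
  refine (Orlicz.dense_range_toOrlicz hΦ).induction_on
    (p := fun f => WithLp.toLp 1 (fun i => T.moll (pderiv i ρ) f) ∈ T.gradClosure Φ) f ?_ fun χ => ?_
  · refine T.isClosed_gradClosure.preimage ((PiLp.continuous_toLp 1 _).comp
      (continuous_pi fun i => ?_))
    exact (T.mollL hΦ (hρ.pderiv i).integrable).continuous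
  · let f' : SmoothSharp Φ T := (⟨_, T.mollTop_mem_smooth hρ χ⟩ : smooth T)
    have h1 : sharpGrad T Φ f' ∈ T.gradClosure Φ :=
      Submodule.le_topologicalClosure _ ⟨f', rfl⟩
    have h2 : WithLp.toLp 1 (fun i => T.moll (pderiv i ρ) (toOrlicz Φ χ)) = -sharpGrad T Φ f' := by
      ext1 i
      have h3 : stochDeriv T i f' = T.mollTop (hρ.pderiv i).neg.integrable χ :=
        (smooth.exists_deriv T f' i).choose_spec.unique T (T.hasStochDeriv_mollTop hρ χ i)
      change _ = -toOrlicz Φ (stochDeriv T i f')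
      rw [h3, T.toOrlicz_mollTop hΦ]
      simp only [moll, neg_smul, integral_neg, neg_neg]
    rw [h2]
    exact neg_mem h1

/-! Functions whose mollifications have vanishing gradient are invariant. -/

theorem moll_sub {ρ₁ ρ₂ : EuclideanSpace ℝ (Fin N) → ℝ} (hΦ : Delta2 Φ) (h₁ : Integrable ρ₁)
    (h₂ : Integrable ρ₂) (f : Orlicz Φ μ) :
    T.moll (fun z => ρ₁ z - ρ₂ z) f = T.moll ρ₁ f - T.moll ρ₂ f := by
  unfold moll
  rw [← integral_sub (T.integrable_smul_act hΦ h₁ f) (T.integrable_smul_act hΦ h₂ f)]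
  simp only [sub_smul]

theorem moll_add {ρ₁ ρ₂ : EuclideanSpace ℝ (Fin N) → ℝ} (hΦ : Delta2 Φ) (h₁ : Integrable ρ₁)
    (h₂ : Integrable ρ₂) (f : Orlicz Φ μ) :
    T.moll (fun z => ρ₁ z + ρ₂ z) f = T.moll ρ₁ f + T.moll ρ₂ f := by
  unfold moll
  rw [← integral_add (T.integrable_smul_act hΦ h₁ f) (T.integrable_smul_act hΦ h₂ f)]
  simp only [add_smul]

omit [IsProbabilityMeasure μ] in
theorem moll_const_mul (c : ℝ) (ρ : EuclideanSpace ℝ (Fin N) → ℝ) (f : Orlicz Φ μ) :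
    T.moll (fun z => c * ρ z) f = c • T.moll ρ f := by
  unfold moll
  rw [← integral_smul]
  simp only [mul_smul]

/-- The curve `t ↦ act (t eᵢ) (moll ρ f)` has derivative zero at `0`, by the `L¹` convergence of the
difference quotients of `ρ`, and hence everywhere, because the action is isometric and additive in
`t`. -/
theorem act_smul_moll_of_moll_pderiv_eq_zero (hΦ : Delta2 Φ) (hρ : IsBump ρ) (f : Orlicz Φ μ)
    (i : Fin N) (h : T.moll (pderiv i ρ) f = 0) (t : ℝ) :
    T.act Φ (t • EuclideanSpace.single i 1) (T.moll ρ f) = T.moll ρ f := by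
  set v : EuclideanSpace ℝ (Fin N) := EuclideanSpace.single i 1 with hv
  have h0 : Tendsto (fun s : ℝ => s⁻¹ • (T.act Φ (s • v) (T.moll ρ f) - T.moll ρ f))
      (𝓝[≠] 0) (𝓝 0) := by
    have h1 := (hρ.tendsto_integral_slope v).mul_const ‖f‖
    rw [zero_mul] at h1
    refine squeeze_zero_norm (fun s => ?_) h1
    have hi1 : Integrable fun z => ρ (z - s • v) := hρ.integrable.comp_sub_right _
    have h2 := T.norm_moll_le (fun z => s⁻¹ * (ρ (z - s • v) - ρ z) + pderiv i ρ z) f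
    have hi2 : Integrable fun z => s⁻¹ * (ρ (z - s • v) - ρ z) :=
      (hi1.sub hρ.integrable).const_mul _
    rw [T.moll_add hΦ hi2 (hρ.pderiv i).integrable,
      T.moll_const_mul, T.moll_sub hΦ hi1 hρ.integrable, h, add_zero,
      ← T.act_moll hΦ hρ.integrable] at h2
    exact h2
  have h1 : ∀ t : ℝ, HasDerivAt (fun t : ℝ => T.act Φ (t • v) (T.moll ρ f)) 0 t := by
    intro t
    refine hasDerivAt_iff_tendsto_slope_zero.2 ?_
    have h2 := ((T.act Φ (t • v)).continuous.tendsto _).comp h0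
    rw [map_zero] at h2
    refine h2.congr fun s => ?_
    simp only [Function.comp_apply, map_smul, map_sub, act_act, ← add_smul, add_comm]
  have h2 := is_const_of_deriv_eq_zero (fun t => (h1 t).differentiableAt) (fun t => (h1 t).deriv) t 0
  rw [zero_smul, act_zero] at h2
  exact h2

variable (Φ) in
/-- The closed subspace of the invariant functions in `L^Φ(Ω)`. -/
noncomputable def invariants : Submodule ℝ (Orlicz Φ μ) where
  carrier := {f | ∀ z, T.act Φ z f = f}
  add_mem' hf hg z := by rw [map_add, hf z, hg z]
  zero_mem' z := map_zero _
  smul_mem' c f hf z := by rw [map_smul, hf z]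

omit [IsProbabilityMeasure μ] in
theorem mem_invariants {f : Orlicz Φ μ} : f ∈ T.invariants Φ ↔ ∀ z, T.act Φ z f = f := Iff.rfl

omit [IsProbabilityMeasure μ] in
theorem isClosed_invariants : IsClosed (T.invariants Φ : Set (Orlicz Φ μ)) := by
  have : (T.invariants Φ : Set (Orlicz Φ μ)) = ⋂ z, {f | T.act Φ z f = f} := by
    ext f
    simp [mem_invariants]
  rw [this]
  exact isClosed_iInter fun z => isClosed_eq (T.act Φ z).continuous continuous_id

/-- Every mollification of `f` is fixed by the translations along coordinate axes, so `f` is fixed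
as their limit; these translations generate `ℝᴺ`. -/
theorem mem_invariants_of_moll_pderiv_eq_zero (hΦ : Delta2 Φ) {f : Orlicz Φ μ}
    (h : ∀ ρ, IsBump ρ → ∀ i, T.moll (pderiv i ρ) f = 0) : f ∈ T.invariants Φ := by
  obtain ⟨ρ, hρ, hlim⟩ := T.exists_mollifier (Φ := Φ) hΦ
  have h1 : ∀ i (t : ℝ), T.act Φ (t • EuclideanSpace.single i 1) f = f := fun i t => by
    refine tendsto_nhds_unique (((T.act Φ _).continuous.tendsto _).comp (hlim f)) ((hlim f).congr
      fun k => ?_)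
    exact (T.act_smul_moll_of_moll_pderiv_eq_zero hΦ ⟨(hρ k).1, (hρ k).2⟩ f i
      (h _ ⟨(hρ k).1, (hρ k).2⟩ i) t).symm
  intro z
  have hz : z = ∑ i, z i • (EuclideanSpace.single i 1 : EuclideanSpace ℝ (Fin N)) := by
    ext j
    simp [Finset.sum_apply, Pi.single_apply]
  have h2 : ∀ s : Finset (Fin N),
      T.act Φ (∑ i ∈ s, z i • (EuclideanSpace.single i 1 : EuclideanSpace ℝ (Fin N))) f = f := by
    intro s
    induction s using Finset.cons_induction with
    | empty => rw [Finset.sum_empty, act_zero]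
    | cons a s ha ih => rw [Finset.sum_cons, ← act_act, h1, ih]
  rw [hz]
  exact h2 _

omit [IsProbabilityMeasure μ] in
theorem comp_ae_eq_of_mem_invariants {f : Orlicz Φ μ} (hf : f ∈ T.invariants Φ) {g : Ω → ℝ}
    (hfg : f =ᵐ[μ] g) : MemInv T Φ g := by
  refine ⟨f.2.congr Φ hfg, fun z => ?_⟩
  have h1 := T.coe_act z f
  rw [hf z] at h1
  filter_upwards [h1, hfg, (T.measurePreserving' z).quasiMeasurePreserving.ae hfg] with ω h2 h3 h4
  rw [← h4, ← h2, h3]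

end DynamicalSystem

end Smoothing

end StochTwoScale

namespace StochTwoScale

/-! ### Weighted integrals in `x` with values in `L^Φ(Ω)`. -/

section SliceIntegral

variable {N : ℕ} {Ω : Type*} [MeasurableSpace Ω] {μ : Measure Ω} [IsProbabilityMeasure μ]
  {κ : Measure (EuclideanSpace ℝ (Fin N))} [IsFiniteMeasure κ] {Φ : YoungFunction}
  {φ : EuclideanSpace ℝ (Fin N) → ℝ}

omit [IsFiniteMeasure κ] in
theorem slice_add (v v' : Orlicz Φ (κ.prod μ)) :
    slice μ Φ (v + v' : Orlicz Φ (κ.prod μ)) =ᵐ[κ] fun x => slice μ Φ v x + slice μ Φ v' x := by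
  filter_upwards [slice_congr (Φ := Φ) (Orlicz.coe_add v v'), memOrlicz_slice v.2,
    memOrlicz_slice v'.2] with x h h1 h2
  rw [h]
  exact Orlicz.ofFun_add h1 h2

omit [IsFiniteMeasure κ] in
theorem slice_smul (c : ℝ) (v : Orlicz Φ (κ.prod μ)) :
    slice μ Φ (c • v : Orlicz Φ (κ.prod μ)) =ᵐ[κ] fun x => c • slice μ Φ v x := by
  filter_upwards [slice_congr (Φ := Φ) (Orlicz.coe_smul c v), memOrlicz_slice v.2] with x h h1
  rw [h]
  exact Orlicz.ofFun_smul h1 c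

omit [IsFiniteMeasure κ] in
theorem IsBump.integrable_smul (hφ : IsBump φ) {B : Type*} [NormedAddCommGroup B]
    [NormedSpace ℝ B] {s : EuclideanSpace ℝ (Fin N) → B} (hs : Integrable s κ) :
    Integrable (fun x => φ x • s x) κ := by
  obtain ⟨C, hC⟩ := hφ.exists_bound
  exact hs.smul_of_top_right (memLp_top_of_bound hφ.continuous.aestronglyMeasurable C
    (ae_of_all _ hC))

theorem integral_norm_slice_le (hΦ : Delta2 Φ) (v : Orlicz Φ (κ.prod μ)) :
    ∫ x, ‖slice μ Φ v x‖ ∂κ ≤ (κ.real univ + 1) * ‖v‖ := by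
  have hi := integrable_slice (μ := μ) hΦ v.2
  have h0 : 0 < κ.real univ + 1 := by positivity
  have key : ∀ a, ‖v‖ < a → ∫ x, ‖slice μ Φ v x‖ ∂κ ≤ (κ.real univ + 1) * a := by
    intro a ha
    have ha0 : 0 < a := (norm_nonneg v).trans_lt ha
    lift a to ℝ≥0 using ha0.le
    have h1 := Orlicz.modular_le_one v ha
    have h2 := lintegral_enorm_slice_le (μ := μ) v.2.1 (by exact_mod_cast ha0)
      (h1.trans_lt ENNReal.one_lt_top)
    rw [integral_norm_eq_lintegral_enorm hi.1]
    refine ENNReal.toReal_le_of_le_ofReal (by positivity) (h2.trans ?_)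
    rw [mul_comm (κ.real univ + 1), ENNReal.ofReal_mul ha0.le, ENNReal.ofReal_coe_nnreal,
      ENNReal.ofReal_add (by positivity) zero_le_one, ofReal_measureReal, ENNReal.ofReal_one]
    gcongr
  refine le_of_forall_gt_imp_ge_of_dense fun b hb => ?_
  have h1 := key (b / (κ.real univ + 1)) (by rwa [lt_div_iff₀ h0, mul_comm])
  rwa [mul_div_cancel₀ _ h0.ne'] at h1

variable (κ) in
/-- The weighted integral `∫ φ(x) v(x, ·) dκ(x)`, an element of `L^Φ(Ω)`. -/
noncomputable def sliceInt (φ : EuclideanSpace ℝ (Fin N) → ℝ) (v : Orlicz Φ (κ.prod μ)) :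
    Orlicz Φ μ := ∫ x, φ x • slice μ Φ v x ∂κ

/-- The weighted integral as a continuous linear map. -/
noncomputable def sliceIntL (hΦ : Delta2 Φ) (hφ : IsBump φ) :
    Orlicz Φ (κ.prod μ) →L[ℝ] Orlicz Φ μ :=
  LinearMap.mkContinuousOfExistsBound
    { toFun := sliceInt κ φ
      map_add' := fun v v' => by
        unfold sliceInt
        rw [← integral_add (hφ.integrable_smul (integrable_slice hΦ v.2))
          (hφ.integrable_smul (integrable_slice hΦ v'.2))]
        refine integral_congr_ae ?_
        filter_upwards [slice_add v v'] with x hx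
        rw [hx, smul_add]
      map_smul' := fun c v => by
        unfold sliceInt
        rw [RingHom.id_apply, ← integral_smul]
        refine integral_congr_ae ?_
        filter_upwards [slice_smul c v] with x hx
        rw [hx, smul_comm] }
    (by
      obtain ⟨C, hC⟩ := hφ.exists_bound
      have hC0 : 0 ≤ C := (norm_nonneg _).trans (hC 0)
      refine ⟨C * (κ.real univ + 1), fun v => ?_⟩
      refine (norm_integral_le_of_norm_le ((integrable_slice hΦ v.2).norm.const_mul C)
        (ae_of_all _ fun x => ?_)).trans ?_
      · rw [norm_smul]
        exact mul_le_mul_of_nonneg_right (hC x) (norm_nonneg _)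
      · rw [integral_const_mul, mul_assoc]
        exact mul_le_mul_of_nonneg_left (integral_norm_slice_le hΦ v) hC0)

theorem sliceIntL_apply (hΦ : Delta2 Φ) (hφ : IsBump φ) (v : Orlicz Φ (κ.prod μ)) :
    sliceIntL hΦ hφ v = sliceInt κ φ v := rfl

theorem coe_sliceInt (hΦ : Delta2 Φ) (hφ : IsBump φ) (v : Orlicz Φ (κ.prod μ)) :
    sliceInt κ φ v =ᵐ[μ] fun ω => ∫ x, φ x * v (x, ω) ∂κ := by
  have hs : slice μ Φ (fun p => φ p.1 * v p) =ᵐ[κ] fun x => φ x • slice μ Φ v x := by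
    filter_upwards [memOrlicz_slice v.2] with x hx
    exact Orlicz.ofFun_smul hx (φ x)
  have h := coe_integral_slice (Φ := Φ) (v := fun p => φ p.1 * v p)
    (hφ.continuous.aestronglyMeasurable.comp_fst.mul v.2.1)
    ((memOrlicz_slice v.2).mono fun x hx => hx.smul Φ (φ x))
    ((hφ.integrable_smul (integrable_slice hΦ v.2)).congr hs.symm)
  rw [integral_congr_ae hs] at h
  exact h

theorem pairing_sliceInt (hΦ : Delta2 Φ) (hφ : IsBump φ) (v : Orlicz Φ (κ.prod μ))
    (χ : Lp ℝ ⊤ μ) :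
    Orlicz.pairing χ (sliceInt κ φ v) = ∫ p, v p * (φ p.1 * χ p.2) ∂(κ.prod μ) := by
  obtain ⟨C, hC⟩ := hφ.exists_bound
  have h1 : MemLp (fun p : EuclideanSpace ℝ (Fin N) × Ω => φ p.1 * χ p.2) ⊤ (κ.prod μ) := by
    refine memLp_top_of_bound
      (hφ.continuous.aestronglyMeasurable.comp_fst.mul (Lp.memLp χ).1.comp_snd) (C * ‖χ‖) ?_
    filter_upwards [Measure.quasiMeasurePreserving_snd.ae (Orlicz.ae_norm_le χ)] with p hp
    rw [norm_mul]
    exact mul_le_mul (hC _) hp (norm_nonneg _) ((norm_nonneg _).trans (hC p.1))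
  have h2 : Integrable (fun p => v p * (φ p.1 * χ p.2)) (κ.prod μ) :=
    v.integrable.mul_of_top_left h1
  rw [sliceInt, ← ContinuousLinearMap.integral_comp_comm _
    (hφ.integrable_smul (integrable_slice hΦ v.2)), integral_prod _ h2]
  refine integral_congr_ae ?_
  filter_upwards [memOrlicz_slice v.2] with x hx
  rw [map_smul, Orlicz.pairing_apply, smul_eq_mul, ← integral_const_mul]
  refine integral_congr_ae ?_
  filter_upwards [coe_slice hx] with ω hω
  rw [hω]
  ring

theorem sliceInt_add_left (hΦ : Delta2 Φ) {φ' : EuclideanSpace ℝ (Fin N) → ℝ} (hφ : IsBump φ)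
    (hφ' : IsBump φ') (v : Orlicz Φ (κ.prod μ)) :
    sliceInt κ (fun x => φ x + φ' x) v = sliceInt κ φ v + sliceInt κ φ' v := by
  unfold sliceInt
  rw [← integral_add (hφ.integrable_smul (integrable_slice hΦ v.2))
    (hφ'.integrable_smul (integrable_slice hΦ v.2))]
  simp only [add_smul]

omit [IsProbabilityMeasure μ] [IsFiniteMeasure κ] in
theorem sliceInt_const_mul_left (c : ℝ) (v : Orlicz Φ (κ.prod μ)) :
    sliceInt κ (fun x => c * φ x) v = c • sliceInt κ φ v := by
  unfold sliceInt
  rw [← integral_smul]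
  simp only [mul_smul]

/-- Turns an identity for almost every `ω` into one between elements of `L^Φ(Ω)`, to which the
action, mollifications and pairings can be applied. -/
theorem hasWeakDeriv_iff (hΦ : Delta2 Φ) {Q : Set (EuclideanSpace ℝ (Fin N))}
    [IsFiniteMeasure (volume.restrict Q)] {i : Fin N}
    {v g : Orlicz Φ ((volume.restrict Q).prod μ)} :
    HasWeakDeriv Q μ i v g ↔ ∀ φ, IsTest Q φ →
      sliceInt (volume.restrict Q) (pderiv i φ) v = -sliceInt (volume.restrict Q) φ g := by
  refine forall₂_congr fun φ hφ => ?_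
  have hb : IsBump φ := ⟨hφ.1, hφ.2.1⟩
  have e1 : ∀ ω, ∫ x in Q, pderiv i φ x * v (x, ω) =
      ∫ x in Q, v (x, ω) * fderiv ℝ φ x (EuclideanSpace.single i 1) := fun ω =>
    integral_congr_ae (ae_of_all _ fun x => mul_comm _ _)
  have e2 : ∀ ω, ∫ x in Q, φ x * g (x, ω) = ∫ x in Q, g (x, ω) * φ x := fun ω =>
    integral_congr_ae (ae_of_all _ fun x => mul_comm _ _)
  constructor
  · intro h
    refine Orlicz.ext ?_
    filter_upwards [h, coe_sliceInt hΦ (hb.pderiv i) v, coe_sliceInt hΦ hb g,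
      Orlicz.coe_neg (sliceInt (volume.restrict Q) φ g)] with ω h1 h2 h3 h4
    rw [h2, h4, h3, e1, e2, h1]
  · intro h
    filter_upwards [coe_sliceInt hΦ (hb.pderiv i) v, coe_sliceInt hΦ hb g,
      Orlicz.coe_neg (sliceInt (volume.restrict Q) φ g)] with ω h2 h3 h4
    rw [← e1, ← e2, ← h2, ← h3, ← h4, h]

end SliceIntegral

/-! ### The unfolding operator and its integration by parts. -/

section Unfolding

variable {N : ℕ} {Ω : Type*} [MeasurableSpace Ω] {μ : Measure Ω} [IsProbabilityMeasure μ]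
  (T : DynamicalSystem N μ) {κ : Measure (EuclideanSpace ℝ (Fin N))} [IsFiniteMeasure κ]
  {Φ : YoungFunction} {φ ρ : EuclideanSpace ℝ (Fin N) → ℝ}

omit [IsFiniteMeasure κ] in
theorem quasiMeasurePreserving_smul_of_ne_zero (hκ : κ ≪ volume) {c : ℝ} (hc : c ≠ 0) :
    Measure.QuasiMeasurePreserving (fun x : EuclideanSpace ℝ (Fin N) => c • x) κ volume := by
  refine Measure.QuasiMeasurePreserving.mono_left ⟨measurable_const_smul c, ?_⟩ hκ
  rw [Measure.map_addHaar_smul _ hc]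
  exact Measure.smul_absolutelyContinuous

namespace DynamicalSystem

omit [IsFiniteMeasure κ] in
theorem integral_shift [SFinite κ] {a : EuclideanSpace ℝ (Fin N) → EuclideanSpace ℝ (Fin N)}
    (ha : Measure.QuasiMeasurePreserving a κ volume) {f : EuclideanSpace ℝ (Fin N) × Ω → ℝ}
    (hf : Integrable f (κ.prod μ)) :
    ∫ p, f (p.1, T (a p.1) p.2) ∂(κ.prod μ) = ∫ p, f p ∂(κ.prod μ) := by
  have hf' : Integrable (fun p => f (p.1, T (a p.1) p.2)) (κ.prod μ) :=
    ⟨T.aestronglyMeasurable_shift ha hf.1, (T.lintegral_shift ha hf.1.enorm).trans_lt hf.2⟩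
  rw [integral_eq_lintegral_pos_part_sub_lintegral_neg_part hf,
    integral_eq_lintegral_pos_part_sub_lintegral_neg_part hf',
    T.lintegral_shift ha (f := fun p => ENNReal.ofReal (f p)) hf.1.aemeasurable.ennreal_ofReal,
    T.lintegral_shift ha (f := fun p => ENNReal.ofReal (-f p))
      hf.1.aemeasurable.neg.ennreal_ofReal]

/-- The function `(x, ω) ↦ v(x, T(-c x) ω)`. -/
noncomputable def unfold (c : ℝ) (v : Orlicz Φ (κ.prod μ)) : Orlicz Φ (κ.prod μ) :=
  Orlicz.ofFun (κ.prod μ) Φ fun p => v (p.1, T ((-c) • p.1) p.2)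

variable {c : ℝ}

theorem coe_unfold (hκ : κ ≪ volume) (hc : c ≠ 0) (v : Orlicz Φ (κ.prod μ)) :
    T.unfold c v =ᵐ[κ.prod μ] fun p => v (p.1, T ((-c) • p.1) p.2) :=
  Orlicz.coe_ofFun (T.memOrlicz_shift
    (quasiMeasurePreserving_smul_of_ne_zero hκ (neg_ne_zero.2 hc)) v.2)

theorem norm_unfold (hκ : κ ≪ volume) (hc : c ≠ 0) (v : Orlicz Φ (κ.prod μ)) :
    ‖T.unfold c v‖ = ‖v‖ := by
  have ha := quasiMeasurePreserving_smul_of_ne_zero hκ (neg_ne_zero.2 hc)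
  rw [unfold, Orlicz.norm_ofFun (T.memOrlicz_shift ha v.2), T.luxemburg_shift ha Φ v.2.1,
    Orlicz.norm_def]

omit [IsProbabilityMeasure μ] in
theorem act_slice {X : Type*} {v : X × Ω → ℝ} {x : X} (h : MemOrlicz Φ (fun ω => v (x, ω)) μ)
    (z : EuclideanSpace ℝ (Fin N)) :
    T.act Φ z (slice μ Φ v x) = Orlicz.ofFun μ Φ fun ω => v (x, T z ω) := by
  have h1 : (fun ω => slice μ Φ v x (T z ω)) =ᵐ[μ] fun ω => v (x, T z ω) :=
    (T.measurePreserving' z).quasiMeasurePreserving.ae (coe_slice h)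
  rw [act_def, Orlicz.ofFun_congr h1]

theorem slice_unfold (hκ : κ ≪ volume) (hc : c ≠ 0) (v : Orlicz Φ (κ.prod μ)) :
    slice μ Φ (T.unfold c v) =ᵐ[κ] fun x => T.act Φ ((-c) • x) (slice μ Φ v x) := by
  filter_upwards [slice_congr (Φ := Φ) (T.coe_unfold hκ hc v), memOrlicz_slice v.2] with x h1 h2
  rw [h1, T.act_slice h2]
  rfl

/-- The substitution `ω ↦ T(-cx)ω` preserves `μ` for each `x` and cancels the oscillation `T(cx)` in
the test function. This is what reduces two-scale convergence to convergence of the unfoldings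
against fixed bounded functions. -/
theorem integral_mul_unfold (hκ : κ ≪ volume) (hc : c ≠ 0) (v : Orlicz Φ (κ.prod μ))
    {f : EuclideanSpace ℝ (Fin N) × Ω → ℝ} (hf : AEStronglyMeasurable f (κ.prod μ)) {C : ℝ}
    (hC : ∀ᵐ p ∂(κ.prod μ), ‖f p‖ ≤ C) :
    ∫ p, v p * f (p.1, T (c • p.1) p.2) ∂(κ.prod μ) = ∫ p, T.unfold c v p * f p ∂(κ.prod μ) := by
  have ha := quasiMeasurePreserving_smul_of_ne_zero hκ hc
  have ha' := quasiMeasurePreserving_smul_of_ne_zero hκ (neg_ne_zero.2 hc)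
  have hf' : MemLp (fun p => f (p.1, T (c • p.1) p.2)) ⊤ (κ.prod μ) :=
    memLp_top_of_bound (T.aestronglyMeasurable_shift ha hf) C
      (T.ae_shift ha (P := fun p => ‖f p‖ ≤ C) hC)
  rw [← T.integral_shift ha' (f := fun p => v p * f (p.1, T (c • p.1) p.2))
    (v.integrable.mul_of_top_left hf')]
  refine integral_congr_ae ?_
  filter_upwards [T.coe_unfold hκ hc v] with p hp
  simp only [hp, ← T.map_add', ← add_smul, add_neg_cancel, zero_smul, T.map_zero']

theorem aestronglyMeasurable_act_slice (hΦ : Delta2 Φ) (v : Orlicz Φ (κ.prod μ)) :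
    AEStronglyMeasurable (fun p : EuclideanSpace ℝ (Fin N) × EuclideanSpace ℝ (Fin N) =>
      T.act Φ p.2 (slice μ Φ v p.1)) (κ.prod volume) := by
  let v' : (EuclideanSpace ℝ (Fin N) × EuclideanSpace ℝ (Fin N)) × Ω → ℝ := fun p => v (p.1.1, p.2)
  have h1 : AEStronglyMeasurable v' ((κ.prod volume).prod μ) :=
    v.2.1.comp_quasiMeasurePreserving
      (MeasureTheory.QuasiMeasurePreserving.prodMap Measure.quasiMeasurePreserving_fst
        (Measure.QuasiMeasurePreserving.id μ))
  have h2 := T.aestronglyMeasurable_shift (a := Prod.snd) Measure.quasiMeasurePreserving_snd h1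
  have hm : ∀ᵐ p : EuclideanSpace ℝ (Fin N) × EuclideanSpace ℝ (Fin N) ∂(κ.prod volume),
      MemOrlicz Φ (fun ω => v (p.1, ω)) μ :=
    Measure.quasiMeasurePreserving_fst.ae (memOrlicz_slice v.2)
  refine (aestronglyMeasurable_slice hΦ h2 (hm.mono fun p hp => T.memOrlicz_comp hp p.2)).congr ?_
  filter_upwards [hm] with p hp
  rw [T.act_slice hp]
  rfl

theorem integrable_smul_act_slice (hΦ : Delta2 Φ) (hρ : IsBump ρ) (hφ : IsBump φ) (c : ℝ)
    (v : Orlicz Φ (κ.prod μ)) :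
    Integrable (fun p : EuclideanSpace ℝ (Fin N) × EuclideanSpace ℝ (Fin N) =>
      (ρ (p.2 + c • p.1) * φ p.1) • T.act Φ p.2 (slice μ Φ v p.1)) (κ.prod volume) := by
  have hc : Continuous fun p : EuclideanSpace ℝ (Fin N) × EuclideanSpace ℝ (Fin N) =>
      ρ (p.2 + c • p.1) * φ p.1 := by
    have := hρ.continuous
    have := hφ.continuous
    fun_prop
  refine (integrable_prod_iff (hc.aestronglyMeasurable.smul
    (T.aestronglyMeasurable_act_slice hΦ v))).2 ⟨ae_of_all _ fun x => ?_, ?_⟩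
  · have h1 : Integrable fun y => ρ (y + c • x) * φ x :=
      (hρ.integrable.comp_add_right (c • x)).mul_const _
    exact T.integrable_smul_act hΦ h1 (slice μ Φ v x)
  · have hi : Integrable (fun x => (∫ z, |ρ z|) * ‖φ x • slice μ Φ v x‖) κ :=
      (hφ.integrable_smul (integrable_slice hΦ v.2)).norm.const_mul _
    refine hi.congr (ae_of_all _ fun x => ?_)
    have h1 : ∀ y, ‖(ρ (y + c • x) * φ x) • T.act Φ y (slice μ Φ v x)‖ =
        |ρ (y + c • x)| * ‖φ x • slice μ Φ v x‖ := fun y => by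
      rw [norm_smul, norm_mul, LinearIsometry.norm_map, mul_assoc, norm_smul, Real.norm_eq_abs (ρ _)]
    have h2 : ∫ y, |ρ (y + c • x)| = ∫ z, |ρ z| := integral_add_right_eq_self (fun z => |ρ z|) (c • x)
    refine ((integral_congr_ae (ae_of_all _ h1)).trans ?_).symm
    rw [integral_mul_const, h2]

theorem integrable_act_sliceInt (hΦ : Delta2 Φ) (hρ : IsBump ρ) (hφ : IsBump φ) (c : ℝ)
    (v : Orlicz Φ (κ.prod μ)) :
    Integrable fun y => T.act Φ y (sliceInt κ (fun x => ρ (y + c • x) * φ x) v) := by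
  refine (T.integrable_smul_act_slice hΦ hρ hφ c v).integral_prod_right.congr
    (ae_of_all _ fun y => ?_)
  have h := (T.act Φ y).toContinuousLinearMap.integral_comp_comm
    ((hρ.mul_comp_add_smul hφ y c).integrable_smul (integrable_slice (κ := κ) (μ := μ) hΦ v.2))
  simp only [LinearIsometry.coe_toContinuousLinearMap, map_smul] at h
  exact h

/-- Substituting `z = y + cx` in the mollification cancels the shift `T(-cx)` in the unfolding. The
fast variable then appears only in the smooth weight `ρ(y + cx)φ(x)`, against which a weak
derivative in `x` can be tested. -/
theorem moll_sliceInt_unfold (hΦ : Delta2 Φ) (hκ : κ ≪ volume) (hc : c ≠ 0) (hρ : IsBump ρ)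
    (hφ : IsBump φ) (v : Orlicz Φ (κ.prod μ)) :
    T.moll ρ (sliceInt κ φ (T.unfold c v)) =
      ∫ y, T.act Φ y (sliceInt κ (fun x => ρ (y + c • x) * φ x) v) := by
  have h1 : ∀ y, T.act Φ y (sliceInt κ (fun x => ρ (y + c • x) * φ x) v) =
      ∫ x, (ρ (y + c • x) * φ x) • T.act Φ y (slice μ Φ v x) ∂κ := fun y => by
    have h := (T.act Φ y).toContinuousLinearMap.integral_comp_comm
      ((hρ.mul_comp_add_smul hφ y c).integrable_smul (integrable_slice (κ := κ) (μ := μ) hΦ v.2))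
    simp only [LinearIsometry.coe_toContinuousLinearMap, map_smul] at h
    exact h.symm
  simp only [h1]
  rw [← integral_integral_swap (T.integrable_smul_act_slice hΦ hρ hφ c v),
    ← T.mollL_apply hΦ hρ.integrable, sliceInt, ← ContinuousLinearMap.integral_comp_comm _
      (hφ.integrable_smul (integrable_slice hΦ (T.unfold c v).2))]
  refine integral_congr_ae ?_
  filter_upwards [T.slice_unfold hκ hc v] with x hx
  rw [map_smul, mollL_apply, hx, moll, ← integral_smul, ← integral_add_right_eq_self _ (c • x)]
  refine integral_congr_ae (ae_of_all _ fun y => ?_)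
  simp only [act_act, smul_smul, mul_comm (φ x)]
  congr 3
  rw [neg_smul]
  abel

/-- Integration by parts in the unfolded variables. -/
theorem moll_sliceInt_unfold_add (hΦ : Delta2 Φ) {Q : Set (EuclideanSpace ℝ (Fin N))}
    [IsFiniteMeasure (volume.restrict Q)] (hc : c ≠ 0) (hρ : IsBump ρ) (hφ : IsTest Q φ)
    {i : Fin N} {v g : Orlicz Φ ((volume.restrict Q).prod μ)} (h : HasWeakDeriv Q μ i v g) :
    T.moll ρ (sliceInt (volume.restrict Q) φ (T.unfold c g)) +
      T.moll ρ (sliceInt (volume.restrict Q) (pderiv i φ) (T.unfold c v)) =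
      -(c • T.moll (pderiv i ρ) (sliceInt (volume.restrict Q) φ (T.unfold c v))) := by
  have hb : IsBump φ := ⟨hφ.1, hφ.2.1⟩
  have hκ : volume.restrict Q ≪ volume := Measure.restrict_le_self.absolutelyContinuous
  have hi : Integrable fun y =>
      T.act Φ y (sliceInt (volume.restrict Q) (fun x => ρ (y + c • x) * φ x) g) +
        T.act Φ y (sliceInt (volume.restrict Q) (fun x => ρ (y + c • x) * pderiv i φ x) v) :=
    (T.integrable_act_sliceInt hΦ hρ hb c g).add
      (T.integrable_act_sliceInt hΦ hρ (hb.pderiv i) c v)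
  have hi' : Integrable fun y =>
      c • T.act Φ y (sliceInt (volume.restrict Q) (fun x => pderiv i ρ (y + c • x) * φ x) v) :=
    (T.integrable_act_sliceInt hΦ (hρ.pderiv i) hb c v).smul c
  rw [← add_eq_zero_iff_eq_neg, T.moll_sliceInt_unfold hΦ hκ hc hρ hb,
    T.moll_sliceInt_unfold hΦ hκ hc hρ (hb.pderiv i),
    T.moll_sliceInt_unfold hΦ hκ hc (hρ.pderiv i) hb, ← integral_smul,
    ← integral_add (T.integrable_act_sliceInt hΦ hρ hb c g)
      (T.integrable_act_sliceInt hΦ hρ (hb.pderiv i) c v),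
    ← integral_add hi hi']
  refine integral_eq_zero_of_ae (ae_of_all _ fun y => ?_)
  -- For fixed `y` the weight is itself a test function on `Q`, and its `i`-th derivative `ρ ∂ᵢφ + c
  -- φ ∂ᵢρ` produces the three terms. The identity thus holds before integration in `y`.
  have hθ : IsTest Q fun x => ρ (y + c • x) * φ x :=
    ⟨(hρ.mul_comp_add_smul hb y c).1, (hρ.mul_comp_add_smul hb y c).2,
      (tsupport_mul_subset_right).trans hφ.2.2⟩
  have hd : pderiv i (fun x => ρ (y + c • x) * φ x) = fun x =>
      ρ (y + c • x) * pderiv i φ x + c * (pderiv i ρ (y + c • x) * φ x) := by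
    ext x
    have h1 : HasFDerivAt (fun x => ρ (y + c • x)) ((fderiv ℝ ρ (y + c • x)).comp
        (c • ContinuousLinearMap.id ℝ _)) x :=
      (hρ.differentiable _).hasFDerivAt.comp x (((hasFDerivAt_id x).const_smul c).const_add y)
    have h2 : fderiv ℝ (fun x => ρ (y + c • x) * φ x) x = _ :=
      (h1.mul (hb.differentiable x).hasFDerivAt).fderiv
    simp only [pderiv]
    rw [h2]
    simp
    ring
  have h3 := (hasWeakDeriv_iff hΦ).1 h _ hθ
  have hcb : IsBump fun x => c * (pderiv i ρ (y + c • x) * φ x) :=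
    ⟨contDiff_const.mul ((hρ.pderiv i).mul_comp_add_smul hb y c).1,
      ((hρ.pderiv i).mul_comp_add_smul hb y c).2.mul_left⟩
  rw [hd, sliceInt_add_left hΦ (hρ.mul_comp_add_smul (hb.pderiv i) y c) hcb,
    sliceInt_const_mul_left] at h3
  beta_reduce
  rw [Pi.zero_apply]
  rw [← map_smul, ← map_add, ← map_add, add_assoc, h3, add_neg_cancel, map_zero]

end DynamicalSystem

end Unfolding

end StochTwoScale

namespace StochTwoScale

/-! ### Weak closedness of closed subspaces. -/

section WeakClosure

variable {B : Type*} [NormedAddCommGroup B] [NormedSpace ℝ B]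

theorem mem_of_forall_dual (S : Submodule ℝ B) (hS : IsClosed (S : Set B)) {y : B}
    (h : ∀ ℓ : B →L[ℝ] ℝ, (∀ s ∈ S, ℓ s = 0) → ℓ y = 0) : y ∈ S := by
  have := hS
  let π : B →L[ℝ] B ⧸ S := S.mkQ.mkContinuous 1 fun b => by
    rw [one_mul]
    exact Submodule.Quotient.norm_mk_le S b
  have hπ : ∀ b, π b = 0 ↔ b ∈ S := fun b => Submodule.Quotient.mk_eq_zero S
  rw [← hπ, SeparatingDual.eq_zero_iff_forall_dual_eq_zero (R := ℝ)]
  exact fun g => h (g.comp π) fun s hs => by simp [(hπ s).2 hs]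

theorem exists_dual_pi {N : ℕ} (ℓ : PiLp 1 (fun _ : Fin N => B) →L[ℝ] ℝ) :
    ∃ ℓ' : Fin N → B →L[ℝ] ℝ, ∀ f : Fin N → B, ℓ (WithLp.toLp 1 f) = ∑ i, ℓ' i (f i) := by
  let e := (PiLp.continuousLinearEquiv 1 ℝ fun _ : Fin N => B).symm
  refine ⟨fun i => (ℓ.comp (e : (Fin N → B) →L[ℝ] _)).comp (ContinuousLinearMap.single ℝ (fun _ : Fin N => B) i),
    fun f => ?_⟩
  have h : f = ∑ i, Pi.single i (f i) := (Finset.univ_sum_single f).symm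
  have h2 : ℓ (WithLp.toLp 1 f) = ℓ.comp (e : (Fin N → B) →L[ℝ] _) f := rfl
  rw [h2]
  conv_lhs => rw [h]
  rw [map_sum]
  rfl

/-- By Hahn–Banach a closed subspace is the common kernel of the functionals vanishing on it. A
functional on a finite product is a sum of functionals of the components, so componentwise weak
convergence suffices. -/
theorem toLp_mem_of_tendsto {N : ℕ} (S : Submodule ℝ (PiLp 1 fun _ : Fin N => B))
    (hS : IsClosed (S : Set (PiLp 1 fun _ : Fin N => B))) {f : ℕ → Fin N → B} {g : Fin N → B}
    (hf : ∀ n, WithLp.toLp 1 (f n) ∈ S)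
    (hlim : ∀ i (ℓ : B →L[ℝ] ℝ), Tendsto (fun n => ℓ (f n i)) atTop (𝓝 (ℓ (g i)))) :
    WithLp.toLp 1 g ∈ S := by
  refine mem_of_forall_dual S hS fun ℓ hℓ => ?_
  obtain ⟨ℓ', hℓ'⟩ := exists_dual_pi ℓ
  have h1 : Tendsto (fun n => ℓ (WithLp.toLp 1 (f n))) atTop (𝓝 (ℓ (WithLp.toLp 1 g))) := by
    simp only [hℓ']
    exact tendsto_finsetSum _ fun i _ => hlim i (ℓ' i)
  refine tendsto_nhds_unique h1 (tendsto_const_nhds.congr fun n => (hℓ _ (hf n)).symm)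

end WeakClosure

/-! ### Conditional expectation given the invariant sets. -/

section InvariantExpectation

variable {N : ℕ} {Ω : Type*} [MeasurableSpace Ω] {μ : Measure Ω}
  (T : DynamicalSystem N μ) {κ : Measure (EuclideanSpace ℝ (Fin N))}
  {Φ : YoungFunction} {φ ρ : EuclideanSpace ℝ (Fin N) → ℝ}

namespace DynamicalSystem

variable (κ) in
/-- The `σ`-algebra of the sets that are, up to null sets, invariant under
`(x, ω) ↦ (x, T(z) ω)` for every `z`. -/
@[reducible] def invSigma : MeasurableSpace (EuclideanSpace ℝ (Fin N) × Ω) where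
  MeasurableSet' A := MeasurableSet A ∧ ∀ z, (fun p => (p.1, T z p.2)) ⁻¹' A =ᵐ[κ.prod μ] A
  measurableSet_empty := ⟨MeasurableSet.empty, fun _ => EventuallyEq.rfl⟩
  measurableSet_compl _ hA := ⟨hA.1.compl, fun z => (hA.2 z).compl⟩
  measurableSet_iUnion A hA := ⟨MeasurableSet.iUnion fun n => (hA n).1, fun z => by
    rw [preimage_iUnion]
    exact Filter.EventuallyEq.countable_iUnion fun n => (hA n).2 z⟩

theorem invSigma_le : T.invSigma κ ≤ Prod.instMeasurableSpace := fun _ hA => hA.1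

/-- The sets `{g < q}` with rational `q` determine `g`. There are countably many, so their almost
sure invariance holds simultaneously. -/
theorem comp_ae_eq_of_measurable {g : EuclideanSpace ℝ (Fin N) × Ω → ℝ}
    (hg : Measurable[T.invSigma κ] g) (z : EuclideanSpace ℝ (Fin N)) :
    (fun p => g (p.1, T z p.2)) =ᵐ[κ.prod μ] g := by
  have h : ∀ᵐ p ∂(κ.prod μ), ∀ q : ℚ, (g (p.1, T z p.2) < q) = (g p < q) :=
    ae_all_iff.2 fun q => (hg (measurableSet_Iio (a := (q : ℝ)))).2 z
  filter_upwards [h] with p hp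
  refine le_antisymm (le_of_not_gt fun hlt => ?_) (le_of_not_gt fun hlt => ?_)
  · obtain ⟨q, h1, h2⟩ := exists_rat_btwn hlt
    exact h2.not_ge ((hp q).mpr h1).le
  · obtain ⟨q, h1, h2⟩ := exists_rat_btwn hlt
    exact h2.not_ge ((hp q).mp h1).le

theorem measurable_of_comp_ae_eq {g : EuclideanSpace ℝ (Fin N) × Ω → ℝ} (hg : Measurable g)
    (h : ∀ z, (fun p => g (p.1, T z p.2)) =ᵐ[κ.prod μ] g) : Measurable[T.invSigma κ] g := by
  intro s hs
  refine ⟨hg hs, fun z => ?_⟩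
  filter_upwards [h z] with p hp
  change (g (p.1, T z p.2) ∈ s) = (g p ∈ s)
  rw [hp]

variable [IsProbabilityMeasure μ] [IsFiniteMeasure κ]

theorem integral_condExp_mul {v h : EuclideanSpace ℝ (Fin N) × Ω → ℝ}
    (hv : Integrable v (κ.prod μ)) (hh : StronglyMeasurable[T.invSigma κ] h)
    (hb : MemLp h ⊤ (κ.prod μ)) :
    ∫ p, ((κ.prod μ)[v | T.invSigma κ]) p * h p ∂(κ.prod μ) = ∫ p, v p * h p ∂(κ.prod μ) := by
  have h1 := condExp_mul_of_stronglyMeasurable_right hh (hv.mul_of_top_left hb) hv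
  exact (integral_congr_ae h1).symm.trans (integral_condExp T.invSigma_le)

/-- A bounded function `F(E v)` of the conditional expectation is measurable for the invariant sets,
so `∫ E v · F(E v) = ∫ v · F(E v)`, and Young's inequality for `v` gives the bound required by
`memOrlicz_of_test`. -/
theorem memOrlicz_condExp (v : Orlicz Φ (κ.prod μ)) :
    MemOrlicz Φ ((κ.prod μ)[v | T.invSigma κ]) (κ.prod μ) := by
  obtain ⟨a, ha⟩ : ∃ a : ℝ≥0, ‖v‖ < a := ⟨‖v‖₊ + 1, by push_cast; linarith⟩
  have ha0 : 0 < a := by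
    have := (norm_nonneg v).trans_lt ha
    exact_mod_cast this
  refine Orlicz.memOrlicz_of_test integrable_condExp ha0 fun F hF ⟨C, hC⟩ => ?_
  have h1 : StronglyMeasurable[T.invSigma κ]
      fun p => F (((κ.prod μ)[v | T.invSigma κ]) p) :=
    (hF.comp (stronglyMeasurable_condExp (m := T.invSigma κ)).measurable).stronglyMeasurable
  rw [T.integral_condExp_mul v.integrable h1 (Orlicz.memLp_comp hF hC integrable_condExp.1)]
  have h2 := Orlicz.ofReal_abs_integral_mul_le v
    (fun p => F (((κ.prod μ)[v | T.invSigma κ]) p)) ha one_pos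
  simp only [div_one, one_mul] at h2
  exact (ENNReal.ofReal_le_ofReal (le_abs_self _)).trans h2

/-- The conditional expectation given the `σ`-algebra of invariant sets. -/
noncomputable def invExp (v : Orlicz Φ (κ.prod μ)) : Orlicz Φ (κ.prod μ) :=
  Orlicz.ofFun (κ.prod μ) Φ ((κ.prod μ)[v | T.invSigma κ])

theorem coe_invExp (v : Orlicz Φ (κ.prod μ)) :
    T.invExp v =ᵐ[κ.prod μ] (κ.prod μ)[v | T.invSigma κ] := Orlicz.coe_ofFun (T.memOrlicz_condExp v)

theorem slice_invExp_act (v : Orlicz Φ (κ.prod μ)) (z : EuclideanSpace ℝ (Fin N)) :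
    ∀ᵐ x ∂κ, T.act Φ z (slice μ Φ (T.invExp v) x) = slice μ Φ (T.invExp v) x := by
  have h1 := T.comp_ae_eq_of_measurable (κ := κ)
    (stronglyMeasurable_condExp (m := T.invSigma κ) (f := v) (μ := κ.prod μ)).measurable z
  filter_upwards [slice_congr (Φ := Φ) (T.coe_invExp v), Measure.ae_ae_of_ae_prod h1,
    memOrlicz_slice (T.memOrlicz_condExp v)] with x h2 h3 h4
  rw [h2, T.act_slice h4]
  exact Orlicz.ofFun_congr h3

theorem act_sliceInt (hΦ : Delta2 Φ) (hφ : IsBump φ) (v : Orlicz Φ (κ.prod μ))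
    (z : EuclideanSpace ℝ (Fin N)) :
    T.act Φ z (sliceInt κ φ v) = ∫ x, φ x • T.act Φ z (slice μ Φ v x) ∂κ := by
  have h := (T.act Φ z).toContinuousLinearMap.integral_comp_comm
    (hφ.integrable_smul (integrable_slice (κ := κ) (μ := μ) hΦ v.2))
  simp only [LinearIsometry.coe_toContinuousLinearMap, map_smul] at h
  exact h.symm

theorem sliceInt_invExp_mem (hΦ : Delta2 Φ) (hφ : IsBump φ) (v : Orlicz Φ (κ.prod μ)) :
    sliceInt κ φ (T.invExp v) ∈ T.invariants Φ := by
  intro z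
  rw [T.act_sliceInt hΦ hφ]
  refine integral_congr_ae ?_
  filter_upwards [T.slice_invExp_act v z] with x hx
  rw [hx]

/-- For invariant `χ` the product `φ(x)χ(ω)` is measurable for the invariant sets, because the
action does not move `x`. -/
theorem pairing_sliceInt_invExp (hΦ : Delta2 Φ) (hφ : IsBump φ) (v : Orlicz Φ (κ.prod μ))
    {χ : Lp ℝ ⊤ μ} (hχ : ∀ z, (fun ω => χ (T z ω)) =ᵐ[μ] χ) :
    Orlicz.pairing χ (sliceInt κ φ (T.invExp v)) = Orlicz.pairing χ (sliceInt κ φ v) := by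
  obtain ⟨C, hC⟩ := hφ.exists_bound
  have h1 : MemLp (fun p : EuclideanSpace ℝ (Fin N) × Ω => φ p.1 * χ p.2) ⊤ (κ.prod μ) := by
    refine memLp_top_of_bound
      (hφ.continuous.aestronglyMeasurable.comp_fst.mul (Lp.memLp χ).1.comp_snd) (C * ‖χ‖) ?_
    filter_upwards [Measure.quasiMeasurePreserving_snd.ae (Orlicz.ae_norm_le χ)] with p hp
    rw [norm_mul]
    exact mul_le_mul (hC _) hp (norm_nonneg _) ((norm_nonneg _).trans (hC p.1))
  have h2 : Measurable fun p : EuclideanSpace ℝ (Fin N) × Ω => φ p.1 * χ p.2 :=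
    (hφ.continuous.measurable.comp measurable_fst).mul
      ((Lp.stronglyMeasurable χ).measurable.comp measurable_snd)
  have h3 := T.measurable_of_comp_ae_eq (κ := κ) h2 fun z => by
    filter_upwards [Measure.quasiMeasurePreserving_snd.ae (hχ z)] with p hp
    rw [hp]
  rw [pairing_sliceInt hΦ hφ, pairing_sliceInt hΦ hφ,
    ← T.integral_condExp_mul v.integrable h3.stronglyMeasurable h1]
  refine integral_congr_ae ?_
  filter_upwards [T.coe_invExp v] with p hp
  rw [hp]

omit [IsProbabilityMeasure μ] in
theorem integral_comp {f : Ω → ℝ} (hf : AEStronglyMeasurable f μ)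
    (z : EuclideanSpace ℝ (Fin N)) : ∫ ω, f (T z ω) ∂μ = ∫ ω, f ω ∂μ := by
  have h := (T.measurePreserving' z).map_eq
  rw [← h] at hf
  rw [← integral_map (T.measurePreserving' z).aemeasurable hf, h]

theorem pairing_act {χ : Lp ℝ ⊤ μ} (hχ : ∀ z, (fun ω => χ (T z ω)) =ᵐ[μ] χ)
    (z : EuclideanSpace ℝ (Fin N)) (f : Orlicz Φ μ) :
    Orlicz.pairing χ (T.act Φ z f) = Orlicz.pairing χ f := by
  rw [Orlicz.pairing_apply, Orlicz.pairing_apply,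
    ← T.integral_comp (Orlicz.integrable_mul f χ).1 z]
  refine integral_congr_ae ?_
  filter_upwards [hχ z, T.coe_act z f] with ω h1 h2
  rw [h1, h2]

theorem pairing_moll (hΦ : Delta2 Φ) (hρ : Integrable ρ) {χ : Lp ℝ ⊤ μ}
    (hχ : ∀ z, (fun ω => χ (T z ω)) =ᵐ[μ] χ) (f : Orlicz Φ μ) :
    Orlicz.pairing χ (T.moll ρ f) = (∫ z, ρ z) * Orlicz.pairing χ f := by
  rw [moll, ← ContinuousLinearMap.integral_comp_comm _ (T.integrable_smul_act hΦ hρ f),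
    ← integral_mul_const]
  refine integral_congr_ae (ae_of_all _ fun z => ?_)
  simp only [map_smul, T.pairing_act hχ, smul_eq_mul]

end DynamicalSystem

/-- The difference quotients have integral zero by translation invariance and converge in `L¹` to
minus the derivative. -/
theorem IsBump.integral_pderiv (hρ : IsBump ρ) (i : Fin N) : ∫ z, StochTwoScale.pderiv i ρ z = 0 := by
  have h := hρ.tendsto_integral_slope (EuclideanSpace.single i 1)
  have h1 : ∀ t : ℝ, |∫ z, StochTwoScale.pderiv i ρ z| ≤
      ∫ z, |t⁻¹ * (ρ (z - t • EuclideanSpace.single i 1) - ρ z) +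
        fderiv ℝ ρ z (EuclideanSpace.single i 1)| := fun t => by
    have hi1 : Integrable fun z => ρ (z - t • EuclideanSpace.single i 1) :=
      hρ.integrable.comp_sub_right _
    have hi2 : Integrable fun z => t⁻¹ * (ρ (z - t • EuclideanSpace.single i 1) - ρ z) :=
      (hi1.sub hρ.integrable).const_mul _
    have hi3 : Integrable fun z => fderiv ℝ ρ z (EuclideanSpace.single i 1) :=
      (hρ.pderiv i).integrable
    have e : ∫ z, StochTwoScale.pderiv i ρ z = ∫ z, (t⁻¹ * (ρ (z - t • EuclideanSpace.single i 1) - ρ z) +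
        fderiv ℝ ρ z (EuclideanSpace.single i 1)) := by
      rw [integral_add hi2 hi3, integral_const_mul,
        integral_sub hi1 hρ.integrable, integral_sub_right_eq_self, sub_self, mul_zero, zero_add]
      rfl
    rw [e]
    exact abs_integral_le_integral_abs
  have h2 := ge_of_tendsto h (Eventually.of_forall h1)
  exact abs_eq_zero.1 (le_antisymm h2 (abs_nonneg _))

end InvariantExpectation

end StochTwoScale

namespace StochTwoScale

/-! ### Identification of the two-scale limits. -/

section Limit

variable {N : ℕ} {Ω : Type*} [MeasurableSpace Ω] {μ : Measure Ω} [IsProbabilityMeasure μ]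
  (T : DynamicalSystem N μ) {Φ : YoungFunction} {φ ρ : EuclideanSpace ℝ (Fin N) → ℝ}
  {Q : Set (EuclideanSpace ℝ (Fin N))} [IsFiniteMeasure (volume.restrict Q)]

namespace DynamicalSystem

/-- The situation of a sequence with bounded derivatives, whose unfoldings at the scales `c n`
converge weakly together with those of the derivatives. -/
structure UnfoldsTo (c : ℕ → ℝ) (u : ℕ → Orlicz Φ ((volume.restrict Q).prod μ))
    (g : ℕ → Fin N → Orlicz Φ ((volume.restrict Q).prod μ))
    (u₀ : Orlicz Φ ((volume.restrict Q).prod μ))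
    (ξ : Fin N → Orlicz Φ ((volume.restrict Q).prod μ)) : Prop where
  ne_zero : ∀ n, c n ≠ 0
  tendsto_inv : Tendsto (fun n => (c n)⁻¹) atTop (𝓝 0)
  hasWeakDeriv : ∀ n i, HasWeakDeriv Q μ i (u n) (g n i)
  tendsto : ∀ ℓ : Orlicz Φ ((volume.restrict Q).prod μ) →L[ℝ] ℝ,
    Tendsto (fun n => ℓ (T.unfold (c n) (u n))) atTop (𝓝 (ℓ u₀))
  tendsto_deriv : ∀ i (ℓ : Orlicz Φ ((volume.restrict Q).prod μ) →L[ℝ] ℝ),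
    Tendsto (fun n => ℓ (T.unfold (c n) (g n i))) atTop (𝓝 (ℓ (ξ i)))

namespace UnfoldsTo

variable {T} {c : ℕ → ℝ} {u : ℕ → Orlicz Φ ((volume.restrict Q).prod μ)}
  {g : ℕ → Fin N → Orlicz Φ ((volume.restrict Q).prod μ)}
  {u₀ : Orlicz Φ ((volume.restrict Q).prod μ)}
  {ξ : Fin N → Orlicz Φ ((volume.restrict Q).prod μ)}

/-- Divide the integration by parts by `c n`. Its left side converges weakly, so multiplied by `(c
n)⁻¹ → 0` it disappears and leaves `M_{∂ᵢρ}(∫ φ u₀) = 0` for every `ρ`. -/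
theorem sliceInt_mem_invariants (h : T.UnfoldsTo c u g u₀ ξ) (hΦ : Delta2 Φ) (hφ : IsTest Q φ) :
    sliceInt (volume.restrict Q) φ u₀ ∈ T.invariants Φ := by
  have hb : IsBump φ := ⟨hφ.1, hφ.2.1⟩
  refine T.mem_invariants_of_moll_pderiv_eq_zero hΦ fun ρ hρ i =>
    Orlicz.eq_zero_of_pairing fun χ => ?_
  have h1 := h.tendsto ((Orlicz.pairing χ).comp
    ((T.mollL hΦ (hρ.pderiv i).integrable).comp (sliceIntL hΦ hb)))
  have h2 := h.tendsto_deriv i ((Orlicz.pairing χ).comp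
    ((T.mollL hΦ hρ.integrable).comp (sliceIntL hΦ hb)))
  have h3 := h.tendsto ((Orlicz.pairing χ).comp
    ((T.mollL hΦ hρ.integrable).comp (sliceIntL hΦ (hb.pderiv i))))
  have h4 := (h.tendsto_inv.mul (h2.add h3)).neg
  rw [zero_mul, neg_zero] at h4
  refine tendsto_nhds_unique h1 (h4.congr fun n => ?_)
  have h5 := congrArg (Orlicz.pairing χ)
    (T.moll_sliceInt_unfold_add hΦ (h.ne_zero n) hρ hφ (h.hasWeakDeriv n i))
  rw [map_add, map_neg, map_smul, smul_eq_mul] at h5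
  simp only [ContinuousLinearMap.comp_apply, sliceIntL_apply, mollL_apply]
  rw [h5, mul_neg, neg_neg, inv_mul_cancel_left₀ (h.ne_zero n)]

/-- Paired with an invariant `χ`, the singular term carries the factor `∫ ∂ᵢρ = 0`. The identity
therefore holds exactly for every `n`, once the mollifier is removed, and passes to the limit. -/
theorem pairing_eq_zero (h : T.UnfoldsTo c u g u₀ ξ) (hΦ : Delta2 Φ) (hφ : IsTest Q φ) (i : Fin N)
    {χ : Lp ℝ ⊤ μ} (hχ : ∀ z, (fun ω => χ (T z ω)) =ᵐ[μ] χ) :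
    Orlicz.pairing χ (sliceInt (volume.restrict Q) φ (ξ i)) +
      Orlicz.pairing χ (sliceInt (volume.restrict Q) (pderiv i φ) u₀) = 0 := by
  have hb : IsBump φ := ⟨hφ.1, hφ.2.1⟩
  have h1 := h.tendsto_deriv i ((Orlicz.pairing χ).comp (sliceIntL hΦ hb))
  have h2 := h.tendsto ((Orlicz.pairing χ).comp (sliceIntL hΦ (hb.pderiv i)))
  refine tendsto_nhds_unique (h1.add h2) (tendsto_const_nhds.congr fun n => ?_)
  simp only [ContinuousLinearMap.comp_apply, sliceIntL_apply]
  obtain ⟨ρ, hρ, hlim⟩ := T.exists_mollifier (Φ := Φ) hΦ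
  rw [← map_add]
  refine tendsto_nhds_unique (tendsto_const_nhds.congr fun k => ?_)
    (((Orlicz.pairing χ).continuous.tendsto _).comp (hlim _))
  have hρk : IsBump (ρ k) := ⟨(hρ k).1, (hρ k).2⟩
  rw [Function.comp_apply, ← T.mollL_apply hΦ hρk.integrable, map_add, mollL_apply, mollL_apply,
    T.moll_sliceInt_unfold_add hΦ (h.ne_zero n) hρk hφ (h.hasWeakDeriv n i), map_neg, map_smul,
    T.pairing_moll hΦ (hρk.pderiv i).integrable hχ, hρk.integral_pderiv, zero_mul, smul_zero,
    neg_zero]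

/-- The sum of the two sides is invariant, as `∂ᵢφ` is again a test function, and it has zero
pairing with invariant bounded functions. Its own `squash` is one of these, so it vanishes. -/
theorem sliceInt_pderiv (h : T.UnfoldsTo c u g u₀ ξ) (hΦ : Delta2 Φ) (hφ : IsTest Q φ)
    (i : Fin N) : sliceInt (volume.restrict Q) (pderiv i φ) u₀ =
      -sliceInt (volume.restrict Q) φ (T.invExp (ξ i)) := by
  have hb : IsBump φ := ⟨hφ.1, hφ.2.1⟩
  have hφ' : IsTest Q (pderiv i φ) := ⟨(hb.pderiv i).1, (hb.pderiv i).2,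
    ((tsupport_fderiv_apply_subset ℝ _).trans hφ.2.2)⟩
  rw [← add_eq_zero_iff_eq_neg]
  set f := sliceInt (volume.restrict Q) (pderiv i φ) u₀ +
    sliceInt (volume.restrict Q) φ (T.invExp (ξ i)) with hf
  have hinv : f ∈ T.invariants Φ :=
    add_mem (h.sliceInt_mem_invariants hΦ hφ') (T.sliceInt_invExp_mem hΦ hb _)
  have hm := Orlicz.memLp_squash f.2.1
  have hfinv := (T.comp_ae_eq_of_mem_invariants hinv (EventuallyEq.refl _ _)).2
  have hχ : ∀ z, (fun ω => (hm.toLp : Lp ℝ ⊤ μ) (T z ω)) =ᵐ[μ] hm.toLp := fun z => by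
    filter_upwards [hm.coeFn_toLp, hfinv z,
      (T.measurePreserving' z).quasiMeasurePreserving.ae hm.coeFn_toLp] with ω h1 h2 h3
    rw [h1, h3, h2]
  have key : ∀ χ : Lp ℝ ⊤ μ, (∀ z, (fun ω => χ (T z ω)) =ᵐ[μ] χ) → Orlicz.pairing χ f = 0 :=
    fun χ hχ => by
      rw [hf, map_add, T.pairing_sliceInt_invExp hΦ hb _ hχ, add_comm]
      exact h.pairing_eq_zero hΦ hφ i hχ
  have h0 := key _ hχ
  rw [Orlicz.pairing_toLp] at h0
  exact Orlicz.ext ((Orlicz.ae_eq_zero_of_integral_mul_squash f.integrable h0).trans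
    Orlicz.coe_zero.symm)

theorem hasWeakDeriv_invExp (h : T.UnfoldsTo c u g u₀ ξ) (hΦ : Delta2 Φ) (i : Fin N) :
    HasWeakDeriv Q μ i u₀ (T.invExp (ξ i)) :=
  (hasWeakDeriv_iff hΦ).2 fun _ hφ => h.sliceInt_pderiv hΦ hφ i

/-- For fixed `ρ` the right sides of the integration by parts lie in `gradClosure`, and so does
their weak limit, however fast `c n` grows. By `sliceInt_pderiv` the term `∫ ∂ᵢφ u₀` in that limit
is `-∫ φ E ξᵢ`; mollifiers then remove `ρ`. -/
theorem toLp_sliceInt_mem (h : T.UnfoldsTo c u g u₀ ξ) (hΦ : Delta2 Φ) (hφ : IsTest Q φ) :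
    WithLp.toLp 1 (fun i => sliceInt (volume.restrict Q) φ (ξ i - T.invExp (ξ i))) ∈
      T.gradClosure Φ := by
  have hb : IsBump φ := ⟨hφ.1, hφ.2.1⟩
  have key : ∀ ρ, IsBump ρ → WithLp.toLp 1
      (fun i => T.moll ρ (sliceInt (volume.restrict Q) φ (ξ i - T.invExp (ξ i)))) ∈
      T.gradClosure Φ := by
    intro ρ hρ
    refine toLp_mem_of_tendsto (T.gradClosure Φ) T.isClosed_gradClosure
      (f := fun n i => -(c n • T.moll (pderiv i ρ)
        (sliceInt (volume.restrict Q) φ (T.unfold (c n) (u n))))) (fun n => ?_) fun i ℓ => ?_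
    · have h1 := T.toLp_moll_pderiv_mem hΦ hρ
        (sliceInt (volume.restrict Q) φ (T.unfold (c n) (u n)))
      exact neg_mem ((T.gradClosure Φ).smul_mem (c n) h1)
    · have h1 := h.tendsto_deriv i (ℓ.comp ((T.mollL hΦ hρ.integrable).comp (sliceIntL hΦ hb)))
      have h2 := h.tendsto (ℓ.comp ((T.mollL hΦ hρ.integrable).comp (sliceIntL hΦ (hb.pderiv i))))
      have e : T.moll ρ (sliceInt (volume.restrict Q) φ (ξ i - T.invExp (ξ i))) =
          T.moll ρ (sliceInt (volume.restrict Q) φ (ξ i)) +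
            T.moll ρ (sliceInt (volume.restrict Q) (pderiv i φ) u₀) := by
        rw [← sliceIntL_apply hΦ hb, map_sub, sliceIntL_apply, sliceIntL_apply,
          h.sliceInt_pderiv hΦ hφ, sub_eq_add_neg, ← T.mollL_apply hΦ hρ.integrable, map_add]
        rfl
      rw [e, map_add]
      refine (h1.add h2).congr fun n => ?_
      rw [← T.moll_sliceInt_unfold_add hΦ (h.ne_zero n) hρ hφ (h.hasWeakDeriv n i), map_add]
      rfl
  obtain ⟨ρ, hρ, hlim⟩ := T.exists_mollifier (Φ := Φ) hΦ
  refine T.isClosed_gradClosure.mem_of_tendsto (((PiLp.continuous_toLp 1 _).tendsto _).comp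
    (tendsto_pi_nhds.2 fun i => hlim _)) (Eventually.of_forall fun k => ?_)
  exact key (ρ k) ⟨(hρ k).1, (hρ k).2⟩

theorem ae_slice_mem_invariants (h : T.UnfoldsTo c u g u₀ ξ) (hΦ : Delta2 Φ) (hQ : IsOpen Q) :
    ∀ᵐ x ∂(volume.restrict Q), slice μ Φ u₀ x ∈ T.invariants Φ :=
  ae_mem_of_integral_smul_mem _ T.isClosed_invariants hQ (integrable_slice hΦ u₀.2)
    fun _ hφ => h.sliceInt_mem_invariants hΦ hφ

theorem ae_slice_mem_gradClosure (h : T.UnfoldsTo c u g u₀ ξ) (hΦ : Delta2 Φ) (hQ : IsOpen Q) :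
    ∀ᵐ x ∂(volume.restrict Q), WithLp.toLp 1
      (fun i => slice μ Φ (ξ i - T.invExp (ξ i) : Orlicz Φ ((volume.restrict Q).prod μ)) x) ∈
      T.gradClosure Φ := by
  let e := (PiLp.continuousLinearEquiv 1 ℝ fun _ : Fin N => Orlicz Φ μ).symm
  have hi : Integrable (fun x i =>
      slice μ Φ (ξ i - T.invExp (ξ i) : Orlicz Φ ((volume.restrict Q).prod μ)) x)
      (volume.restrict Q) := Integrable.of_eval fun i => integrable_slice hΦ (ξ i - T.invExp (ξ i)).2
  have hi' : Integrable (fun x => e fun i =>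
      slice μ Φ (ξ i - T.invExp (ξ i) : Orlicz Φ ((volume.restrict Q).prod μ)) x)
      (volume.restrict Q) :=
    (e : (Fin N → Orlicz Φ μ) →L[ℝ] PiLp 1 fun _ : Fin N => Orlicz Φ μ).integrable_comp hi
  refine ae_mem_of_integral_smul_mem _ T.isClosed_gradClosure hQ hi' fun φ hφ => ?_
  have hb : IsBump φ := ⟨hφ.1, hφ.2.1⟩
  have h1 := (e : (Fin N → Orlicz Φ μ) →L[ℝ]
    PiLp 1 fun _ : Fin N => Orlicz Φ μ).integral_comp_comm (hb.integrable_smul hi)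
  simp only [map_smul] at h1
  refine (congrArg (· ∈ T.gradClosure Φ) (h1.trans ?_)).mpr (h.toLp_sliceInt_mem hΦ hφ)
  change WithLp.toLp 1 _ = _
  congr 1
  ext1 i
  rw [eval_integral fun i => (hb.integrable_smul hi).eval i]
  rfl

end UnfoldsTo

theorem ae_slice_invExp_mem (hΦ : Delta2 Φ) (hQ : IsOpen Q) (v : Orlicz Φ ((volume.restrict Q).prod μ)) :
    ∀ᵐ x ∂(volume.restrict Q), slice μ Φ (T.invExp v) x ∈ T.invariants Φ :=
  ae_mem_of_integral_smul_mem _ T.isClosed_invariants hQ (integrable_slice hΦ (T.invExp v).2)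
    fun _ hφ => T.sliceInt_invExp_mem hΦ ⟨hφ.1, hφ.2.1⟩ v

end DynamicalSystem

end Limit

/-! ### The completion as the closure of the gradients. -/

section GradBar

variable {N : ℕ} {Ω : Type*} [MeasurableSpace Ω] {μ : Measure Ω} [IsProbabilityMeasure μ]
  (T : DynamicalSystem N μ) (Φ : YoungFunction)

theorem isometry_gradBar : Isometry (gradBar T Φ) :=
  (isometry_sharpGrad T Φ).completion_extension

theorem norm_gradBar (f : WSharp T Φ) : ‖gradBar T Φ f‖ = ‖f‖ := by
  have h0 : gradBar T Φ 0 = 0 := by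
    rw [← UniformSpace.Completion.coe_zero, gradBar_coe, map_zero]
  rw [← dist_zero_right, ← h0, (isometry_gradBar T Φ).dist_eq, dist_zero_right]

/-- An isometry from a complete space has closed range, and this range contains all gradients of
smooth functions. -/
theorem exists_gradBar_eq {v : PiLp 1 fun _ : Fin N => Orlicz Φ μ} (hv : v ∈ T.gradClosure Φ) :
    ∃ f, gradBar T Φ f = v := by
  have hc : IsClosed (range (gradBar T Φ)) :=
    (isometry_gradBar T Φ).isClosedEmbedding.isClosed_range
  refine closure_minimal ?_ hc hv
  rintro _ ⟨f, rfl⟩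
  exact ⟨f, gradBar_coe T Φ f⟩

end GradBar

/-! ### Orlicz integrability of the norm of the slices under `Δ'`. -/

section DeltaPrime

variable {Ω : Type*} [MeasurableSpace Ω] {μ : Measure Ω} {Φ : YoungFunction}

/-- For `0 < t < ‖f‖` the modular at `t` exceeds `1`, so `Φ(t) ≤ ∫ Φ(t)Φ(|f|/t) ≤ ∫ Φ(b|f|)`. Then
`t` increases to `‖f‖`. -/
theorem map_nnnorm_le_modular {b : ℝ≥0} (hb : ∀ s t, Φ s * Φ t ≤ Φ (b * (s * t)))
    (f : Orlicz Φ μ) : (Φ ‖f‖₊ : ℝ≥0∞) ≤ modular Φ f μ b⁻¹ := by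
  have key : ∀ t : ℝ≥0, 0 < t → t < ‖f‖₊ → (Φ t : ℝ≥0∞) ≤ modular Φ f μ b⁻¹ := by
    intro t ht0 ht
    have h1 : 1 < modular Φ f μ t := by
      by_contra! hle
      have h2 : ‖f‖₊ ≤ t := luxemburg_le Φ ht0 hle
      exact absurd ht h2.not_gt
    calc (Φ t : ℝ≥0∞) = Φ t * 1 := (mul_one _).symm
      _ ≤ Φ t * modular Φ f μ t := by gcongr
      _ = ∫⁻ x, (Φ t : ℝ≥0∞) * (Φ (‖f x‖₊ / t) : ℝ≥0∞) ∂μ :=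
          (lintegral_const_mul' _ _ ENNReal.coe_ne_top).symm
      _ ≤ modular Φ f μ b⁻¹ := lintegral_mono fun x => by
          rw [← ENNReal.coe_mul]
          refine ENNReal.coe_le_coe.2 ((hb _ _).trans (le_of_eq ?_))
          rw [mul_div_cancel₀ _ ht0.ne', div_inv_eq_mul, mul_comm]
  rcases eq_or_ne ‖f‖₊ 0 with h0 | h0
  · rw [h0, Φ.map_zero]
    exact zero_le
  · have hlim : Tendsto (fun t : ℝ≥0 => (Φ t : ℝ≥0∞)) (𝓝[<] ‖f‖₊) (𝓝 (Φ ‖f‖₊ : ℝ≥0∞)) :=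
      ENNReal.tendsto_coe.2 ((Φ.continuous'.tendsto _).mono_left nhdsWithin_le_nhds)
    have h0' : 0 < ‖f‖₊ := pos_iff_ne_zero.2 h0
    have : (𝓝[<] ‖f‖₊).NeBot := nhdsLT_neBot_of_exists_lt ⟨0, h0'⟩
    refine le_of_tendsto hlim ?_
    filter_upwards [Ioo_mem_nhdsLT h0'] with t ht
    exact key t ht.1 ht.2

theorem memOrlicz_norm_slice {X : Type*} [MeasurableSpace X] {κ : Measure X} [IsFiniteMeasure κ]
    [IsFiniteMeasure μ] (hΦ : Delta2 Φ) (h : DeltaPrime Φ.conj) (v : Orlicz Φ (κ.prod μ)) :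
    MemOrlicz Φ (fun x => ‖slice μ Φ v x‖) κ := by
  obtain ⟨b, hb0, hb⟩ := Φ.exists_mul_le_of_deltaPrime_conj h
  refine ⟨(integrable_slice hΦ v.2).1.norm, 1, one_pos, lt_of_le_of_lt ?_
    (modular_lt_top_of_delta2 Φ hΦ v.2 (δ := b⁻¹) (by positivity))⟩
  rw [← lintegral_modular_slice v.2.1]
  refine lintegral_mono_ae ?_
  filter_upwards [memOrlicz_slice v.2] with x hx
  rw [div_one, nnnorm_norm, ← modular_congr Φ (coe_slice hx)]
  exact map_nnnorm_le_modular hb _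

theorem MemOrlicz.sum {X ι : Type*} [MeasurableSpace X] {κ : Measure X} (s : Finset ι)
    {f : ι → X → ℝ} (hf : ∀ i, MemOrlicz Φ (f i) κ) : MemOrlicz Φ (∑ i ∈ s, f i) κ := by
  induction s using Finset.cons_induction with
  | empty => simpa using MemOrlicz.zero Φ
  | cons a s ha ih =>
    rw [Finset.sum_cons]
    exact (hf a).add Φ ih

end DeltaPrime

end StochTwoScale

/-! ### Assembly of the compactness theorem. -/

namespace StochTwoScale

variable {N : ℕ} {Ω : Type*} [MeasurableSpace Ω] {μ : Measure Ω} [IsProbabilityMeasure μ]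
  (T : DynamicalSystem N μ) {Φ : YoungFunction} {Q : Set (EuclideanSpace ℝ (Fin N))}
  [IsFiniteMeasure (volume.restrict Q)]

theorem twoScale_of_tendsto_pairing {ε : ℕ → ℝ} (hε : ∀ n, 0 < ε n)
    {u : ℕ → Orlicz Φ ((volume.restrict Q).prod μ)} {u₀ : Orlicz Φ ((volume.restrict Q).prod μ)}
    (h : ∀ χ, Tendsto (fun n => Orlicz.pairing χ (T.unfold (ε n)⁻¹ (u n))) atTop
      (𝓝 (Orlicz.pairing χ u₀))) : TwoScale T Φ Q ε u u₀ := by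
  intro m φ ψ hφ
  let f : EuclideanSpace ℝ (Fin N) × Ω → ℝ := fun p => ∑ j, φ j p.1 * (ψ j : Lp ℝ ⊤ μ) p.2
  have hfm : AEStronglyMeasurable f ((volume.restrict Q).prod μ) :=
    Finset.aestronglyMeasurable_fun_sum _ fun j _ =>
      (hφ j).1.continuous.aestronglyMeasurable.comp_fst.mul (Lp.memLp _).1.comp_snd
  choose C hC using fun j => IsBump.exists_bound ⟨(hφ j).1, (hφ j).2.1⟩
  have hfC : ∀ᵐ p ∂((volume.restrict Q).prod μ), ‖f p‖ ≤ ∑ j, C j * ‖(ψ j : Lp ℝ ⊤ μ)‖ := by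
    have h1 : ∀ᵐ p ∂((volume.restrict Q).prod μ), ∀ j,
        ‖(ψ j : Lp ℝ ⊤ μ) p.2‖ ≤ ‖(ψ j : Lp ℝ ⊤ μ)‖ := ae_all_iff.2 fun j =>
      Measure.quasiMeasurePreserving_snd.ae (Orlicz.ae_norm_le (ψ j : Lp ℝ ⊤ μ))
    filter_upwards [h1] with p hp
    refine (norm_sum_le _ _).trans (Finset.sum_le_sum fun j _ => ?_)
    rw [norm_mul]
    exact mul_le_mul (hC _ _) (hp j) (norm_nonneg _) ((norm_nonneg _).trans (hC j p.1))
  have hf := memLp_top_of_bound hfm _ hfC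
  have h1 := h hf.toLp
  simp only [Orlicz.pairing_toLp] at h1
  refine h1.congr fun n => ?_
  exact (T.integral_mul_unfold Measure.restrict_le_self.absolutelyContinuous
    (inv_ne_zero (hε n).ne') (u n) hfm hfC).symm

theorem exists_twoScale_limit (hQ : IsOpen Q) (hΦ : Delta2 Φ) (hΦ' : Delta2 Φ.conj)
    {ε : ℕ → ℝ} (hε : ∀ n, 0 < ε n) (hε₀ : Tendsto ε atTop (𝓝 0))
    (u : ℕ → Orlicz Φ ((volume.restrict Q).prod μ))
    (Du : ℕ → Fin N → Orlicz Φ ((volume.restrict Q).prod μ))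
    (hDu : ∀ n i, HasWeakDeriv Q μ i (u n) (Du n i))
    (hub : ∃ C : ℝ, ∀ n, ‖u n‖ ≤ C) (hDub : ∃ C : ℝ, ∀ n i, ‖Du n i‖ ≤ C) :
    ∃ (k : ℕ → ℕ) (u₀ : Orlicz Φ ((volume.restrict Q).prod μ))
      (Du₀ : Fin N → Orlicz Φ ((volume.restrict Q).prod μ))
      (u₁ : EuclideanSpace ℝ (Fin N) → WSharp T Φ)
      (G : Fin N → Orlicz Φ ((volume.restrict Q).prod μ)),
      StrictMono k ∧
      (∀ i, HasWeakDeriv Q μ i u₀ (Du₀ i)) ∧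
      (∀ᵐ x ∂(volume.restrict Q), MemInv T Φ (fun ω => u₀ (x, ω)) ∧
        ∀ i, MemInv T Φ (fun ω => Du₀ i (x, ω))) ∧
      Integrable u₁ (volume.restrict Q) ∧
      (∀ᵐ x ∂(volume.restrict Q), ∀ i, (fun ω => G i (x, ω)) =ᵐ[μ] gradBar T Φ (u₁ x) i) ∧
      TwoScale T Φ Q (ε ∘ k) (u ∘ k) u₀ ∧
      (∀ i, TwoScale T Φ Q (ε ∘ k) (fun n => Du (k n) i) (Du₀ i + G i)) ∧
      (DeltaPrime Φ.conj → MemOrlicz Φ u₁ (volume.restrict Q)) := by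
  have hκ : volume.restrict Q ≪ volume := Measure.restrict_le_self.absolutelyContinuous
  have hc : ∀ n, (ε n)⁻¹ ≠ 0 := fun n => inv_ne_zero (hε n).ne'
  obtain ⟨C, hC⟩ := hub
  obtain ⟨C', hC'⟩ := hDub
  -- The index `none` stands for the function and `some i` for its `i`-th derivative, so that one
  -- subsequence serves all of them.
  let w : ℕ → Option (Fin N) → Orlicz Φ ((volume.restrict Q).prod μ) := fun n o =>
    T.unfold (ε n)⁻¹ (o.elim (u n) (Du n))
  have hw : ∀ n o, ‖w n o‖ ≤ max C C' := fun n o => by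
    refine (T.norm_unfold hκ (hc n) _).le.trans ?_
    cases o with
    | none => exact (hC n).trans (le_max_left _ _)
    | some i => exact (hC' n i).trans (le_max_right _ _)
  obtain ⟨k, w₀, hk, hlim⟩ := Orlicz.exists_subseq_pairing w hw
  let ξ : Fin N → Orlicz Φ ((volume.restrict Q).prod μ) := fun i => w₀ (some i)
  have hU : T.UnfoldsTo (fun n => (ε (k n))⁻¹) (u ∘ k) (Du ∘ k) (w₀ none) ξ :=
    { ne_zero := fun n => hc (k n)
      tendsto_inv := by
        simp only [inv_inv]
        exact hε₀.comp hk.tendsto_atTop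
      hasWeakDeriv := fun n i => hDu (k n) i
      tendsto := Orlicz.tendsto_of_pairing hΦ hΦ' (fun n => hw (k n) none) (hlim none)
      tendsto_deriv := fun i =>
        Orlicz.tendsto_of_pairing hΦ hΦ' (fun n => hw (k n) (some i)) (hlim (some i)) }
  let G : Fin N → Orlicz Φ ((volume.restrict Q).prod μ) := fun i => ξ i - T.invExp (ξ i)
  have hG := hU.ae_slice_mem_gradClosure hΦ hQ
  -- The choice is made pointwise, with value `0` on the exceptional null set. No measurable
  -- selection is needed: `gradBar` is an isometric embedding, so measurability and norms of `u₁`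
  -- are read off from the slices of `G`.
  have hex : ∀ x, ∃ f : WSharp T Φ, WithLp.toLp 1 (fun i => slice μ Φ (G i) x) ∈
      T.gradClosure Φ → gradBar T Φ f = WithLp.toLp 1 fun i => slice μ Φ (G i) x := fun x => by
    by_cases h : WithLp.toLp 1 (fun i => slice μ Φ (G i) x) ∈ T.gradClosure Φ
    · obtain ⟨f, hf⟩ := exists_gradBar_eq T Φ h
      exact ⟨f, fun _ => hf⟩
    · exact ⟨0, fun h' => absurd h' h⟩
  choose u₁ hu₁ using hex
  have hu₁' : ∀ᵐ x ∂(volume.restrict Q),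
      gradBar T Φ (u₁ x) = WithLp.toLp 1 fun i => slice μ Φ (G i) x :=
    hG.mono fun x hx => hu₁ x hx
  have hs : AEStronglyMeasurable (fun x => gradBar T Φ (u₁ x)) (volume.restrict Q) := by
    refine AEStronglyMeasurable.congr ?_ (EventuallyEq.symm hu₁')
    exact (PiLp.continuous_toLp 1 _).comp_aestronglyMeasurable
      (Integrable.of_eval fun i => integrable_slice hΦ (G i).2).1
  have hsm : AEStronglyMeasurable u₁ (volume.restrict Q) :=
    (isometry_gradBar T Φ).isEmbedding.aestronglyMeasurable_comp_iff.1 hs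
  have hnorm : ∀ᵐ x ∂(volume.restrict Q), ‖u₁ x‖ = ∑ i, ‖slice μ Φ (G i) x‖ := by
    filter_upwards [hu₁'] with x hx
    rw [← norm_gradBar, hx, PiLp.norm_eq_of_L1]
  refine ⟨k, w₀ none, fun i => T.invExp (ξ i), u₁, G, hk, fun i => hU.hasWeakDeriv_invExp hΦ i,
    ?_, ?_, ?_, ?_, fun i => ?_, fun h => ?_⟩
  · filter_upwards [hU.ae_slice_mem_invariants hΦ hQ, memOrlicz_slice (w₀ none).2,
      ae_all_iff.2 fun i => T.ae_slice_invExp_mem hΦ hQ (ξ i),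
      ae_all_iff.2 fun i => memOrlicz_slice (T.invExp (ξ i)).2] with x h1 h2 h3 h4
    exact ⟨T.comp_ae_eq_of_mem_invariants h1 (coe_slice h2),
      fun i => T.comp_ae_eq_of_mem_invariants (h3 i) (coe_slice (h4 i))⟩
  · have hi : Integrable (fun x => ∑ i, ‖slice μ Φ (G i) x‖) (volume.restrict Q) :=
      integrable_finsetSum _ fun i _ => (integrable_slice hΦ (G i).2).norm
    exact hi.mono' hsm (hnorm.mono fun x hx => hx.le)
  · filter_upwards [hu₁', ae_all_iff.2 fun i => memOrlicz_slice (G i).2] with x h1 h2 i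
    rw [h1]
    exact (coe_slice (h2 i)).symm
  · exact twoScale_of_tendsto_pairing T (fun n => hε (k n)) (hlim none)
  · have e : T.invExp (ξ i) + G i = w₀ (some i) := add_sub_cancel _ _
    change TwoScale T Φ Q (ε ∘ k) (fun n => Du (k n) i) (T.invExp (ξ i) + G i)
    rw [e]
    exact twoScale_of_tendsto_pairing T (fun n => hε (k n)) (hlim (some i))
  · refine (MemOrlicz.sum Finset.univ fun i => memOrlicz_norm_slice hΦ h (G i)).mono Φ hsm ?_
    filter_upwards [hnorm] with x hx
    rw [← NNReal.coe_le_coe, coe_nnnorm, coe_nnnorm, hx, Finset.sum_apply]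
    exact le_abs_self _

end StochTwoScale

theorem theorem3 {N : ℕ} {Ω : Type*} [MeasurableSpace Ω] (μ : Measure Ω) [IsProbabilityMeasure μ]
    (T : DynamicalSystem N μ)
    (Q : Set (EuclideanSpace ℝ (Fin N))) (hQ : IsOpen Q) (hQb : Bornology.IsBounded Q)
    (Φ : YoungFunction) (hΦ : Delta2 Φ) (hΦ' : Delta2 Φ.conj)
    (ε : ℕ → ℝ) (hε : ∀ n, 0 < ε n) (hε₀ : Tendsto ε atTop (𝓝 0))
    (u : ℕ → Orlicz Φ (prodMeasure Q μ)) (Du : ℕ → Fin N → Orlicz Φ (prodMeasure Q μ))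
    (hDu : ∀ n i, HasWeakDeriv Q μ i (u n) (Du n i))
    (hub : ∃ C : ℝ, ∀ n, ‖u n‖ ≤ C) (hDub : ∃ C : ℝ, ∀ n i, ‖Du n i‖ ≤ C) :
    ∃ (k : ℕ → ℕ) (u₀ : Orlicz Φ (prodMeasure Q μ)) (Du₀ : Fin N → Orlicz Φ (prodMeasure Q μ))
      (u₁ : EuclideanSpace ℝ (Fin N) → WSharp T Φ) (G : Fin N → Orlicz Φ (prodMeasure Q μ)),
      StrictMono k ∧
      -- `u₀ ∈ W¹L^Φ_{D_x}(Q; I_nv^Φ(Ω))`, with gradient `Du₀`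
      (∀ i, HasWeakDeriv Q μ i u₀ (Du₀ i)) ∧
      (∀ᵐ x ∂(volume.restrict Q), MemInv T Φ (fun ω => u₀ (x, ω)) ∧
        ∀ i, MemInv T Φ (fun ω => Du₀ i (x, ω))) ∧
      -- `u₁ ∈ L¹(Q; W¹_#L^Φ(Ω))`, and `G ∈ L^Φ(Q × Ω)ᴺ` is `(x, ω) ↦ D̄_ω u₁(x)(ω)`
      Integrable u₁ (volume.restrict Q) ∧
      (∀ᵐ x ∂(volume.restrict Q), ∀ i, (fun ω => G i (x, ω)) =ᵐ[μ] gradBar T Φ (u₁ x) i) ∧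
      -- the convergences along the subsequence
      TwoScale T Φ Q (ε ∘ k) (u ∘ k) u₀ ∧
      (∀ i, TwoScale T Φ Q (ε ∘ k) (fun n => Du (k n) i) (Du₀ i + G i)) ∧
      -- `u₁ ∈ L^Φ(Q; W¹_#L^Φ(Ω))` when `Φ̃ ∈ Δ'`
      (DeltaPrime Φ.conj → MemOrlicz Φ u₁ (volume.restrict Q)) := by
  have hfin : IsFiniteMeasure (volume.restrict Q) := ⟨by
    rw [Measure.restrict_apply_univ]
    exact hQb.measure_lt_top⟩
  exact exists_twoScale_limit T hQ hΦ hΦ' hε hε₀ u Du hDu hub hDub
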